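/- Let $k\ge 4$, let $\sigma\subset\mathbb R^2$ be a regular $k$-gon with circumradius $R>0$ (the radius of its smallest enclosing disk), let $\mathcal P\subset\mathbb R^2$ be a set of $n$ points, and write $\sigma(c)$ for the translate of $\sigma$ with centre $c$. Let $d_\sigma(x,y)=\min\{\lambda\ge 0: y\in x+\lambda(\sigma-o_\sigma)\}$, where $o_\sigma$ is the centre of $\sigma$. The algorithm $ES$ for $(\sigma,\mathcal P)$ is the following. Preprocessing (from $\sigma$ and $\mathcal P$ only). 1. Put $\ell=R/4$, $t=\frac94R$ if $k\in\{5,6\}$, and $\ell=R/2$, $t=\frac52R$ otherwise. Partition the plane by a grid of (half-open) square tiles of side length $\ell$ such that every point of $\mathcal P$ lies in the interior of a tile. The direction of the grid is arbitrary, except that for $k=4$ the tiles are parallel to the sides of $\sigma$. 2. For each tile $s$ let $o_{s,1},\dots,o_{s,4}$ be, in any order, the centres of the four quadrants of the square of side length $t$ that is concentric with $s$ and parallel to it. Let $V_{s,\tau}$ be the set of all $p\in\mathcal P\cap s$ for which there is a point $c$ with $o_{s,\tau}\in\sigma(c)$ and $p\in\partial\sigma(c)$ that lies in the interior of the Voronoi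 cell $\{x: d_\sigma(x,p)\le d_\sigma(x,q)\ \text{for all } q\in\mathcal P\cap s\}$. 3. The grid is placed such that the points of each $V_{s,\tau}$ are seen from $o_{s,\tau}$ under distinct angles. Let $G_{s,\tau}$ be the path graph on $V_{s,\tau}$ that joins consecutive points in the order of these angles, measured in $(-\pi,\pi]$ from one side direction of the grid, and let $c_{s,\tau}$ be a vertex ranking of $G_{s,\tau}$ with colours $1,\dots,\lfloor\log_2(2|V_{s,\tau}|)\rfloor$, that is, a colouring such that every simple path between two distinct vertices of the same colour has an internal vertex of larger colour. Online phase. Start with $\mathcal H=\emptyset$. When a translate $\sigma(c)$ arrives that already contains a point of $\mathcal H$, do nothing. Otherwise, for each tile $s$ with $\sigma(c)\cap\mathcal P\cap s\ne\emptyset$, let $\tau$ be the least index with $o_{s,\tau}\in\sigma(c)$, and add to $\mathcal H$ the point of $\sigma(c)\cap V_{s,\tau}$ with the largest colour $c_{s,\tau}$. Theorem. For every allowed direction of the grid the preprocessing can be carried out. Whatever choices are made in it, the maximum number $m_\sigma$ of tiles that a translate of $\sigma$ can intersect satisfies $m_\sigma\le 63$, and for every finite sequence of translates of $\sigma$ (those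 that contain no point of $\mathcal P$ being ignored) the set $\mathcal H\subseteq\mathcal P$ obtained by $ES$ hits all of them and satisfies $$|\mathcal H|\le 4\,m_\sigma\,\lfloor\log_2 2n\rfloor\cdot|\mathcal O|$$ for every set $\mathcal O\subseteq\mathcal P$ that hits all of them (for $n=0$ the logarithm is read as $0$; then $\mathcal H=\emptyset$). That is, $ES$ has competitive ratio at most $4m_\sigma\lfloor\log_2 2n\rfloor$. -/

import Mathlib

/-- A vertex ranking of `G` with colours `1, …, K`: every simple path joining two distinct
vertices of the same colour has an internal vertex of larger colour. -/
def IsVertexRanking {V : Type*} (G : SimpleGraph V) (K : ℕ) (c : V → ℕ) : Prop :=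
  (∀ v, 1 ≤ c v ∧ c v ≤ K) ∧
    ∀ x y, x ≠ y → c x = c y → ∀ w : G.Walk x y, w.IsPath →
      ∃ z ∈ w.support, z ≠ x ∧ z ≠ y ∧ c x < c z

namespace OnlineHitting

/-! The Euclidean plane is `ℂ`. -/

/-- The `j`-th vertex of the regular `k`-gon with centre `0`, circumradius `R` and rotation
angle `φ`. -/
noncomputable def vertex (k : ℕ) (R φ : ℝ) (j : ℕ) : ℂ :=
  R * Complex.exp ((φ + 2 * Real.pi * j / k) * Complex.I)

/-- The regular `k`-gon with centre `0`, circumradius `R` and rotation angle `φ`. Its smallest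
enclosing disk has radius `R`. -/
noncomputable def polygon (k : ℕ) (R φ : ℝ) : Set ℂ :=
  convexHull ℝ (Set.range fun j : Fin k => vertex k R φ j)

/-- The translate of `σ` centred at `c`. -/
def copyAt (σ : Set ℂ) (c : ℂ) : Set ℂ := (fun z => c + z) '' σ

/-- The translate of the reflected copy `-σ` centred at `c`. -/
def reflAt (σ : Set ℂ) (c : ℂ) : Set ℂ := (fun z => c - z) '' σ

/-- The convex distance function induced by `σ`: the least scaling factor for which the scaled
copy of `σ` centred at `x` reaches `y`. -/
noncomputable def convexDist (σ : Set ℂ) (x y : ℂ) : ℝ := gauge σ (y - x)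

/-- Side length of the tiles. -/
noncomputable def tileSide (k : ℕ) (R : ℝ) : ℝ :=
  if k = 5 ∨ k = 6 then R / 4 else R / 2

/-- Side length of the super-squares. -/
noncomputable def superSide (k : ℕ) (R : ℝ) : ℝ :=
  if k = 5 ∨ k = 6 then 9 / 4 * R else 5 / 2 * R

/-- The directions `u` allowed for a side of the tiles: any unit vector if `k ≠ 4`; if the
`k`-gon is a square then the tiles are parallel to its sides. -/
def GridDirection (k : ℕ) (R φ : ℝ) (u : ℂ) : Prop :=
  ‖u‖ = 1 ∧ (k = 4 → ∃ r : ℝ, vertex k R φ 1 - vertex k R φ 0 = r * u)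

/-- The half-open square tile with index `s` of the tiling of the plane by squares of side
length `ℓ` with sides parallel to `u` and `i u`, one of whose corners is `a`. -/
def tile (ℓ : ℝ) (u a : ℂ) (s : ℤ × ℤ) : Set ℂ :=
  {z | s.1 * ℓ ≤ ((z - a) / u).re ∧ ((z - a) / u).re < (s.1 + 1) * ℓ ∧
       s.2 * ℓ ≤ ((z - a) / u).im ∧ ((z - a) / u).im < (s.2 + 1) * ℓ}

/-- The centre of a tile. -/
noncomputable def tileCenter (ℓ : ℝ) (u a : ℂ) (s : ℤ × ℤ) : ℂ :=
  a + u * (((s.1 + 1 / 2) * ℓ : ℝ) + ((s.2 + 1 / 2) * ℓ : ℝ) * Complex.I)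

/-- The four sign patterns of the quadrants, counterclockwise. -/
def quadrantSign : Fin 4 → ℝ × ℝ := ![(1, 1), (-1, 1), (-1, -1), (1, -1)]

/-- The centre of a quadrant of the super-square of side length `t` concentric with the tile. -/
noncomputable def quadrantCenter (ℓ t : ℝ) (u a : ℂ) (s : ℤ × ℤ) (q : Fin 4) : ℂ :=
  tileCenter ℓ u a s +
    u * (((quadrantSign q).1 * (t / 4) : ℝ) + ((quadrantSign q).2 * (t / 4) : ℝ) * Complex.I)

/-- The Voronoi cell of `p` among the points of `P` in the tile `T`, with respect to the convex
distance function induced by `σ`. -/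
def voronoiCell (σ : Set ℂ) (P : Finset ℂ) (T : Set ℂ) (p : ℂ) : Set ℂ :=
  {x | ∀ q ∈ P, q ∈ T → convexDist σ x p ≤ convexDist σ x q}

open Classical in
/-- The extreme points of `P` in the tile `T` with respect to the quadrant centre `o`, as they
are computed from `P` alone: `p` is extreme if some copy of `σ` that contains `o` and has `p` on
its boundary is centred in the interior of the Voronoi cell of `p`. -/
noncomputable def extremePoints (σ : Set ℂ) (P : Finset ℂ) (T : Set ℂ) (o : ℂ) : Finset ℂ :=
  P.filter fun p => p ∈ T ∧
    (reflAt σ o ∩ frontier (reflAt σ p) ∩ interior (voronoiCell σ P T p)).Nonempty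

/-- The outcome of the preprocessing of the algorithm for the `k`-gon `polygon k R φ` and the
point set `P`, with tiles parallel to `u`. It involves no input object. -/
structure Preprocessing (k : ℕ) (R φ : ℝ) (P : Finset ℂ) (u : ℂ) where
  /-- position of the tiling -/
  a : ℂ
  /-- every point of `P` lies in the interior of a tile -/
  mem_interior : ∀ p ∈ P, ∃ s, p ∈ interior (tile (tileSide k R) u a s)
  /-- numbering of the quadrants -/
  label : Equiv.Perm (Fin 4)
  /-- listing of each set of extreme points -/
  order : ∀ (s : ℤ × ℤ) (τ : Fin 4),
    Fin (extremePoints (polygon k R φ) P (tile (tileSide k R) u a s)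
      (quadrantCenter (tileSide k R) (superSide k R) u a s (label τ))).card ≃
    extremePoints (polygon k R φ) P (tile (tileSide k R) u a s)
      (quadrantCenter (tileSide k R) (superSide k R) u a s (label τ))
  /-- the extreme points are listed by increasing angle, as seen from the quadrant centre -/
  order_strictMono : ∀ s τ, StrictMono fun i =>
    Complex.arg (((order s τ i : ℂ) -
      quadrantCenter (tileSide k R) (superSide k R) u a s (label τ)) / u)
  /-- colouring of each set of extreme points -/
  rank : ∀ (s : ℤ × ℤ) (τ : Fin 4),
    extremePoints (polygon k R φ) P (tile (tileSide k R) u a s)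
      (quadrantCenter (tileSide k R) (superSide k R) u a s (label τ)) → ℕ
  /-- the colouring is a vertex ranking of the path graph along the listing, with
  `⌊log₂ (2 |V|)⌋` colours -/
  rank_isVertexRanking : ∀ s τ, IsVertexRanking
    ((SimpleGraph.pathGraph _).comap (order s τ).symm)
    (Nat.log 2 (2 * (extremePoints (polygon k R φ) P (tile (tileSide k R) u a s)
      (quadrantCenter (tileSide k R) (superSide k R) u a s (label τ))).card))
    (rank s τ)

namespace Preprocessing

variable {k : ℕ} {R φ : ℝ} {P : Finset ℂ} {u : ℂ} (D : Preprocessing k R φ P u)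

/-- The tile with index `s`. -/
noncomputable def tileAt (s : ℤ × ℤ) : Set ℂ := tile (tileSide k R) u D.a s

/-- The centre `o_τ` of the quadrant with number `τ` of the super-square of the tile `s`. -/
noncomputable def quad (s : ℤ × ℤ) (τ : Fin 4) : ℂ :=
  quadrantCenter (tileSide k R) (superSide k R) u D.a s (D.label τ)

/-- The set `V_{s,τ}` of extreme points. -/
noncomputable def extreme (s : ℤ × ℤ) (τ : Fin 4) : Finset ℂ :=
  extremePoints (polygon k R φ) P (D.tileAt s) (D.quad s τ)

/-- `τ` is the type, with respect to the tile `s`, of the translate centred at `c`: the least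
`τ` such that the translate contains `o_τ`. -/
def IsType (s : ℤ × ℤ) (c : ℂ) (τ : Fin 4) : Prop :=
  D.quad s τ ∈ copyAt (polygon k R φ) c ∧
    ∀ τ' < τ, D.quad s τ' ∉ copyAt (polygon k R φ) c

open Classical in
/-- The points selected for an unstabbed translate centred at `c`: from each tile, the point of
largest colour among the extreme points of the type of the translate that the translate
contains. -/
noncomputable def selected (c : ℂ) : Finset ℂ :=
  P.filter fun v => ∃ (s : ℤ × ℤ) (τ : Fin 4) (hv : v ∈ D.extreme s τ),
    D.IsType s c τ ∧ v ∈ copyAt (polygon k R φ) c ∧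
      ∀ (w : ℂ) (hw : w ∈ D.extreme s τ), w ∈ copyAt (polygon k R φ) c →
        D.rank s τ ⟨w, hw⟩ ≤ D.rank s τ ⟨v, hv⟩

open Classical in
/-- One step of the algorithm: the translate centred at `c` arrives when `H` is the current
hitting set. -/
noncomputable def step (H : Finset ℂ) (c : ℂ) : Finset ℂ :=
  if ∃ p ∈ H, p ∈ copyAt (polygon k R φ) c then H else H ∪ D.selected c

/-- The hitting set maintained by the algorithm after the translates with centres listed in `I`
have arrived one by one. -/
noncomputable def run (I : List ℂ) : Finset ℂ := I.foldl D.step ∅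

/-- The maximum number of tiles that a translate can intersect. -/
noncomputable def maxTiles : ℕ∞ :=
  ⨆ c : ℂ, {s : ℤ × ℤ | (copyAt (polygon k R φ) c ∩ D.tileAt s).Nonempty}.encard

end Preprocessing

/-- `H` is a feasible solution for the translates of `σ` with centres in `I`: a subset of `P`
that hits all of them (those that contain no point of `P` are ignored). -/
def IsHittingSet (σ : Set ℂ) (P : Finset ℂ) (I : List ℂ) (H : Finset ℂ) : Prop :=
  H ⊆ P ∧ ∀ c ∈ I, (∃ p ∈ P, p ∈ copyAt σ c) → ∃ p ∈ H, p ∈ copyAt σ c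

end OnlineHitting

/-!
The algorithm is analysed tile by tile. A translate that meets a tile contains one of the four
quadrant centres `o` of its super-square (`exists_quadrantCenter_mem`), which gives it a type.
Everything then rests on one geometric fact: two translates that both contain `o` cannot cross
twice inside the tile. This is proved for an abstract convex body `K` in the form `no_crossing`.
The property of `K` and of the tile that is needed is `CrossingFree`: if two points of the tile lie
in a translate but not in the interior of another one, both containing `o`, then the translation
between them is not in the cone of the directions from `o` to the two points. It holds for a square
with sides parallel to the grid by a look at the coordinates. For a `k`-gon with `k ≥ 5`, which
lies between two concentric disks of similar radii, it holds because the tile is small and lies far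
enough from `o`: the supporting lines at the two points would have to be too close to the centre
(`crossingFree_polygon`).

There are two consequences.

* Extreme points exist: a translate that contains `o` and a point of the tile contains an extreme
  point (`exists_mem_extremePoints`). By induction on the number of points in the translate, it is
  moved, without gaining points and with `o` in its interior, until a point `p` of it lies on its
  boundary. The positions in which a point on one side of the line `o p`, or on the other, is
  gained form closed sets, and a connectedness argument shows that they do not cover all positions,
  since two translates would cross in a common one (`exists_mem_boundary`). Then the translate is
  moved off `p`. If it loses all its points thereby, then, as finitely many closed Voronoi cells
  cover an open set of centres, one of these points has a Voronoi cell with interior points there,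
  and it is extreme.
* The extreme points in a translate are contiguous in the order of their angles
  (`mem_copyAt_of_between`), and so are those in the union of two translates with a common point in
  the tile (`Preprocessing.mem_copyAt_or_mem_copyAt`). Points that are seen under the same angle
  need a separate argument (`mem_copyAt_of_collinear`).

As two extreme points of the same colour have one of larger colour between them, a translate
contains a unique extreme point of largest colour, and two translates of the same type that share a
point of the tile and have the same largest colour share this extreme point
(`Preprocessing.isTop_eq_isTop`). So the second of them is already hit when it arrives. Hence a
point of a feasible solution is contained in at most `4 ⌊log₂ 2n⌋` of the translates for which
points are added, one for each type and colour, and for each of them at most one point per tile is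
added.

The preprocessing exists because the bad positions of the grid lie on countably many lines, and the
ruler sequence is a vertex ranking of a path. The bound `63` for the number of tiles is clear if
the circumradius is two side lengths. For the pentagon and the hexagon, with a circumradius of four
side lengths, all tiles lie in a window of `9 × 9` tiles, up to symmetry the rotation angle ranges
over a short interval, and at least `18` tiles of the window are missed: pairs of tiles that are
too far apart, and tiles that lie beyond an edge (`tileBound_six`, `tileBound_five`).
-/

namespace OnlineHitting

/-! ### Vertex rankings of paths -/

/-- In a path graph, listed by `e`, every walk from `x` to `y` visits every vertex listed between
them. -/
theorem mem_support_of_between {V : Type*} {n : ℕ} (e : V ≃ Fin n) {x y : V}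
    (w : ((SimpleGraph.pathGraph n).comap e).Walk x y) (z : V) (hxz : e x ≤ e z)
    (hzy : e z ≤ e y) : z ∈ w.support := by
  induction w with
  | nil =>
    have : e z = e _ := le_antisymm hzy hxz
    simpa using e.injective this
  | @cons a b c h p ih =>
    rw [SimpleGraph.Walk.support_cons, List.mem_cons]
    by_cases hz : z = a
    · exact Or.inl hz
    · right
      have hne : e a ≠ e z := fun h' => hz (e.injective h').symm
      have hlt : e a < e z := lt_of_le_of_ne hxz hne
      have hadj : (SimpleGraph.pathGraph n).Adj (e a) (e b) := h
      rw [SimpleGraph.pathGraph_adj] at hadj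
      refine ih ?_ hzy
      rw [Fin.lt_def] at hlt
      rw [Fin.le_def]
      omega

/-- Two vertices of a listed path graph are joined by a path through the vertices listed between
them. -/
theorem exists_isPath_between {V : Type*} {n : ℕ} (e : V ≃ Fin n) (x y : V) (hxy : e x ≤ e y) :
    ∃ w : ((SimpleGraph.pathGraph n).comap e).Walk x y, w.IsPath ∧
      ∀ z ∈ w.support, e x ≤ e z ∧ e z ≤ e y := by
  obtain ⟨d, hd⟩ : ∃ d : ℕ, (e y : ℕ) = e x + d := Nat.exists_eq_add_of_le hxy
  induction d generalizing x with
  | zero =>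
    have : x = y := e.injective (Fin.ext (by omega))
    subst this
    exact ⟨.nil, by simp, by simp⟩
  | succ d ih =>
    have hlt : (e x : ℕ) + 1 < n := by have := (e y).isLt; omega
    set x' : V := e.symm ⟨e x + 1, hlt⟩ with hx'
    have hex' : (e x' : ℕ) = e x + 1 := by simp [hx']
    obtain ⟨w, hw, hs⟩ := ih x' (by rw [Fin.le_def]; omega) (by omega)
    have hadj : ((SimpleGraph.pathGraph n).comap e).Adj x x' := by
      rw [SimpleGraph.comap_adj, SimpleGraph.pathGraph_adj]
      omega
    refine ⟨.cons hadj w, ?_, ?_⟩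
    · rw [SimpleGraph.Walk.cons_isPath_iff]
      refine ⟨hw, fun hmem => ?_⟩
      have := (hs x hmem).1
      rw [Fin.le_def] at this
      omega
    · intro z hz
      rw [SimpleGraph.Walk.support_cons, List.mem_cons] at hz
      rcases hz with rfl | hz
      · exact ⟨le_rfl, hxy⟩
      · have := hs z hz
        refine ⟨?_, this.2⟩
        have := this.1
        rw [Fin.le_def] at this ⊢
        omega

/-- Between two vertices of the same colour in a vertex ranking of a path lies one of larger
colour. -/
theorem exists_between_of_isVertexRanking {V : Type*} {n K : ℕ} (e : V ≃ Fin n) {c : V → ℕ}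
    (hc : IsVertexRanking ((SimpleGraph.pathGraph n).comap e) K c) {x y : V} (hxy : e x < e y)
    (h : c x = c y) : ∃ z, e x < e z ∧ e z < e y ∧ c x < c z := by
  obtain ⟨w, hw, hs⟩ := exists_isPath_between e x y hxy.le
  obtain ⟨z, hz, hzx, hzy, hcz⟩ := hc.2 x y (fun h' => hxy.ne (congrArg e h')) h w hw
  refine ⟨z, lt_of_le_of_ne (hs z hz).1 fun h' => hzx (e.injective h').symm,
    lt_of_le_of_ne (hs z hz).2 fun h' => hzy (e.injective h'), hcz⟩

/-- Between two positive integers of the same `2`-adic valuation lies one of larger valuation. -/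
theorem exists_between_padicValNat {a b : ℕ} (ha : 0 < a) (hab : a < b)
    (h : padicValNat 2 a = padicValNat 2 b) :
    ∃ m, a < m ∧ m < b ∧ padicValNat 2 a < padicValNat 2 m := by
  have hb : 0 < b := ha.trans hab
  obtain ⟨x, hx⟩ : 2 ^ padicValNat 2 a ∣ a := pow_padicValNat_dvd
  obtain ⟨y, hy⟩ : 2 ^ padicValNat 2 a ∣ b := by
    rw [h]; exact pow_padicValNat_dvd
  set q := padicValNat 2 a with hq
  have hpos : 0 < 2 ^ q := by positivity
  have hxodd : ¬ 2 ∣ x := by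
    rintro ⟨x', rfl⟩
    have : 2 ^ (q + 1) ∣ a := ⟨x', by rw [hx]; ring⟩
    exact pow_succ_padicValNat_not_dvd ha.ne' this
  have hyodd : ¬ 2 ∣ y := by
    rintro ⟨y', rfl⟩
    have : 2 ^ (padicValNat 2 b + 1) ∣ b := ⟨y', by rw [← h, hy]; ring⟩
    exact pow_succ_padicValNat_not_dvd hb.ne' this
  have hxy : x < y := by
    rw [hx, hy] at hab
    exact lt_of_mul_lt_mul_left hab hpos.le
  obtain ⟨x', hx'⟩ : 2 ∣ x + 1 := by omega
  have hxy' : x + 1 < y := by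
    rcases Nat.lt_or_ge (x + 1) y with h' | h'
    · exact h'
    · exfalso; apply hyodd; omega
  refine ⟨2 ^ q * (x + 1), ?_, ?_, ?_⟩
  · calc a = 2 ^ q * x := hx
      _ < 2 ^ q * (x + 1) := by gcongr; omega
  · calc 2 ^ q * (x + 1) < 2 ^ q * y := by gcongr
      _ = b := hy.symm
  · have hd : 2 ^ (q + 1) ∣ 2 ^ q * (x + 1) := ⟨x', by rw [hx']; ring⟩
    have hne : 2 ^ q * (x + 1) ≠ 0 := by positivity
    have := (padicValNat_dvd_iff_le (p := 2) hne).1 hd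
    omega

/-- A path has a vertex ranking with `⌊log₂ 2n⌋` colours: the ruler sequence. -/
theorem exists_isVertexRanking {V : Type*} {n : ℕ} (e : V ≃ Fin n) :
    ∃ c : V → ℕ, IsVertexRanking ((SimpleGraph.pathGraph n).comap e) (Nat.log 2 (2 * n)) c := by
  refine ⟨fun v => padicValNat 2 (e v + 1) + 1, fun v => ⟨Nat.succ_le_succ (Nat.zero_le _), ?_⟩, ?_⟩
  · have hlt := (e v).isLt
    have h1 : padicValNat 2 (e v + 1) ≤ Nat.log 2 n :=
      Nat.le_log_of_pow_le (by norm_num)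
        ((Nat.le_of_dvd (Nat.succ_pos _) pow_padicValNat_dvd).trans hlt)
    have h2 : Nat.log 2 (2 * n) = Nat.log 2 n + 1 := by
      rw [mul_comm]
      exact Nat.log_mul_base (by norm_num) (by omega)
    dsimp only
    omega
  · have key : ∀ x y : V, e x < e y →
        padicValNat 2 (e x + 1) + 1 = padicValNat 2 (e y + 1) + 1 →
        ∃ z, e x < e z ∧ e z < e y ∧
          padicValNat 2 (e x + 1) + 1 < padicValNat 2 (e z + 1) + 1 := by
      intro x y hlt hc
      rw [Fin.lt_def] at hlt
      obtain ⟨m, h1, h2, h3⟩ := exists_between_padicValNat (a := e x + 1) (b := e y + 1)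
        (by omega) (by omega) (by omega)
      have hm : m - 1 < n := by have := (e y).isLt; omega
      refine ⟨e.symm ⟨m - 1, hm⟩, ?_, ?_, ?_⟩
      · simp only [Equiv.apply_symm_apply, Fin.lt_def]; omega
      · simp only [Equiv.apply_symm_apply, Fin.lt_def]; omega
      · simp only [Equiv.apply_symm_apply]
        rw [show m - 1 + 1 = m by omega]
        omega
    intro x y hne hc w _
    rcases lt_or_gt_of_ne (fun h => hne (e.injective h) : e x ≠ e y) with hlt | hlt
    · obtain ⟨z, h1, h2, h3⟩ := key x y hlt hc
      exact ⟨z, mem_support_of_between e w z h1.le h2.le, fun h => h1.ne (congrArg e h).symm,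
        fun h => h2.ne (congrArg e h), h3⟩
    · obtain ⟨z, h1, h2, h3⟩ := key y x hlt hc.symm
      refine ⟨z, ?_, fun h => h2.ne (congrArg e h), fun h => h1.ne (congrArg e h).symm, ?_⟩
      · have := mem_support_of_between e w.reverse z h1.le h2.le
        simpa using this
      · dsimp only at hc ⊢
        omega

/-! ### Regular polygons -/

theorem convex_polygon (k : ℕ) (R φ : ℝ) : Convex ℝ (polygon k R φ) :=
  convex_convexHull ℝ _

theorem isCompact_polygon (k : ℕ) (R φ : ℝ) : IsCompact (polygon k R φ) :=
  (Set.finite_range _).isCompact_convexHull ℝ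

theorem vertex_eq (k : ℕ) (R φ : ℝ) (j : ℕ) :
    vertex k R φ j = R * (Real.cos (φ + 2 * Real.pi * j / k) : ℝ) +
      R * (Real.sin (φ + 2 * Real.pi * j / k) : ℝ) * Complex.I := by
  have : ((φ : ℂ) + 2 * Real.pi * j / k) = ((φ + 2 * Real.pi * j / k : ℝ) : ℂ) := by push_cast; ring
  rw [vertex, this, Complex.exp_mul_I, ← Complex.ofReal_cos, ← Complex.ofReal_sin]
  ring

theorem vertex_re (k : ℕ) (R φ : ℝ) (j : ℕ) :
    (vertex k R φ j).re = R * Real.cos (φ + 2 * Real.pi * j / k) := by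
  simp [vertex_eq, -Complex.ofReal_cos, -Complex.ofReal_sin]

theorem vertex_im (k : ℕ) (R φ : ℝ) (j : ℕ) :
    (vertex k R φ j).im = R * Real.sin (φ + 2 * Real.pi * j / k) := by
  simp [vertex_eq, -Complex.ofReal_cos, -Complex.ofReal_sin]

/-- A linear inequality holds on a polygon if it holds at its vertices. -/
theorem polygon_le {k : ℕ} {R φ p q M : ℝ}
    (h : ∀ j < k, p * (R * Real.cos (φ + 2 * Real.pi * j / k)) +
      q * (R * Real.sin (φ + 2 * Real.pi * j / k)) ≤ M) {z : ℂ} (hz : z ∈ polygon k R φ) :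
    p * z.re + q * z.im ≤ M := by
  have hconv : Convex ℝ {z : ℂ | p * z.re + q * z.im ≤ M} := by
    have := convex_halfSpace_le (𝕜 := ℝ) (f := fun z : ℂ => p * z.re + q * z.im)
      ⟨fun a b => by simp; ring, fun a b => by simp; ring⟩ M
    exact this
  refine convexHull_min ?_ hconv hz
  rintro _ ⟨j, rfl⟩
  simpa [vertex_re, vertex_im] using h j j.2

theorem norm_le_of_mem_polygon {k : ℕ} {R φ : ℝ} (hR : 0 ≤ R) {z : ℂ} (hz : z ∈ polygon k R φ) :
    ‖z‖ ≤ R := by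
  have : polygon k R φ ⊆ Metric.closedBall 0 R := by
    refine convexHull_min ?_ (convex_closedBall _ _)
    rintro _ ⟨j, rfl⟩
    simp only [Metric.mem_closedBall, dist_zero_right]
    have h : ((φ : ℂ) + 2 * Real.pi * (j : ℕ) / k) = ((φ + 2 * Real.pi * (j : ℕ) / k : ℝ) : ℂ) := by
      push_cast; ring
    rw [vertex, norm_mul, h, Complex.norm_exp_ofReal_mul_I, mul_one, Complex.norm_real,
      Real.norm_of_nonneg hR]
  simpa using this hz

/-- Every real linear functional on the plane is a linear combination of the coordinates. -/
theorem clm_apply_eq (f : ℂ →L[ℝ] ℝ) (z : ℂ) : f z = f 1 * z.re + f Complex.I * z.im := by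
  conv_lhs => rw [← Complex.re_add_im z]
  have h1 : (z.re : ℂ) = z.re • (1 : ℂ) := by simp
  have h2 : (z.im : ℂ) * Complex.I = z.im • Complex.I := by simp
  rw [map_add, h1, h2, map_smul, map_smul, smul_eq_mul, smul_eq_mul]
  ring

/-- The disk of radius `R cos (π / k)` lies in the regular `k`-gon: every direction makes an angle
of at most `π / k` with the direction of some vertex. -/
theorem mem_polygon_of_norm_le {k : ℕ} (hk : 0 < k) {R φ : ℝ} (hR : 0 ≤ R) {z : ℂ}
    (hz : ‖z‖ ≤ R * Real.cos (Real.pi / k)) : z ∈ polygon k R φ := by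
  by_contra hnot
  obtain ⟨f, v, hf, hv⟩ := geometric_hahn_banach_closed_point (convex_polygon k R φ)
    (isCompact_polygon k R φ).isClosed hnot
  set n : ℂ := ⟨f 1, f Complex.I⟩ with hn
  have hkpos : (0 : ℝ) < k := by exact_mod_cast hk
  have hpi := Real.pi_pos
  have hre : f 1 = ‖n‖ * Real.cos n.arg := by rw [Complex.norm_mul_cos_arg]
  have him : f Complex.I = ‖n‖ * Real.sin n.arg := by rw [Complex.norm_mul_sin_arg]
  set m : ℤ := round ((n.arg - φ) * k / (2 * Real.pi)) with hm
  have hround : |(n.arg - φ) * k / (2 * Real.pi) - m| ≤ 1 / 2 := abs_sub_round _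
  have hang : |φ + 2 * Real.pi * m / k - n.arg| ≤ Real.pi / k := by
    have h1 : φ + 2 * Real.pi * m / k - n.arg =
        -(2 * Real.pi / k) * ((n.arg - φ) * k / (2 * Real.pi) - m) := by
      field_simp
      ring
    rw [h1, abs_mul, abs_neg, abs_of_pos (by positivity)]
    calc 2 * Real.pi / k * |(n.arg - φ) * k / (2 * Real.pi) - m|
        ≤ 2 * Real.pi / k * (1 / 2) := by gcongr
      _ = Real.pi / k := by ring
  have hcos : Real.cos (Real.pi / k) ≤ Real.cos (φ + 2 * Real.pi * m / k - n.arg) := by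
    rw [← Real.cos_abs (φ + 2 * Real.pi * m / k - n.arg)]
    refine Real.cos_le_cos_of_nonneg_of_le_pi (abs_nonneg _) ?_ hang
    exact div_le_self hpi.le (by exact_mod_cast hk)
  have hkz : (k : ℤ) ≠ 0 := by exact_mod_cast hk.ne'
  obtain ⟨j, hj⟩ : ∃ j : ℕ, (j : ℤ) = m % k := ⟨(m % k).toNat, Int.toNat_of_nonneg
    (Int.emod_nonneg _ hkz)⟩
  have hjk : j < k := by
    have := Int.emod_lt_of_pos m (by exact_mod_cast hk : (0 : ℤ) < k)
    omega
  have hmj : (m : ℝ) = j + k * (m / k : ℤ) := by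
    have := Int.emod_add_mul_ediv m k
    rw [← hj] at this
    exact_mod_cast this.symm
  have hcos' : Real.cos (φ + 2 * Real.pi * m / k - n.arg) =
      Real.cos (φ + 2 * Real.pi * j / k - n.arg) := by
    have : φ + 2 * Real.pi * m / k - n.arg =
        φ + 2 * Real.pi * j / k - n.arg + (m / k : ℤ) * (2 * Real.pi) := by
      rw [hmj]; field_simp; ring
    rw [this, Real.cos_add_int_mul_two_pi]
  have hvert : vertex k R φ j ∈ polygon k R φ := subset_convexHull ℝ _ ⟨⟨j, hjk⟩, rfl⟩
  have h1 : f (vertex k R φ j) = ‖n‖ * (R * Real.cos (φ + 2 * Real.pi * j / k - n.arg)) := by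
    rw [clm_apply_eq f, hre, him, vertex_re, vertex_im, Real.cos_sub]
    ring
  have h2 : f z ≤ ‖n‖ * ‖z‖ := by
    have : f z = (n * (starRingEnd ℂ) z).re := by
      rw [clm_apply_eq f]; simp [hn]
    rw [this]
    calc (n * (starRingEnd ℂ) z).re ≤ ‖n * (starRingEnd ℂ) z‖ := Complex.re_le_norm _
      _ = ‖n‖ * ‖z‖ := by rw [norm_mul, Complex.norm_conj]
  have h3 : ‖n‖ * ‖z‖ ≤ f (vertex k R φ j) := by
    rw [h1]
    refine mul_le_mul_of_nonneg_left (hz.trans ?_) (norm_nonneg _)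
    rw [← hcos']
    exact mul_le_mul_of_nonneg_left hcos hR
  linarith [hf _ hvert]

/-- In coordinates parallel to its sides, the regular `4`-gon is an axis-parallel square. -/
theorem mem_polygon_four {R φ : ℝ} (hR : 0 < R) {u : ℂ} (hu : ‖u‖ = 1) {r : ℝ}
    (hr : vertex 4 R φ 1 - vertex 4 R φ 0 = r * u) (z : ℂ) :
    z ∈ polygon 4 R φ ↔ |(z / u).re| ≤ R / √2 ∧ |(z / u).im| ≤ R / √2 := by
  have hu0 : u ≠ 0 := by rintro rfl; simp at hu
  have hvj : ∀ j : ℕ, vertex 4 R φ j = vertex 4 R φ 0 * Complex.I ^ j := by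
    intro j
    have : ((φ : ℂ) + 2 * Real.pi * j / (4 : ℕ)) * Complex.I =
        ((φ : ℂ) + 2 * Real.pi * (0 : ℕ) / (4 : ℕ)) * Complex.I +
          j * (Real.pi / 2 * Complex.I) := by push_cast; ring
    unfold vertex
    rw [this, Complex.exp_add, Complex.exp_nat_mul, Complex.exp_pi_div_two_mul_I]
    ring
  set s : ℝ := -r / 2 with hs
  have hv0 : vertex 4 R φ 0 = s * u * (1 + Complex.I) := by
    have h1 := hvj 1
    rw [pow_one] at h1
    rw [h1] at hr
    have hI : Complex.I * Complex.I = -1 := Complex.I_mul_I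
    have : (s : ℂ) = -r / 2 := by simp [hs]
    rw [this]
    linear_combination (-(1 + Complex.I) / 2) * hr + (vertex 4 R φ 0 / 2) * hI
  have hnv0 : ‖vertex 4 R φ 0‖ = R := by
    have h : ((φ : ℂ) + 2 * Real.pi * (0 : ℕ) / (4 : ℕ)) = (φ : ℂ) := by push_cast; ring
    rw [vertex, norm_mul, h, Complex.norm_exp_ofReal_mul_I, mul_one, Complex.norm_real,
      Real.norm_of_nonneg hR.le]
  have hsabs : |s| = R / √2 := by
    have h1 : ‖(1 + Complex.I : ℂ)‖ = √2 := by
      rw [Complex.norm_def]; congr 1; simp [Complex.normSq_apply]; norm_num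
    rw [hv0, norm_mul, norm_mul, hu, mul_one, Complex.norm_real, h1, Real.norm_eq_abs] at hnv0
    rw [← hnv0]
    field_simp
  have hspos : 0 < |s| := by rw [hsabs]; positivity
  have hs0 : s ≠ 0 := abs_pos.1 hspos
  have hI2 : Complex.I ^ 2 = -1 := Complex.I_sq
  have hI3 : Complex.I ^ 3 = -Complex.I := Complex.I_pow_three
  rw [← hsabs]
  constructor
  · intro hz
    have hconv : Convex ℝ {z : ℂ | |(z / u).re| ≤ |s| ∧ |(z / u).im| ≤ |s|} := by
      intro v hv w hw α β hα hβ hαβ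
      have hdiv : (α • v + β • w) / u = α * (v / u) + β * (w / u) := by
        simp only [Complex.real_smul]; ring
      simp only [Set.mem_ofPred_eq, abs_le] at hv hw ⊢
      obtain ⟨⟨h1, h2⟩, h3, h4⟩ := hv
      obtain ⟨⟨h5, h6⟩, h7, h8⟩ := hw
      rw [hdiv]
      simp only [Complex.add_re, Complex.re_ofReal_mul, Complex.add_im, Complex.im_ofReal_mul]
      have hβ' : β = 1 - α := by linarith
      subst hβ'
      refine ⟨⟨?_, ?_⟩, ?_, ?_⟩ <;> nlinarith
    refine convexHull_min ?_ hconv hz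
    rintro _ ⟨j, rfl⟩
    have hdiv : vertex 4 R φ j / u = s * ((1 + Complex.I) * Complex.I ^ (j : ℕ)) := by
      rw [hvj, hv0]; field_simp
    simp only [Set.mem_ofPred_eq, hdiv]
    fin_cases j <;> simp [hI2, hI3]
  · rintro ⟨hx, hy⟩
    set x : ℝ := (z / u).re / s with hxd
    set y : ℝ := (z / u).im / s with hyd
    have hx1 : |x| ≤ 1 := by rw [hxd, abs_div]; exact div_le_one_of_le₀ hx (abs_nonneg _)
    have hy1 : |y| ≤ 1 := by rw [hyd, abs_div]; exact div_le_one_of_le₀ hy (abs_nonneg _)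
    rw [abs_le] at hx1 hy1
    have hzx : z = s * u * (x + y * Complex.I) := by
      have hsx : s * x = (z / u).re := by rw [hxd]; field_simp
      have hsy : s * y = (z / u).im := by rw [hyd]; field_simp
      have h1 : z / u = s * (x + y * Complex.I) := by
        rw [← Complex.re_add_im (z / u), ← hsx, ← hsy]
        push_cast
        ring
      rw [div_eq_iff hu0] at h1
      rw [h1]; ring
    have hmem : ∀ j : Fin 4, vertex 4 R φ 0 * Complex.I ^ (j : ℕ) ∈ polygon 4 R φ := fun j => by
      rw [← hvj]; exact subset_convexHull ℝ _ ⟨j, rfl⟩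
    have hc := convex_polygon 4 R φ
    have hA := hc (hmem 0) (hmem 1) (a := (1 + x) / 2) (b := (1 - x) / 2) (by linarith)
      (by linarith) (by ring)
    have hB := hc (hmem 3) (hmem 2) (a := (1 + x) / 2) (b := (1 - x) / 2) (by linarith)
      (by linarith) (by ring)
    have hC := hc hA hB (a := (1 + y) / 2) (b := (1 - y) / 2) (by linarith)
      (by linarith) (by ring)
    convert hC using 1
    rw [hzx, hv0]
    simp only [Complex.real_smul, Fin.val_zero, Fin.val_one, Fin.val_two, pow_zero, pow_one, hI2,
      show ((3 : Fin 4) : ℕ) = 3 from rfl, hI3]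
    push_cast
    linear_combination (-(1 + y) / 2 * (1 - x) / 2 * (s * u) + (1 - y) / 2 * (1 + x) / 2 * (s * u) )
      * hI2

/-! ### Crossings of two translates -/

/-- The determinant of two plane vectors. -/
def cross (a b : ℂ) : ℝ := a.re * b.im - a.im * b.re

/-- The condition on a convex body `K` and a set `S` of vectors under which two translates of `K`
that contain a point `o` cannot cross twice inside `o + S`. The translates are `x + w - K` and
`x - K` as seen from `o`. -/
def CrossingFree (K S : Set ℂ) : Prop :=
  ∀ α ∈ S, ∀ δ ∈ S, cross α δ ≠ 0 → ∀ x ∈ K, ∀ p q : ℝ, 0 ≤ p → 0 ≤ q → p • α + q • δ ≠ 0 →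
    x + (p • α + q • δ) + α ∈ K → x + (p • α + q • δ) + δ ∈ K →
    x + α ∈ interior K ∨ x + δ ∈ interior K

/-- A supporting functional at a point outside the interior of a convex body. -/
theorem exists_support {K : Set ℂ} (hK : Convex ℝ K) (hint : (interior K).Nonempty) {y : ℂ}
    (hy : y ∉ interior K) : ∃ f : ℂ →L[ℝ] ℝ, f ≠ 0 ∧ ∀ z ∈ K, f z ≤ f y := by
  obtain ⟨f, hf⟩ := geometric_hahn_banach_open_point hK.interior isOpen_interior hy
  refine ⟨f, ?_, fun z hz => ?_⟩
  · rintro rfl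
    obtain ⟨z, hz⟩ := hint
    simpa using hf z hz
  · have hz' : z ∈ closure (interior K) := by
      rw [hK.closure_interior_eq_closure_of_nonempty_interior hint]
      exact subset_closure hz
    have hcl : IsClosed {z | f z ≤ f y} := isClosed_le f.continuous continuous_const
    exact closure_minimal (fun w hw => (hf w hw).le) hcl hz'

/-- Two independent vectors span the plane. -/
theorem eq_zero_of_apply_eq_zero {α δ : ℂ} (h : cross α δ ≠ 0) {f : ℂ →L[ℝ] ℝ} (hα : f α = 0)
    (hδ : f δ = 0) : f = 0 := by
  rw [clm_apply_eq] at hα hδ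
  have h1 : f 1 * cross α δ = 0 := by unfold cross; linear_combination δ.im * hα - α.im * hδ
  have h2 : f Complex.I * cross α δ = 0 := by
    unfold cross; linear_combination α.re * hδ - δ.re * hα
  ext z
  rw [clm_apply_eq, (mul_eq_zero.1 h1).resolve_right h, (mul_eq_zero.1 h2).resolve_right h]
  simp

/-- Two translates of a convex body that both contain `o` cannot cross in such a way that the
first contains `a` and `d`, which are not interior to the second, whereas the second contains a
point `b` between the directions of `a` and `d` that is not in the first. In the statement
everything is seen from the centre of the second translate; `α, δ, β` are `a - o, d - o, b - o`,
`x` is `o` and `-w` is the translation from the first to the second body. -/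
theorem no_crossing {K S : Set ℂ} (hK : Convex ℝ K) (hint : (interior K).Nonempty)
    (hgood : CrossingFree K S) {x α δ : ℂ} (hα : α ∈ S) (hδ : δ ∈ S) (hαδ : cross α δ ≠ 0)
    {p q lam mu : ℝ} (hx : x ∈ K) (hxw : x + (p • α + q • δ) ∈ K)
    (ha : x + (p • α + q • δ) + α ∈ K) (hd : x + (p • α + q • δ) + δ ∈ K)
    (ha' : x + α ∉ interior K) (hd' : x + δ ∉ interior K)
    (hb' : x + (lam • α + mu • δ) ∈ K) (hb : x + (p • α + q • δ) + (lam • α + mu • δ) ∉ K)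
    (hlam : 0 ≤ lam) (hmu : 0 ≤ mu) (hq : 0 < mu ∨ 0 ≤ q) (hp : 0 < lam ∨ 0 ≤ p) : False := by
  have hsum : 1 < lam + mu := by
    by_contra! hle
    refine hb ?_
    have : x + (p • α + q • δ) + (lam • α + mu • δ) =
        (1 - lam - mu) • (x + (p • α + q • δ)) + lam • (x + (p • α + q • δ) + α) +
          mu • (x + (p • α + q • δ) + δ) := by module
    rw [this]
    have h3 := hK.sum_mem (t := Finset.univ) (w := ![1 - lam - mu, lam, mu])
      (z := ![x + (p • α + q • δ), x + (p • α + q • δ) + α, x + (p • α + q • δ) + δ])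
      (by intro i _; fin_cases i; exacts [by simp; linarith, hlam, hmu])
      (by simp only [Fin.sum_univ_three, Matrix.cons_val]; ring)
      (by intro i _; fin_cases i <;> assumption)
    simpa only [Fin.sum_univ_three, Matrix.cons_val] using h3
  -- a nonnegative combination of three points of `K` is excluded
  have hcomb : p + q < 0 → p * mu + q * (1 - lam) ≤ 0 → q * lam + p * (1 - mu) ≤ 0 → False := by
    intro hH hA hB
    refine hb ?_
    obtain ⟨N, hN⟩ : ∃ N : ℝ, N = lam + mu - 1 - p - q := ⟨_, rfl⟩
    have hNpos : 0 < N := by linarith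
    have h3 := hK.sum_mem (t := Finset.univ)
      (w := ![(lam + mu - 1) / N, -(q * lam + p * (1 - mu)) / N, -(p * mu + q * (1 - lam)) / N])
      (z := ![x + (lam • α + mu • δ), x + (p • α + q • δ) + α, x + (p • α + q • δ) + δ])
      (by intro i _; fin_cases i <;> exact div_nonneg (by linarith) hNpos.le)
      (by simp only [Fin.sum_univ_three, Matrix.cons_val]; field_simp; rw [hN]; ring)
      (by intro i _; fin_cases i <;> assumption)
    simp only [Fin.sum_univ_three, Matrix.cons_val] at h3
    convert h3 using 1
    have hcancel : ∀ a : ℝ, N * (a / N) = a := fun a => mul_div_cancel₀ a hNpos.ne'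
    have hcancel' : ∀ a b : ℝ, N * (a / N * b) = a * b := fun a b => by
      rw [← mul_assoc, hcancel]
    refine smul_right_injective ℂ hNpos.ne' ?_
    simp only [smul_add, smul_smul, hcancel, hcancel']
    rw [hN]
    module
  -- if `q < 0`, or `p < 0`, then a supporting line at `α`, or at `δ`, restricts the translation
  have hfα : 0 ≤ q ∨ p * mu + q * (1 - lam) ≤ 0 := by
    by_cases hq0 : 0 ≤ q
    · exact Or.inl hq0
    right
    have hmu0 := hq.resolve_right hq0
    push Not at hq0
    obtain ⟨f, hf0, hf⟩ := exists_support hK hint ha'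
    have h1 := hf _ hx
    have h2 := hf _ ha
    have h3 := hf _ hb'
    simp only [map_add, map_smul, smul_eq_mul] at h1 h2 h3
    rcases (show 0 ≤ f α by linarith).eq_or_lt with h0 | hpos
    · rw [← h0] at h2 h3
      have : f δ = 0 := by nlinarith
      exact absurd (eq_zero_of_apply_eq_zero hαδ h0.symm this) hf0
    · by_contra! hcon
      nlinarith [mul_pos hcon hpos]
  have hfδ : 0 ≤ p ∨ q * lam + p * (1 - mu) ≤ 0 := by
    by_cases hp0 : 0 ≤ p
    · exact Or.inl hp0
    right
    have hlam0 := hp.resolve_right hp0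
    push Not at hp0
    obtain ⟨f, hf0, hf⟩ := exists_support hK hint hd'
    have h1 := hf _ hx
    have h2 := hf _ hd
    have h3 := hf _ hb'
    simp only [map_add, map_smul, smul_eq_mul] at h1 h2 h3
    rcases (show 0 ≤ f δ by linarith).eq_or_lt with h0 | hpos
    · rw [← h0] at h2 h3
      have : f α = 0 := by nlinarith
      exact absurd (eq_zero_of_apply_eq_zero hαδ this h0.symm) hf0
    · by_contra! hcon
      nlinarith [mul_pos hcon hpos]
  rcases lt_or_ge q 0 with hq0 | hq0 <;> rcases lt_or_ge p 0 with hp0 | hp0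
  · exact hcomb (by linarith) (hfα.resolve_left hq0.not_ge) (hfδ.resolve_left hp0.not_ge)
  · have hA := hfα.resolve_left hq0.not_ge
    have hlt : p + q < 0 := by
      by_contra! hge
      nlinarith [mul_nonneg hge hmu]
    refine hcomb hlt hA ?_
    rcases le_or_gt 1 mu with h | h
    · nlinarith
    · nlinarith [mul_pos (show 0 < -(p + q) by linarith) (show 0 < 1 - mu by linarith)]
  · have hB := hfδ.resolve_left hp0.not_ge
    have hlt : p + q < 0 := by
      by_contra! hge
      nlinarith [mul_nonneg hge hlam]
    refine hcomb hlt ?_ hB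
    rcases le_or_gt 1 lam with h | h
    · nlinarith
    · nlinarith [mul_pos (show 0 < -(p + q) by linarith) (show 0 < 1 - lam by linarith)]
  · have hw : p • α + q • δ ≠ 0 := by
      intro h0
      rw [h0, add_zero] at hb
      exact hb hb'
    exact (hgood α hα δ hδ hαδ x hx p q hp0 hq0 hw ha hd).elim ha' hd'

/-! ### Bodies between two disks are crossing-free -/

/-- A product with a factor in `[0, 1]` is at most the other factor if it is positive. -/
theorem le_of_le_mul_of_le_one {s t f : ℝ} (hs : 0 < s) (hf : 0 ≤ f) (hf1 : f ≤ 1)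
    (h : s ≤ f * t) : s ≤ t := by
  have ht : 0 < t := by
    by_contra! ht
    nlinarith
  nlinarith

/-- If the second coordinate of the centre is close to the far side of the box, then both
supporting lines cannot be at distance `r` from the centre. -/
theorem no_double_support_aux {l m r f g f' g' c₁ c₂ : ℝ} (hlm : l ≤ m) (hlr : 1 < l + r)
    (hd : 3 * (m - l) < 2 * r) (hf : 0 ≤ f) (hg : 0 ≤ g) (hf' : 0 ≤ f') (hg' : 0 ≤ g')
    (hfg : f ^ 2 + g ^ 2 = 1) (hfg' : f' ^ 2 + g' ^ 2 = 1) (hc : c₁ ^ 2 + c₂ ^ 2 ≤ 1)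
    (h1 : r ≤ f * (m - c₁) - g * (l - c₂)) (h2 : r ≤ g' * (m - c₂) - f' * (l - c₁)) :
    l ≤ c₂ → False := by
  intro hY
  have hr : 0 < r := by linarith
  have hf1 : f ≤ 1 := by nlinarith
  have hg1 : g ≤ 1 := by nlinarith
  have hf1' : f' ≤ 1 := by nlinarith
  have hg1' : g' ≤ 1 := by nlinarith
  have hc1 : c₁ ≤ 1 := by nlinarith
  rcases lt_or_ge m c₂ with hm | hm
  · have : r ≤ f' * (c₁ - l) := by nlinarith
    linarith [le_of_le_mul_of_le_one hr hf' hf1' this]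
  · have hgm : g' * (m - c₂) ≤ m - c₂ := by nlinarith
    have h3 : r - (m - l) ≤ f' * (c₁ - l) := by nlinarith
    have h4 := le_of_le_mul_of_le_one (by linarith) hf' hf1' h3
    have h5 : g * (c₂ - l) ≤ m - l := by nlinarith
    rcases le_or_gt 0 (m - c₁) with h | h
    · nlinarith
    · nlinarith

/-- The remaining positions of the centre, left of the box and below the diagonal through its
corner. As the body, which lies in a disk of radius `1`, contains a point `(p₁, p₂)` of the upper
right quadrant at `(l, l)`, the centre is at distance at most `1 / √2 < 0.7072` from the box in the
first coordinate. -/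
theorem no_double_support_aux' {l m r f g c₁ c₂ p₁ p₂ : ℝ} (hlm : l ≤ m)
    (hd : 3 * (m - l) < 2 * r) (hg : 0 ≤ g) (hfg : f ^ 2 + g ^ 2 = 1)
    (hN : (m - l + 0.7072) * f - 0.7072 * g < r)
    (h1 : r ≤ f * (m - c₁) - g * (l - c₂)) (hp₁ : l ≤ p₁) (hp₂ : l ≤ p₂)
    (hp : (p₁ - c₁) ^ 2 + (p₂ - c₂) ^ 2 ≤ 1) (h₁ : c₁ ≤ l) (h₂ : c₂ ≤ c₁) : False := by
  have hs : l - c₁ ≤ 0.7072 := by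
    by_contra! hlt
    have h3 : 0.7072 ^ 2 < (p₁ - c₁) ^ 2 := by
      exact pow_lt_pow_left₀ (by linarith) (by norm_num) two_ne_zero
    have h4 : 0.7072 ^ 2 < (p₂ - c₂) ^ 2 := by
      exact pow_lt_pow_left₀ (by linarith) (by norm_num) two_ne_zero
    -- `0.7072 ^ 2 > 1 / 2`
    norm_num at h3 h4
    linarith
  have hg1 : g ≤ 1 := by nlinarith
  have h3 : r ≤ (m - c₁) * f - g * (l - c₁) := by nlinarith
  rcases le_or_gt f g with h | h
  · nlinarith
  · nlinarith

/-- The numerical core. Let `c` be the centre of a body between the disks of radii `r` and `1`, and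
let `[l, m]²` be the box of the possible positions of two points, as seen from a common point of
two translates. Supporting lines at the two points with outer normals `(f, -g)` and `(-f', g')`
are at distance at least `r` from the centre, and hence so are the parallel lines through the
corners `(m, l)` and `(l, m)` of the box. This is impossible for both of them. -/
theorem no_double_support {l m r f g f' g' c₁ c₂ p₁ p₂ : ℝ} (hlm : l ≤ m) (hlr : 1 < l + r)
    (hd : 3 * (m - l) < 2 * r)
    (hN : ∀ f g : ℝ, 0 ≤ f → 0 ≤ g → f ^ 2 + g ^ 2 = 1 → l * f ≤ m * g →
      (m - l + 0.7072) * f - 0.7072 * g < r)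
    (hf : 0 ≤ f) (hg : 0 ≤ g) (hf' : 0 ≤ f') (hg' : 0 ≤ g')
    (hfg : f ^ 2 + g ^ 2 = 1) (hfg' : f' ^ 2 + g' ^ 2 = 1)
    (hlf : l * f ≤ m * g) (hlg : l * g' ≤ m * f') (hc : c₁ ^ 2 + c₂ ^ 2 ≤ 1)
    (hp₁ : l ≤ p₁) (hp₂ : l ≤ p₂) (hp : (p₁ - c₁) ^ 2 + (p₂ - c₂) ^ 2 ≤ 1)
    (h1 : r ≤ f * (m - c₁) - g * (l - c₂)) (h2 : r ≤ g' * (m - c₂) - f' * (l - c₁)) : False := by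
  rcases le_or_gt l c₂ with h₂ | h₂
  · exact no_double_support_aux hlm hlr hd hf hg hf' hg' hfg hfg' hc h1 h2 h₂
  rcases le_or_gt l c₁ with h₁ | h₁
  · exact no_double_support_aux hlm hlr hd hg' hf' hg hf (by linarith) (by linarith)
      (by linarith) h2 h1 h₁
  rcases le_total c₂ c₁ with h | h
  · exact no_double_support_aux' hlm hd hg hfg (hN f g hf hg hfg hlf) h1 hp₁ hp₂ hp h₁.le h
  · exact no_double_support_aux' hlm hd hf' (by linarith)
      (hN g' f' hg' hf' (by linarith) hlg) h2 hp₂ hp₁ (by linarith) h₂.le h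

/-- A supporting functional in orthonormal coordinates `X`, `Y`, with normal vector of length
`1`. -/
theorem exists_support_coord {K : Set ℂ} (hK : Convex ℝ K) (hint : (interior K).Nonempty)
    {X Y : ℂ →ₗ[ℝ] ℝ} (hXY : ∀ z, ‖z‖ ^ 2 = X z ^ 2 + Y z ^ 2)
    (hsurj : ∀ a b : ℝ, ∃ z, X z = a ∧ Y z = b) {y : ℂ} (hy : y ∉ interior K) :
    ∃ a b : ℝ, a ^ 2 + b ^ 2 = 1 ∧ ∀ z ∈ K, a * X z + b * Y z ≤ a * X y + b * Y y := by
  obtain ⟨f, hf0, hf⟩ := exists_support hK hint hy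
  obtain ⟨e₁, h11, h12⟩ := hsurj 1 0
  obtain ⟨e₂, h21, h22⟩ := hsurj 0 1
  have hfz : ∀ z, f z = f e₁ * X z + f e₂ * Y z := by
    intro z
    have h0 : z - X z • e₁ - Y z • e₂ = 0 := by
      have := hXY (z - X z • e₁ - Y z • e₂)
      simp only [map_sub, map_smul, smul_eq_mul, h11, h12, h21, h22] at this
      ring_nf at this
      simpa using this
    have h1 : z = X z • e₁ + Y z • e₂ := by linear_combination (exp := 1) h0
    conv_lhs => rw [h1]
    simp only [map_add, map_smul, smul_eq_mul]
    ring
  have hpos : 0 < f e₁ ^ 2 + f e₂ ^ 2 := by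
    by_contra! hle
    have h1 : f e₁ = 0 := by nlinarith [sq_nonneg (f e₁), sq_nonneg (f e₂)]
    have h2 : f e₂ = 0 := by nlinarith [sq_nonneg (f e₁), sq_nonneg (f e₂)]
    refine hf0 ?_
    ext z
    rw [hfz, h1, h2]
    simp
  obtain ⟨N, hN, hNsq⟩ : ∃ N : ℝ, 0 < N ∧ N ^ 2 = f e₁ ^ 2 + f e₂ ^ 2 :=
    ⟨√(f e₁ ^ 2 + f e₂ ^ 2), Real.sqrt_pos.2 hpos, Real.sq_sqrt hpos.le⟩
  refine ⟨f e₁ / N, f e₂ / N, ?_, fun z hz => ?_⟩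
  · rw [div_pow, div_pow, ← add_div, ← hNsq, div_self (by positivity)]
  · have h := hf z hz
    rw [hfz z, hfz y] at h
    calc f e₁ / N * X z + f e₂ / N * Y z = (f e₁ * X z + f e₂ * Y z) / N := by ring
      _ ≤ (f e₁ * X y + f e₂ * Y y) / N := by gcongr
      _ = _ := by ring

/-- A linear functional with values `P ≥ 0` at `α` and `Q` at `δ`, which supports a body at
`x + α`, is not positive at `δ` if the body contains `x + w + α` and `x + w + δ` for some
`w = p α + q δ ≠ 0` in the cone of `α` and `δ`. -/
theorem nonpos_of_support {P Q p q : ℝ} (hp : 0 ≤ p) (hq : 0 ≤ q) (hpq : p ≠ 0 ∨ q ≠ 0)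
    (hP : 0 ≤ P) (h1 : p * P + q * Q ≤ 0) (h2 : p * P + q * Q + Q ≤ P) : Q ≤ 0 := by
  by_contra! hQ
  have h3 : q * Q = 0 := le_antisymm (by nlinarith) (by positivity)
  have hq0 : q = 0 := (mul_eq_zero.1 h3).resolve_right hQ.ne'
  subst hq0
  have hp0 : p ≠ 0 := by simpa using hpq
  have hp' : 0 < p := lt_of_le_of_ne hp hp0.symm
  have : P = 0 := by nlinarith
  subst this
  linarith

/-- A normal vector `(a, b)` that separates the directions of two vectors of the positive quadrant
lies in a neighbouring quadrant. -/
theorem signs_of_support {a b x y x' y' : ℝ} (hx : 0 < x) (hy : 0 < y) (hx' : 0 < x')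
    (hy' : 0 < y') (hD : 0 < x * y' - y * x') (h : 0 ≤ a * x + b * y) (h' : a * x' + b * y' ≤ 0) :
    0 ≤ a ∧ b ≤ 0 := by
  have h1 := mul_nonneg h hy'.le
  have h2 := mul_nonneg (neg_nonneg.2 h') hy.le
  have h3 := mul_nonneg h hx'.le
  have h4 := mul_nonneg (neg_nonneg.2 h') hx.le
  have ha : 0 ≤ a * (x * y' - y * x') := by linarith
  have hb : 0 ≤ -b * (x * y' - y * x') := by linarith
  exact ⟨nonneg_of_mul_nonneg_left ha hD, by linarith [nonneg_of_mul_nonneg_left hb hD]⟩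

/-- The case of `crossingFree_of_ball` in which `α`, `δ` are in counterclockwise order. -/
theorem crossingFree_aux {K : Set ℂ} (hK : Convex ℝ K) {R r l m : ℝ} (hR : 0 < R)
    (hin : Metric.closedBall 0 (R * r) ⊆ K) (hout : K ⊆ Metric.closedBall 0 R)
    {X Y : ℂ →ₗ[ℝ] ℝ} (hXY : ∀ z, ‖z‖ ^ 2 = X z ^ 2 + Y z ^ 2)
    (hsurj : ∀ a b : ℝ, ∃ z, X z = a ∧ Y z = b) (hl : 0 < l) (hlm : l ≤ m) (hlr : 1 < l + r)
    (hd : 3 * (m - l) < 2 * r)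
    (hN : ∀ f g : ℝ, 0 ≤ f → 0 ≤ g → f ^ 2 + g ^ 2 = 1 → l * f ≤ m * g →
      (m - l + 0.7072) * f - 0.7072 * g < r) {α δ x : ℂ}
    (hα : R * l ≤ X α ∧ X α ≤ R * m ∧ R * l ≤ Y α ∧ Y α ≤ R * m)
    (hδ : R * l ≤ X δ ∧ X δ ≤ R * m ∧ R * l ≤ Y δ ∧ Y δ ≤ R * m)
    (hD : 0 < X α * Y δ - Y α * X δ) (hx : x ∈ K) {p q : ℝ} (hp : 0 ≤ p) (hq : 0 ≤ q)
    (hw : p • α + q • δ ≠ 0)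
    (ha : x + (p • α + q • δ) + α ∈ K) (hd' : x + (p • α + q • δ) + δ ∈ K)
    (hna : x + α ∉ interior K) (hnd : x + δ ∉ interior K) : False := by
  have hr : 0 < r := by linarith
  have hint : (interior K).Nonempty := ⟨0, mem_interior.2 ⟨Metric.ball 0 (R * r),
    Metric.ball_subset_closedBall.trans hin, Metric.isOpen_ball,
    Metric.mem_ball_self (by positivity)⟩⟩
  have hpq : p ≠ 0 ∨ q ≠ 0 := by
    by_contra! h
    exact hw (by simp [h.1, h.2])
  have hball : ∀ a b : ℝ, a ^ 2 + b ^ 2 = 1 → ∃ z ∈ K, X z = R * r * a ∧ Y z = R * r * b := by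
    intro a b hab
    obtain ⟨z, h1, h2⟩ := hsurj (R * r * a) (R * r * b)
    refine ⟨z, hin ?_, h1, h2⟩
    have h3 : ‖z‖ ^ 2 = (R * r) ^ 2 := by rw [hXY, h1, h2]; linear_combination (R * r) ^ 2 * hab
    have h4 : ‖z‖ = R * r := by
      rwa [pow_left_inj₀ (norm_nonneg _) (by positivity) two_ne_zero] at h3
    simp [h4]
  have hnorm : ∀ z ∈ K, X z ^ 2 + Y z ^ 2 ≤ R ^ 2 := by
    intro z hz
    rw [← hXY]
    exact pow_le_pow_left₀ (norm_nonneg _) (by simpa using hout hz) 2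
  obtain ⟨α1, α2, α3, α4⟩ := hα
  obtain ⟨δ1, δ2, δ3, δ4⟩ := hδ
  have hRl : 0 < R * l := by positivity
  -- the normal vectors at the two points
  obtain ⟨a₁, b₁, hab₁, hf₁⟩ := exists_support_coord hK hint hXY hsurj hna
  obtain ⟨a₂, b₂, hab₂, hf₂⟩ := exists_support_coord hK hint hXY hsurj hnd
  obtain ⟨z₁, hz₁, hz₁X, hz₁Y⟩ := hball a₁ b₁ hab₁
  obtain ⟨z₂, hz₂, hz₂X, hz₂Y⟩ := hball a₂ b₂ hab₂
  have h10 := hf₁ _ hx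
  have h11 := hf₁ _ ha
  have h12 := hf₁ _ hd'
  have h13 := hf₁ _ hz₁
  have h20 := hf₂ _ hx
  have h21 := hf₂ _ hd'
  have h22 := hf₂ _ ha
  have h23 := hf₂ _ hz₂
  rw [hz₁X, hz₁Y] at h13
  rw [hz₂X, hz₂Y] at h23
  simp only [map_add, map_smul, smul_eq_mul] at h10 h11 h12 h13 h20 h21 h22 h23
  have hP₁ : 0 ≤ a₁ * X α + b₁ * Y α := by linarith
  have hQ₁ : a₁ * X δ + b₁ * Y δ ≤ 0 :=
    nonpos_of_support hp hq hpq hP₁ (by linarith) (by linarith)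
  have hP₂ : 0 ≤ a₂ * X δ + b₂ * Y δ := by linarith
  have hQ₂ : a₂ * X α + b₂ * Y α ≤ 0 :=
    nonpos_of_support hq hp hpq.symm hP₂ (by linarith) (by linarith)
  have hXα : 0 < X α := by linarith
  have hYα : 0 < Y α := by linarith
  have hXδ : 0 < X δ := by linarith
  have hYδ : 0 < Y δ := by linarith
  obtain ⟨ha₁, hb₁⟩ := signs_of_support hXα hYα hXδ hYδ hD hP₁ hQ₁
  obtain ⟨ha₂, hb₂⟩ := signs_of_support (a := -a₂) (b := -b₂) hXα hYα hXδ hYδ hD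
    (by linarith) (by linarith)
  rw [neg_nonpos] at hb₂
  -- lengths in units of `R`, with the common point as origin
  obtain ⟨c₁, hc₁⟩ : ∃ c : ℝ, X x = -(R * c) := ⟨-X x / R, by field_simp⟩
  obtain ⟨c₂, hc₂⟩ : ∃ c : ℝ, Y x = -(R * c) := ⟨-Y x / R, by field_simp⟩
  obtain ⟨p₁, hp₁⟩ : ∃ c : ℝ, p * X α + q * X δ + X α = R * c :=
    ⟨(p * X α + q * X δ + X α) / R, by field_simp⟩
  obtain ⟨p₂, hp₂⟩ : ∃ c : ℝ, p * Y α + q * Y δ + Y α = R * c :=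
    ⟨(p * Y α + q * Y δ + Y α) / R, by field_simp⟩
  have hle : ∀ {a b : ℝ}, R * a ≤ R * b → a ≤ b := fun h => le_of_mul_le_mul_left h hR
  have hle2 : ∀ {a b : ℝ}, R ^ 2 * a ≤ R ^ 2 * b → a ≤ b := fun h =>
    le_of_mul_le_mul_left h (by positivity)
  have hnx := hnorm _ hx
  have hna' := hnorm _ ha
  simp only [map_add, map_smul, smul_eq_mul] at hna'
  have e1 : X x + (p * X α + q * X δ) + X α = R * (p₁ - c₁) := by rw [hc₁]; linarith
  have e2 : Y x + (p * Y α + q * Y δ) + Y α = R * (p₂ - c₂) := by rw [hc₂]; linarith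
  rw [e1, e2] at hna'
  rw [hc₁, hc₂] at hnx
  refine no_double_support (l := l) (m := m) (r := r) (f := a₁) (g := -b₁) (f' := -a₂) (g' := b₂)
    (c₁ := c₁) (c₂ := c₂) (p₁ := p₁) (p₂ := p₂) hlm hlr hd hN ha₁ (by linarith) (by linarith) hb₂
    (by linarith) (by linarith) (hle ?_) (hle ?_) (hle2 (by linarith)) (hle ?_) (hle ?_)
    (hle2 (by linarith)) (hle ?_) (hle ?_)
  · linarith [mul_le_mul_of_nonneg_left δ1 ha₁, mul_le_mul_of_nonneg_left δ4 (neg_nonneg.2 hb₁)]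
  · linarith [mul_le_mul_of_nonneg_left α3 hb₂, mul_le_mul_of_nonneg_left α2 ha₂]
  · rw [← hp₁]
    linarith [mul_nonneg hp hXα.le, mul_nonneg hq hXδ.le]
  · rw [← hp₂]
    linarith [mul_nonneg hp hYα.le, mul_nonneg hq hYδ.le]
  · have : R * r * (a₁ ^ 2 + b₁ ^ 2) = R * r := by rw [hab₁, mul_one]
    have h3 : a₁ * X x = -(a₁ * (R * c₁)) := by rw [hc₁]; ring
    have h4 : b₁ * Y x = -(b₁ * (R * c₂)) := by rw [hc₂]; ring
    linarith [mul_le_mul_of_nonneg_left α2 ha₁,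
      mul_le_mul_of_nonneg_left α3 (neg_nonneg.2 hb₁)]
  · have : R * r * (a₂ ^ 2 + b₂ ^ 2) = R * r := by rw [hab₂, mul_one]
    have h3 : a₂ * X x = -(a₂ * (R * c₁)) := by rw [hc₁]; ring
    have h4 : b₂ * Y x = -(b₂ * (R * c₂)) := by rw [hc₂]; ring
    linarith [mul_le_mul_of_nonneg_left δ1 ha₂, mul_le_mul_of_nonneg_left δ4 hb₂]

/-- A convex body between the disks of radii `R r` and `R` is crossing-free for a square box
with coordinates in `[R l, R m]`, if `l`, `m` and `r` satisfy suitable inequalities. -/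
theorem crossingFree_of_ball {K : Set ℂ} (hK : Convex ℝ K) {R r l m : ℝ} (hR : 0 < R)
    (hin : Metric.closedBall 0 (R * r) ⊆ K) (hout : K ⊆ Metric.closedBall 0 R)
    {X Y : ℂ →ₗ[ℝ] ℝ} (hXY : ∀ z, ‖z‖ ^ 2 = X z ^ 2 + Y z ^ 2)
    (hsurj : ∀ a b : ℝ, ∃ z, X z = a ∧ Y z = b) (hl : 0 < l) (hlm : l ≤ m) (hlr : 1 < l + r)
    (hd : 3 * (m - l) < 2 * r)
    (hN : ∀ f g : ℝ, 0 ≤ f → 0 ≤ g → f ^ 2 + g ^ 2 = 1 → l * f ≤ m * g →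
      (m - l + 0.7072) * f - 0.7072 * g < r) :
    CrossingFree K {z | R * l ≤ X z ∧ X z ≤ R * m ∧ R * l ≤ Y z ∧ Y z ≤ R * m} := by
  intro α hα δ hδ hαδ x hx p q hp hq hw ha hd'
  by_contra! hcon
  obtain ⟨hna, hnd⟩ := hcon
  rcases lt_trichotomy 0 (X α * Y δ - Y α * X δ) with hD | hD | hD
  · exact crossingFree_aux hK hR hin hout hXY hsurj hl hlm hlr hd hN hα hδ hD hx hp hq hw ha hd'
      hna hnd
  · have h0 : X α • δ - X δ • α = 0 := by
      have := hXY (X α • δ - X δ • α)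
      simp only [map_sub, map_smul, smul_eq_mul] at this
      have h1 : ‖X α • δ - X δ • α‖ ^ 2 = 0 := by
        rw [this]
        linear_combination (-(X α * Y δ - Y α * X δ)) * hD
      simpa using h1
    have hXα : 0 < X α := lt_of_lt_of_le (by positivity) hα.1
    have h1 := congrArg Complex.re h0
    have h2 := congrArg Complex.im h0
    simp at h1 h2
    apply hαδ
    have : X α * cross α δ = 0 := by unfold cross; linear_combination α.re * h2 - α.im * h1
    exact (mul_eq_zero.1 this).resolve_left hXα.ne'
  · rw [add_comm (p • α)] at hw ha hd'
    exact crossingFree_aux hK hR hin hout hXY hsurj hl hlm hlr hd hN hδ hα (by linarith) hx hq hp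
      hw hd' ha hnd hna

/-- A square is crossing-free for a box parallel to its sides. -/
theorem crossingFree_of_square {K : Set ℂ} {h l m : ℝ} {X Y : ℂ →ₗ[ℝ] ℝ}
    (hXc : Continuous X) (hYc : Continuous Y)
    (hK : ∀ z, z ∈ K ↔ |X z| ≤ h ∧ |Y z| ≤ h) (hl : 0 < l) :
    CrossingFree K {z | l ≤ X z ∧ X z ≤ m ∧ l ≤ Y z ∧ Y z ≤ m} := by
  intro α hα δ hδ hαδ x hx p q hp hq hw ha hd'
  left
  have hpq : 0 < p + q := by
    by_contra! h
    exact hw (by simp [show p = 0 by linarith, show q = 0 by linarith])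
  obtain ⟨α1, α2, α3, α4⟩ := hα
  obtain ⟨δ1, δ2, δ3, δ4⟩ := hδ
  rw [hK, abs_le, abs_le] at hx ha
  simp only [map_add, map_smul, smul_eq_mul] at ha
  have h1 : (p + q) * l ≤ p * X α + q * X δ := by nlinarith
  have h2 : (p + q) * l ≤ p * Y α + q * Y δ := by nlinarith
  have h3 := mul_pos hpq hl
  refine mem_interior.2 ⟨{z | |X z| < h ∧ |Y z| < h}, fun z hz => (hK z).2 ⟨hz.1.le, hz.2.le⟩,
    (isOpen_lt hXc.abs continuous_const).inter (isOpen_lt hYc.abs continuous_const), ?_⟩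
  simp only [Set.mem_ofPred_eq, map_add, abs_lt]
  refine ⟨⟨?_, ?_⟩, ?_, ?_⟩ <;> linarith [hx.1.1, hx.2.1, ha.1.2, ha.2.2]

/-! ### Moving a translate until a point lies on its boundary -/

theorem cross_add (a b c : ℂ) : cross a (b + c) = cross a b + cross a c := by
  simp only [cross, Complex.add_re, Complex.add_im]; ring

theorem cross_smul (a b : ℂ) (t : ℝ) : cross a (t • b) = t * cross a b := by
  simp only [cross, Complex.real_smul, Complex.re_ofReal_mul, Complex.im_ofReal_mul]; ring

theorem cross_sub (a b c : ℂ) : cross a (b - c) = cross a b - cross a c := by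
  simp only [cross, Complex.sub_re, Complex.sub_im]; ring

theorem cross_self (a : ℂ) : cross a a = 0 := by
  simp only [cross]; ring

theorem cross_swap (a b : ℂ) : cross b a = -cross a b := by
  simp only [cross]; ring

theorem continuous_cross (a : ℂ) : Continuous (cross a) := by
  unfold cross
  fun_prop

/-- Cramer's rule in the plane. -/
theorem cross_smul_eq (a d b : ℂ) : cross a d • b = cross b d • a + cross a b • d := by
  apply Complex.ext <;>
  simp only [cross, Complex.real_smul, Complex.re_ofReal_mul, Complex.im_ofReal_mul,
    Complex.add_re, Complex.add_im] <;> ring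

theorem eq_div_smul_add {a d : ℂ} (h : cross a d ≠ 0) (b : ℂ) :
    b = (cross b d / cross a d) • a + (cross a b / cross a d) • d := by
  apply smul_right_injective ℂ h
  simp only [smul_add, smul_smul, mul_div_cancel₀ _ h]
  exact cross_smul_eq a d b

theorem exists_smul_of_cross_eq_zero {a b : ℂ} (ha : a ≠ 0) (h : cross a b = 0) :
    ∃ t : ℝ, b = t • a := by
  have hn : Complex.normSq a ≠ 0 := by simpa using ha
  refine ⟨(a.re * b.re + a.im * b.im) / Complex.normSq a, ?_⟩
  apply smul_right_injective ℂ hn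
  simp only [smul_smul, mul_div_cancel₀ _ hn]
  unfold cross at h
  apply Complex.ext
  · simp only [Complex.real_smul, Complex.re_ofReal_mul, Complex.normSq_apply]
    linear_combination (-a.im) * h
  · simp only [Complex.real_smul, Complex.im_ofReal_mul, Complex.normSq_apply]
    linear_combination (a.re) * h

section

variable {K : Set ℂ}

/-- A point on the open segment between an interior point and another point of a convex body is
an interior point; the parameters are scaled by their sum. -/
theorem mem_interior_of_combo (hK : Convex ℝ K) {y v z : ℂ} {a b : ℝ} (hy : y ∈ interior K)
    (hv : v ∈ K) (ha : 0 < a) (hb : 0 ≤ b) (h : (a + b) • z = a • y + b • v) : z ∈ interior K := by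
  have hab : 0 < a + b := by linarith
  have h1 := hK.combo_interior_self_mem_interior hy hv (a := a / (a + b)) (b := b / (a + b))
    (by positivity) (by positivity) (by field_simp)
  convert h1 using 1
  apply smul_right_injective ℂ hab.ne'
  simp only [smul_add, smul_smul, mul_div_cancel₀ _ hab.ne']
  exact h

theorem mem_of_combo (hK : Convex ℝ K) {y v z : ℂ} {a b : ℝ} (hy : y ∈ K)
    (hv : v ∈ K) (ha : 0 < a) (hb : 0 ≤ b) (h : (a + b) • z = a • y + b • v) : z ∈ K := by
  have hab : 0 < a + b := by linarith
  have h1 := hK hy hv (a := a / (a + b)) (b := b / (a + b))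
    (by positivity) (by positivity) (by field_simp)
  convert h1 using 1
  apply smul_right_injective ℂ hab.ne'
  simp only [smul_add, smul_smul, mul_div_cancel₀ _ hab.ne']
  exact h

/-- On a line through an interior point of a convex body, every point strictly between two points
of the body is an interior point. -/
theorem mem_interior_of_line (hK : Convex ℝ K) {y z α : ℂ} {s b c : ℝ} (hy : y ∈ interior K)
    (hyz : y = z + s • α) (hb : 0 < b) (hc : 0 < c) (h1 : z - b • α ∈ K) (h2 : z + c • α ∈ K) :
    z ∈ interior K := by
  rcases le_or_gt 0 s with hs | hs
  · exact mem_interior_of_combo hK hy h1 hb hs (by rw [hyz]; module)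
  · exact mem_interior_of_combo hK hy h2 hc (neg_nonneg.2 hs.le) (by rw [hyz]; module)

/-- A chord in direction `α` with interior end points can be moved sideways, to either side. -/
theorem exists_further_chord {z α : ℂ} {σ : ℝ} (hσ : σ ≠ 0) (hα : α ≠ 0) (hz : z ∈ interior K)
    (hzα : z + α ∈ interior K) :
    ∃ v ∈ K, v + α ∈ K ∧ σ * cross α z < σ * cross α v := by
  have hopen : IsOpen {s : ℝ | z + (s * σ) • (Complex.I * α) ∈ interior K ∧
      z + (s * σ) • (Complex.I * α) + α ∈ interior K} :=
    (isOpen_interior.preimage (f := fun s : ℝ => z + (s * σ) • (Complex.I * α))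
      (by fun_prop)).inter (isOpen_interior.preimage
        (f := fun s : ℝ => z + (s * σ) • (Complex.I * α) + α) (by fun_prop))
  obtain ⟨ε, hε, hball⟩ := Metric.isOpen_iff.1 hopen 0 (by simpa using ⟨hz, hzα⟩)
  have hmem := hball (show ε / 2 ∈ Metric.ball (0 : ℝ) ε by
    simpa [abs_of_pos hε] using hε)
  refine ⟨_, interior_subset hmem.1, interior_subset hmem.2, ?_⟩
  have h2 : cross α (Complex.I * α) = Complex.normSq α := by
    simp [cross, Complex.normSq_apply]
  have h3 : 0 < Complex.normSq α := Complex.normSq_pos.2 hα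
  rw [cross_add, cross_smul, h2]
  have h4 : 0 < σ ^ 2 * (ε / 2 * Complex.normSq α) := by positivity
  linarith

/-- If the chord in direction `α` from `x'` to `x' + α` is extremal in the direction of growing
`cross α`, then a chord `x`, `x + α` of interior points reaches at least as far in every direction
`β` that points further in this direction. -/
theorem mem_of_extremal_chord (hK : Convex ℝ K) {x x' α β : ℂ} {σ : ℝ} (hσ : σ ≠ 0)
    (hα : α ≠ 0) (hx : x ∈ interior K) (hxα : x + α ∈ interior K) (hx' : x' ∈ K)
    (hxα' : x' + α ∈ K)
    (hint' : x' + α ∉ interior K)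
    (hmax : ∀ z, z ∈ K → z + α ∈ K → σ * cross α z ≤ σ * cross α x')
    (hβ : 0 < σ * cross α β) (hxβ : x' + β ∈ K) : x + β ∈ K := by
  have hpush : ∀ z, z ∈ interior K → z + α ∈ interior K → σ * cross α z < σ * cross α x' := by
    intro z hz hzα
    obtain ⟨v, hv, hvα, hlt⟩ := exists_further_chord hσ hα hz hzα
    exact hlt.trans_le (hmax v hv hvα)
  have hlt : σ * cross α x < σ * cross α x' := hpush x hx hxα
  have hσ' : cross α x ≠ cross α x' := by
    rintro h; rw [h] at hlt; exact lt_irrefl _ hlt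
  have hx'int : x' ∉ interior K := by
    intro hx'i
    have hopen : IsOpen {s : ℝ | x' - s • α ∈ interior K} :=
      isOpen_interior.preimage (f := fun s : ℝ => x' - s • α) (by fun_prop)
    obtain ⟨ε, hε, hball⟩ := Metric.isOpen_iff.1 hopen 0 (by simpa using hx'i)
    have hm : 0 < min (ε / 2) (1 / 2) := lt_min (by linarith) (by norm_num)
    set η := min (ε / 2) (1 / 2) with hη
    have hηε : η ≤ ε / 2 := min_le_left _ _
    have hη1 : η ≤ 1 / 2 := min_le_right _ _
    have hmem := hball (show η ∈ Metric.ball (0 : ℝ) ε by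
      simp only [Metric.mem_ball, dist_zero_right, Real.norm_eq_abs, abs_of_pos hm]
      linarith)
    have h2 : x' - η • α + α ∈ interior K :=
      mem_interior_of_combo hK hx'i hxα' hm (b := 1 - η) (by linarith) (by module)
    have h3 := hpush _ hmem h2
    rw [cross_sub, cross_smul, cross_self] at h3
    simp at h3
  -- `x' + β = x + ρ α - (κ + 1) (x - x')` with `κ > 0`
  obtain ⟨κ, hκ, hκeq⟩ : ∃ κ : ℝ, 0 < κ ∧ cross α β = κ * (cross α x' - cross α x) := by
    refine ⟨(σ * cross α β) / (σ * (cross α x' - cross α x)),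
      div_pos hβ (by linarith), ?_⟩
    have := sub_ne_zero.2 hσ'.symm
    field_simp
  obtain ⟨ρ, hρ⟩ := exists_smul_of_cross_eq_zero (b := β - κ • (x' - x)) hα (by
    rw [cross_sub, cross_smul, cross_sub, hκeq, sub_self])
  have hβeq : β = ρ • α + κ • (x' - x) := by rw [← hρ]; module
  have hxK := interior_subset hx
  have hxαK := interior_subset hxα
  rcases lt_or_ge ρ 0 with h0 | h0
  · exfalso
    refine hx'int ?_
    have hu : x' + (ρ / (κ + 1)) • α ∈ interior K := by
      refine mem_interior_of_combo hK hx hxβ hκ zero_le_one ?_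
      rw [smul_add, smul_smul, mul_div_cancel₀ _ (by positivity), hβeq]
      module
    refine mem_interior_of_combo hK hu hxα' one_pos (b := -(ρ / (κ + 1))) ?_ (by module)
    rw [← neg_div]
    exact div_nonneg (by linarith) (by linarith)
  rcases lt_or_ge 1 ρ with h1 | h1
  · exfalso
    refine hint' ?_
    have hu : x' + α + ((ρ - 1) / (κ + 1)) • α ∈ interior K := by
      refine mem_interior_of_combo hK hxα hxβ hκ zero_le_one ?_
      rw [smul_add, smul_smul, mul_div_cancel₀ _ (by positivity), hβeq]
      module
    refine mem_interior_of_combo hK hu hx' one_pos (b := (ρ - 1) / (κ + 1)) ?_ (by module)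
    exact div_nonneg (by linarith) (by linarith)
  · have hxρ : x + ρ • α ∈ K := by
      have := hK hxK hxαK (a := 1 - ρ) (b := ρ) (by linarith) h0 (by ring)
      convert this using 1
      module
    refine mem_of_combo hK hxρ hxβ (a := 1) (b := κ) one_pos hκ.le ?_
    rw [hβeq]
    module

/-- A translate that contains `o` and a point in its interior can be moved, without gaining
points of a finite set, until it still contains `o` in its interior and has the point on its
boundary. Everything is seen from `o`: `x` is the position of `o` in the translate, `B` are the
points and `α` is the point in question. -/
theorem exists_mem_boundary (hK : Convex ℝ K) (hKc : IsCompact K) {B : Finset ℂ}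
    (hgood : CrossingFree K B) {e : ℂ →ₗ[ℝ] ℝ} (he : ∀ β ∈ B, 0 < e β) {x α : ℂ} (hα : α ∈ B)
    (hx : x ∈ interior K) (hxα : x + α ∈ interior K) :
    ∃ x' ∈ interior K, x' + α ∈ K ∧ x' + α ∉ interior K ∧ ∀ β ∈ B, x' + β ∈ K → x + β ∈ K := by
  classical
  have hα0 : α ≠ 0 := by rintro rfl; simpa using he 0 hα
  have hKcl := hKc.isClosed
  have hcF := continuous_cross α
  have hpre : ∀ β : ℂ, IsClosed {z | z + β ∈ K} := fun β =>
    hKcl.preimage (f := fun z => z + β) (by fun_prop)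
  have hpre' : IsClosed {z | z + α ∉ interior K} :=
    (isOpen_interior.preimage (f := fun z => z + α) (by fun_prop)).isClosed_compl
  have hCc : IsCompact (K ∩ {z | z + α ∈ K}) := hKc.inter_right (hpre α)
  have hxC : x ∈ K ∩ {z | z + α ∈ K} := ⟨interior_subset hx, interior_subset (s := K) hxα⟩
  obtain ⟨x₁, hx₁, hmin⟩ := hCc.exists_isMinOn ⟨x, hxC⟩ hcF.continuousOn
  obtain ⟨x₂, hx₂, hmax⟩ := hCc.exists_isMaxOn ⟨x, hxC⟩ hcF.continuousOn
  -- levels at which a point of the given side prevents the translate from being moved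
  let M : ℝ → Set ℂ := fun σ => ⋃ β ∈ B.filter (fun β => x + β ∉ K ∧ 0 < σ * cross α β),
    ((K ∩ {z | z + α ∈ K}) ∩ {z | z + α ∉ interior K}) ∩ {z | z + β ∈ K}
  have hM : ∀ σ, IsClosed (cross α '' M σ) := fun σ => by
    have : IsCompact (M σ) := Finset.isCompact_biUnion _ fun β _ =>
      (hCc.inter_right hpre').inter_right (hpre β)
    exact (this.image hcF).isClosed
  have hmemM : ∀ σ z, z ∈ M σ ↔ ∃ β ∈ B, x + β ∉ K ∧ 0 < σ * cross α β ∧ z ∈ K ∧ z + α ∈ K ∧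
      z + α ∉ interior K ∧ z + β ∈ K := by
    intro σ z
    simp only [M, Set.mem_iUnion, Finset.mem_filter, Set.mem_inter_iff, Set.mem_ofPred_eq]
    constructor
    · rintro ⟨β, ⟨h1, h2, h3⟩, ⟨⟨h4, h5⟩, h6⟩, h7⟩
      exact ⟨β, h1, h2, h3, h4, h5, h6, h7⟩
    · rintro ⟨β, h1, h2, h3, h4, h5, h6, h7⟩
      exact ⟨β, ⟨h1, h2, h3⟩, ⟨⟨h4, h5⟩, h6⟩, h7⟩
  have hL : cross α x₂ ∉ cross α '' M 1 := by
    rintro ⟨z, hz, hzx⟩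
    obtain ⟨β, _, h2, h3, h4, h5, h6, h7⟩ := (hmemM _ _).1 hz
    refine h2 (mem_of_extremal_chord hK one_ne_zero hα0 hx hxα h4 h5 h6 ?_ h3 h7)
    intro v hv hvα
    rw [hzx, one_mul, one_mul]
    exact hmax ⟨hv, hvα⟩
  have hR : cross α x₁ ∉ cross α '' M (-1) := by
    rintro ⟨z, hz, hzx⟩
    obtain ⟨β, _, h2, h3, h4, h5, h6, h7⟩ := (hmemM _ _).1 hz
    refine h2 (mem_of_extremal_chord hK (neg_ne_zero.2 one_ne_zero) hα0 hx hxα h4 h5 h6 ?_ h3 h7)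
    intro v hv hvα
    have : cross α x₁ ≤ cross α v := hmin ⟨hv, hvα⟩
    rw [hzx]
    linarith
  -- a chord of interior points at every intermediate level
  have hlevel : ∀ t ∈ Set.Ioo (cross α x₁) (cross α x₂), ∃ y, cross α y = t ∧ y ∈ interior K ∧
      y + α ∈ interior K := by
    intro t ht
    have key : ∀ v, v ∈ K → v + α ∈ K → ∀ a b : ℝ, 0 < a → 0 ≤ b → a + b = 1 →
        a * cross α x + b * cross α v = t →
        ∃ y, cross α y = t ∧ y ∈ interior K ∧ y + α ∈ interior K := by
      intro v hv hvα a b ha hb hab hat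
      refine ⟨a • x + b • v, by rw [cross_add, cross_smul, cross_smul, hat],
        hK.combo_interior_self_mem_interior hx hv ha hb hab, ?_⟩
      have := hK.combo_interior_self_mem_interior hxα hvα ha hb hab
      convert this using 1
      have h1 : α = (a + b) • α := by rw [hab, one_smul]
      conv_lhs => rw [h1]
      module
    rcases le_total t (cross α x) with h | h
    · have hlt : 0 < cross α x - cross α x₁ := by linarith [ht.1]
      refine key x₁ hx₁.1 hx₁.2 ((t - cross α x₁) / (cross α x - cross α x₁))
        ((cross α x - t) / (cross α x - cross α x₁)) (div_pos (by linarith [ht.1]) hlt)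
        (div_nonneg (by linarith) hlt.le) (by field_simp; ring) (by field_simp; ring)
    · have hlt : 0 < cross α x₂ - cross α x := by linarith [ht.2]
      refine key x₂ hx₂.1 hx₂.2 ((cross α x₂ - t) / (cross α x₂ - cross α x))
        ((t - cross α x) / (cross α x₂ - cross α x)) (div_pos (by linarith [ht.2]) hlt)
        (div_nonneg (by linarith) hlt.le) (by field_simp; ring) (by field_simp; ring)
  have hx12 : cross α x₁ < cross α x₂ := by
    by_contra! hle
    obtain ⟨z, hz, hzα, hlt⟩ := exists_further_chord one_ne_zero hα0 hx hxα
    have h1 : cross α z ≤ cross α x₂ := hmax ⟨hz, hzα⟩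
    have h2 : cross α x₁ ≤ cross α x := hmin hxC
    linarith
  -- if all levels were blocked, then by connectedness one of them would be blocked from both
  -- sides, and two translates would cross
  obtain ⟨t, ht, htL, htR⟩ : ∃ t ∈ Set.Ioo (cross α x₁) (cross α x₂),
      t ∉ cross α '' M 1 ∧ t ∉ cross α '' M (-1) := by
    by_contra! hcon
    have hsub : Set.Icc (cross α x₁) (cross α x₂) ⊆ cross α '' M 1 ∪ cross α '' M (-1) := by
      rw [← closure_Ioo hx12.ne]
      refine closure_minimal (fun t ht => ?_) ((hM 1).union (hM (-1)))
      by_cases h : t ∈ cross α '' M 1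
      · exact Or.inl h
      · exact Or.inr (hcon t ht h)
    have hl := Set.left_mem_Icc.2 hx12.le
    have hr := Set.right_mem_Icc.2 hx12.le
    obtain ⟨t, ht, htL, htR⟩ := isPreconnected_closed_iff.1 isPreconnected_Icc _ _ (hM 1) (hM (-1))
      hsub ⟨_, hl, (hsub hl).resolve_right hR⟩ ⟨_, hr, (hsub hr).resolve_left hL⟩
    have ht' : t ∈ Set.Ioo (cross α x₁) (cross α x₂) := by
      refine ⟨lt_of_le_of_ne ht.1 ?_, lt_of_le_of_ne ht.2 ?_⟩
      · rintro rfl; exact hR htR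
      · rintro rfl; exact hL htL
    obtain ⟨y, hyt, hy, -⟩ := hlevel t ht'
    obtain ⟨z₁, hz₁, hz₁t⟩ := htL
    obtain ⟨z₂, hz₂, hz₂t⟩ := htR
    obtain ⟨β₁, hβ₁, h12, h13, h14, h15, h16, h17⟩ := (hmemM 1 _).1 hz₁
    obtain ⟨β₂, hβ₂, h22, h23, h24, h25, h26, h27⟩ := (hmemM (-1) _).1 hz₂
    have honline : ∀ z, cross α z = t → ∃ s : ℝ, y = z + s • α := by
      intro z hz
      obtain ⟨s, hs⟩ := exists_smul_of_cross_eq_zero (b := y - z) hα0 (by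
        rw [cross_sub, hyt, hz, sub_self])
      exact ⟨s, by rw [← hs]; ring⟩
    -- both positions are the far end of the chord of level `t`
    have hz12 : z₁ = z₂ := by
      obtain ⟨s, hs⟩ := exists_smul_of_cross_eq_zero (b := z₂ - z₁) hα0 (by
        rw [cross_sub, hz₁t, hz₂t, sub_self])
      have hz2 : z₂ = z₁ + s • α := by rw [← hs]; ring
      rcases lt_trichotomy s 0 with h | h | h
      · exfalso
        obtain ⟨s', hs'⟩ := honline (z₂ + α) (by rw [cross_add, cross_self, hz₂t, add_zero])
        refine h26 (mem_interior_of_line hK hy hs' one_pos (neg_pos.2 h) ?_ ?_)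
        · convert h24 using 1; module
        · convert h15 using 1; rw [hz2]; module
      · rw [hz2, h]; simp
      · exfalso
        obtain ⟨s', hs'⟩ := honline (z₁ + α) (by rw [cross_add, cross_self, hz₁t, add_zero])
        refine h16 (mem_interior_of_line hK hy hs' one_pos h ?_ ?_)
        · convert h14 using 1; module
        · convert h25 using 1; rw [hz2]; module
    subst hz12
    -- a point slightly beyond `α`
    obtain ⟨ε, hε, hxε⟩ : ∃ ε : ℝ, 0 < ε ∧ x + (1 + ε) • α ∈ K := by
      have hopen : IsOpen {s : ℝ | x + (1 + s) • α ∈ interior K} :=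
        isOpen_interior.preimage (f := fun s : ℝ => x + (1 + s) • α) (by fun_prop)
      obtain ⟨ε, hε, hball⟩ := Metric.isOpen_iff.1 hopen 0 (by simpa using hxα)
      exact ⟨ε / 2, by linarith, interior_subset (hball (by simpa [abs_of_pos hε] using hε))⟩
    have hzε : z₁ + (1 + ε) • α ∉ K := by
      intro hmem
      obtain ⟨s', hs'⟩ := honline (z₁ + α) (by rw [cross_add, cross_self, hz₁t, add_zero])
      refine h16 (mem_interior_of_line hK hy hs' one_pos hε ?_ ?_)
      · convert h14 using 1; module
      · convert hmem using 1; module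
    have hc1 : 0 < cross α β₁ := by linarith
    have hc2 : cross α β₂ < 0 := by linarith
    have hneg : cross β₁ β₂ < 0 := by
      have h := congrArg e (cross_smul_eq β₁ β₂ α)
      simp only [map_add, map_smul, smul_eq_mul] at h
      rw [cross_swap α β₁] at h
      have h1 := he α hα
      have h2 := he β₁ hβ₁
      have h3 := he β₂ hβ₂
      by_contra! hge
      have := mul_nonneg hge h1.le
      have := mul_pos hc1 h3
      have := mul_pos (neg_pos.2 hc2) h2
      linarith
    have hw := eq_div_smul_add hneg.ne (z₁ - x)
    set p := cross (z₁ - x) β₂ / cross β₁ β₂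
    set q := cross β₁ (z₁ - x) / cross β₁ β₂
    have hα' := eq_div_smul_add hneg.ne α
    have hlam : 0 < cross α β₂ / cross β₁ β₂ := div_pos_of_neg_of_neg hc2 hneg
    have hmu : 0 < cross β₁ α / cross β₁ β₂ :=
      div_pos_of_neg_of_neg (by rw [cross_swap α]; linarith) hneg
    set lam := cross α β₂ / cross β₁ β₂
    set mu := cross β₁ α / cross β₁ β₂
    have hb : ((1 + ε) * lam) • β₁ + ((1 + ε) * mu) • β₂ = (1 + ε) • α := by
      rw [hα']; module
    have hxw : x + (p • β₁ + q • β₂) = z₁ := by rw [← hw]; ring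
    refine no_crossing hK ⟨x, hx⟩ hgood (x := x) (p := p) (q := q) (lam := (1 + ε) * lam)
      (mu := (1 + ε) * mu) hβ₁ hβ₂ hneg.ne (interior_subset hx) ?_ ?_ ?_
      (fun h => h12 (interior_subset h)) (fun h => h22 (interior_subset h)) ?_ ?_
      (by positivity) (by positivity) (Or.inl (by positivity)) (Or.inl (by positivity))
    · rwa [hxw]
    · rwa [hxw]
    · rwa [hxw]
    · rwa [hb]
    · rwa [hxw, hb]
  -- the far end of the chord of level `t`
  obtain ⟨y, hyt, hy, hyα⟩ := hlevel t ht
  obtain ⟨s, ⟨hs0, hsK⟩, hsmax⟩ : ∃ s, IsGreatest {s : ℝ | 0 ≤ s ∧ y + α + s • α ∈ K} s := by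
    have hcl : IsClosed {s : ℝ | 0 ≤ s ∧ y + α + s • α ∈ K} :=
      isClosed_Ici.inter (hKcl.preimage (f := fun s : ℝ => y + α + s • α) (by fun_prop))
    obtain ⟨M', hM'⟩ := hKc.isBounded.exists_norm_le
    have hbdd : BddAbove {s : ℝ | 0 ≤ s ∧ y + α + s • α ∈ K} := by
      refine ⟨(M' + ‖y + α‖) / ‖α‖, ?_⟩
      rintro s ⟨hs, hsK⟩
      rw [le_div_iff₀ (norm_pos_iff.2 hα0)]
      have h1 : s * ‖α‖ = ‖s • α‖ := by rw [norm_smul, Real.norm_of_nonneg hs]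
      have h2 : s • α = (y + α + s • α) - (y + α) := by ring
      rw [h1, h2]
      exact (norm_sub_le _ _).trans (by linarith [hM' _ hsK])
    exact ⟨_, hcl.isGreatest_csSup ⟨0, le_rfl, by simpa using interior_subset hyα⟩ hbdd⟩
  have hx'int : y + s • α ∈ interior K :=
    mem_interior_of_combo hK hy hsK one_pos hs0 (by module)
  have hx't : cross α (y + s • α) = t := by rw [cross_add, cross_smul, cross_self, hyt]; ring
  have hnot : y + s • α + α ∉ interior K := by
    intro hmem
    have hopen : IsOpen {r : ℝ | y + α + (s + r) • α ∈ interior K} :=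
      isOpen_interior.preimage (f := fun r : ℝ => y + α + (s + r) • α) (by fun_prop)
    obtain ⟨ε, hε, hball⟩ := Metric.isOpen_iff.1 hopen 0 (by
      simp only [Set.mem_ofPred_eq, add_zero]; convert hmem using 1; ring)
    have := hsmax ⟨by linarith, interior_subset (hball (show ε / 2 ∈ Metric.ball (0 : ℝ) ε by
      simpa [abs_of_pos hε] using hε))⟩
    linarith
  have hmem : y + s • α + α ∈ K := by convert hsK using 1; ring
  refine ⟨y + s • α, hx'int, hmem, hnot, fun β hβ hβK => ?_⟩
  by_contra hxβ
  rcases lt_trichotomy (cross α β) 0 with h | h | h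
  · exact htR ⟨_, (hmemM (-1) _).2
      ⟨β, hβ, hxβ, by linarith, interior_subset hx'int, hmem, hnot, hβK⟩, hx't⟩
  · obtain ⟨r, rfl⟩ := exists_smul_of_cross_eq_zero hα0 h
    have hr : 0 < r := by
      have := he _ hβ
      rw [map_smul, smul_eq_mul] at this
      exact pos_of_mul_pos_left this (he α hα).le
    rcases le_or_gt r 1 with hr1 | hr1
    · refine hxβ ?_
      have := hK hxC.1 hxC.2 (a := 1 - r) (b := r) (by linarith) hr.le (by ring)
      convert this using 1
      module
    · exact hnot (mem_interior_of_combo hK hx'int hβK (a := r - 1) (b := 1) (by linarith)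
        zero_le_one (by module))
  · exact htL ⟨_, (hmemM 1 _).2
      ⟨β, hβ, hxβ, by linarith, interior_subset hx'int, hmem, hnot, hβK⟩, hx't⟩

end

/-! ### Extreme points exist in every translate -/

theorem mem_copyAt {K : Set ℂ} {c z : ℂ} : z ∈ copyAt K c ↔ z - c ∈ K := by
  simp only [copyAt, Set.mem_image]
  exact ⟨fun ⟨w, hw, h⟩ => by rwa [← h, add_sub_cancel_left], fun h => ⟨_, h, by ring⟩⟩

theorem mem_reflAt {K : Set ℂ} {c z : ℂ} : z ∈ reflAt K c ↔ c - z ∈ K := by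
  simp only [reflAt, Set.mem_image]
  exact ⟨fun ⟨w, hw, h⟩ => by rwa [← h, sub_sub_cancel], fun h => ⟨_, h, by ring⟩⟩

theorem mem_frontier_reflAt {K : Set ℂ} {c z : ℂ} :
    z ∈ frontier (reflAt K c) ↔ c - z ∈ frontier K := by
  have h : reflAt K c = (Homeomorph.subLeft c) '' K := rfl
  rw [h, ← Homeomorph.image_frontier]
  exact mem_reflAt (K := frontier K)

/-- An open set covered by finitely many closed sets meets the interior of one of them. -/
theorem exists_inter_interior_nonempty {X ι : Type*} [TopologicalSpace X] {f : ι → Set X}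
    (s : Finset ι) {W : Set X} (hW : IsOpen W) (hne : W.Nonempty) (hf : ∀ i ∈ s, IsClosed (f i))
    (hsub : ∀ x ∈ W, ∃ i ∈ s, x ∈ f i) : ∃ i ∈ s, (W ∩ interior (f i)).Nonempty := by
  classical
  induction s using Finset.induction_on generalizing W with
  | empty =>
    obtain ⟨x, hx⟩ := hne
    obtain ⟨i, hi, -⟩ := hsub x hx
    simp at hi
  | insert a s ha ih =>
    by_cases h : W ⊆ f a
    · obtain ⟨x, hx⟩ := hne
      exact ⟨a, Finset.mem_insert_self _ _, x, hx, interior_maximal h hW hx⟩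
    · obtain ⟨x, hx, hxa⟩ := Set.not_subset.1 h
      obtain ⟨i, hi, y, hy, hyi⟩ := ih (W := W \ f a)
        (hW.sdiff (hf a (Finset.mem_insert_self _ _))) ⟨x, hx, hxa⟩
        (fun i hi => hf i (Finset.mem_insert_of_mem hi)) (by
          rintro y ⟨hy, hya⟩
          obtain ⟨i, hi, hyi⟩ := hsub y hy
          rcases Finset.mem_insert.1 hi with rfl | hi
          · exact absurd hyi hya
          · exact ⟨i, hi, hyi⟩)
      exact ⟨i, Finset.mem_insert_of_mem hi, y, hy.1, hyi⟩

section

variable {K : Set ℂ}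

/-- The Voronoi cells are star-shaped, and so are their interiors. -/
theorem mem_interior_voronoiCell (hK : Convex ℝ K) (h0 : K ∈ nhds (0 : ℂ)) {P : Finset ℂ}
    {T : Set ℂ} {q x : ℂ} (hx : x ∈ interior (voronoiCell K P T q)) {t : ℝ} (ht : 0 < t)
    (ht1 : t ≤ 1) : q + t • (x - q) ∈ interior (voronoiCell K P T q) := by
  refine mem_interior.2 ⟨(fun y => q + t⁻¹ • (y - q)) ⁻¹' interior (voronoiCell K P T q), ?_,
    isOpen_interior.preimage (by fun_prop), ?_⟩
  · intro y' hy' q₂ hq₂ hq₂T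
    have hy := interior_subset hy' q₂ hq₂ hq₂T
    set y := q + t⁻¹ • (y' - q) with hydef
    have habs := absorbent_nhds_zero h0 (𝕜 := ℝ)
    have h1 : q - y' = t • (q - y) := by
      rw [hydef]
      simp only [sub_add_cancel_left, smul_neg, smul_inv_smul₀ ht.ne', neg_sub]
    have h2 : q₂ - y = (q₂ - y') + (1 - t) • (q - y) := by
      rw [sub_smul, one_smul, ← h1]; ring
    have h3 : gauge K (q₂ - y) ≤ gauge K (q₂ - y') + gauge K ((1 - t) • (q - y)) := by
      conv_lhs => rw [h2]
      exact gauge_add_le hK habs _ _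
    rw [gauge_smul_of_nonneg (by linarith), smul_eq_mul] at h3
    have h4 : gauge K (q - y') = t * gauge K (q - y) := by
      rw [h1, gauge_smul_of_nonneg ht.le, smul_eq_mul]
    unfold convexDist at hy ⊢
    linarith
  · simp only [Set.mem_preimage, add_sub_cancel_left, inv_smul_smul₀ ht.ne', add_sub_cancel]
    exact hx

theorem isClosed_voronoiCell (hK : Convex ℝ K) (h0 : K ∈ nhds (0 : ℂ)) (P : Finset ℂ) (T : Set ℂ)
    (q : ℂ) : IsClosed (voronoiCell K P T q) := by
  have hg := continuous_gauge hK h0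
  have : voronoiCell K P T q =
      ⋂ q₂ ∈ {q₂ | q₂ ∈ P ∧ q₂ ∈ T}, {x | gauge K (q - x) ≤ gauge K (q₂ - x)} := by
    ext x
    simp [voronoiCell, convexDist]
  rw [this]
  exact isClosed_biInter fun q₂ _ => isClosed_le (by fun_prop) (by fun_prop)

/-- If `p` lies on the boundary of a translate that contains `o` in its interior, then the
translate contains an extreme point, or it can be moved such that it loses `p`, gains no point,
and still contains a point: if all points in the translate leave it together with `p`, then the
Voronoi cell of one of them has interior points close to the centre of the translate. -/
theorem exists_extreme_or_exists_smaller (hK : Convex ℝ K) (hKc : IsCompact K)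
    (h0 : K ∈ nhds (0 : ℂ)) {P : Finset ℂ} {T : Set ℂ} {o c p : ℂ} (hp : p ∈ P) (hpT : p ∈ T)
    (ho : o - c ∈ interior K) (hpc : p - c ∈ K) (hpc' : p - c ∉ interior K) :
    (∃ q ∈ extremePoints K P T o, q - c ∈ K) ∨
      ∃ c', o - c' ∈ K ∧ (∃ q ∈ P, q ∈ T ∧ q - c' ∈ K) ∧ p - c' ∉ K ∧
        ∀ q ∈ P, q ∈ T → q - c' ∈ K → q - c ∈ K := by
  classical
  have hg := continuous_gauge hK h0
  have hmem : ∀ z, z ∈ K ↔ gauge K z ≤ 1 := fun z => by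
    rw [gauge_le_one_iff_mem_closure hK h0, hKc.isClosed.closure_eq]
  have hpg : gauge K (p - c) = 1 := by
    rw [gauge_eq_one_iff_mem_frontier hK h0, frontier, hKc.isClosed.closure_eq]
    exact ⟨hpc, hpc'⟩
  let h : ℂ → ℂ → ℂ := fun q x => q + (max 1 (gauge K (q - x)))⁻¹ • (x - q)
  have hmax : ∀ q x, max 1 (gauge K (q - x)) ≠ 0 := fun q x =>
    (zero_lt_one.trans_le (le_max_left _ _)).ne'
  have hh : ∀ q, Continuous (h q) := fun q => by
    have h1 : Continuous fun x => (max 1 (gauge K (q - x)))⁻¹ :=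
      Continuous.inv₀ (by fun_prop) (hmax q)
    fun_prop
  have hE1 : ∀ᶠ x in nhds c, ∀ q ∈ P, q - c ∉ K →
      gauge K (p - x) < gauge K (q - x) ∧ q - x ∉ K := by
    refine (Finset.eventually_all P).2 fun q _ => ?_
    by_cases hq : q - c ∈ K
    · exact Filter.Eventually.of_forall fun _ h => absurd hq h
    have hq1 : 1 < gauge K (q - c) := by rw [hmem] at hq; exact not_le.1 hq
    have h1 : ∀ᶠ x in nhds c, gauge K (p - x) < gauge K (q - x) :=
      (isOpen_lt (f := fun x => gauge K (p - x)) (g := fun x => gauge K (q - x)) (by fun_prop)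
        (by fun_prop)).mem_nhds (by simpa [hpg] using hq1)
    have h2 : ∀ᶠ x in nhds c, 1 < gauge K (q - x) :=
      (isOpen_lt (f := fun x => (1 : ℝ)) (g := fun x => gauge K (q - x)) (by fun_prop)
        (by fun_prop)).mem_nhds hq1
    filter_upwards [h1, h2] with x hx1 hx2 _
    exact ⟨hx1, by rw [hmem]; exact not_le.2 hx2⟩
  have hE2 : ∀ᶠ x in nhds c, o - x ∈ interior K :=
    (isOpen_interior.preimage (f := fun x => o - x) (by fun_prop)).mem_nhds ho
  have hE3 : ∀ᶠ x in nhds c, ∀ q ∈ P, q - c ∈ K → o - h q x ∈ interior K := by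
    refine (Finset.eventually_all P).2 fun q _ => ?_
    by_cases hq : q - c ∈ K
    · have hqc : h q c = c := by
        have : gauge K (q - c) ≤ 1 := (hmem _).1 hq
        simp [h, max_eq_left this]
      have : ∀ᶠ x in nhds c, o - h q x ∈ interior K :=
        (isOpen_interior.preimage (f := fun x => o - h q x)
          (continuous_const.sub (hh q))).mem_nhds (by simpa [hqc] using ho)
      filter_upwards [this] with x hx _ using hx
    · exact Filter.Eventually.of_forall fun _ h => absurd h hq
  obtain ⟨U, hU, hUo, hcU⟩ := eventually_nhds_iff.1 (hE1.and (hE2.and hE3))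
  -- positions close to `c` at which `p` is just outside
  have hWo : IsOpen (U ∩ {x | 1 < gauge K (p - x)}) :=
    hUo.inter (isOpen_lt (by fun_prop) (by fun_prop))
  have hWne : (U ∩ {x | 1 < gauge K (p - x)}).Nonempty := by
    have hopen : IsOpen {s : ℝ | c - s • (p - c) ∈ U} :=
      hUo.preimage (f := fun s : ℝ => c - s • (p - c)) (by fun_prop)
    obtain ⟨ε, hε, hball⟩ := Metric.isOpen_iff.1 hopen 0 (by simpa using hcU)
    have hm := hball (show ε / 2 ∈ Metric.ball (0 : ℝ) ε by simpa [abs_of_pos hε] using hε)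
    refine ⟨_, hm, ?_⟩
    have : p - (c - (ε / 2) • (p - c)) = (1 + ε / 2) • (p - c) := by module
    rw [Set.mem_ofPred_eq, this, gauge_smul_of_nonneg (by positivity), hpg, smul_eq_mul]
    linarith
  by_cases hex : ∃ x ∈ U ∩ {x | 1 < gauge K (p - x)}, ∃ q ∈ P, q ∈ T ∧ q - x ∈ K
  · right
    obtain ⟨x, ⟨hxU, hxp⟩, q, hq, hqT, hqx⟩ := hex
    obtain ⟨h1, h2, -⟩ := hU x hxU
    refine ⟨x, interior_subset h2, ⟨q, hq, hqT, hqx⟩, ?_, fun q' hq' _ hq'x => ?_⟩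
    · rw [hmem]; exact not_le.2 hxp
    · by_contra hcon
      exact (h1 q' hq' hcon).2 hq'x
  · left
    push Not at hex
    obtain ⟨q, hq, x, ⟨hxU, hxp⟩, hxq⟩ := exists_inter_interior_nonempty
      (f := voronoiCell K P T) (P.filter (· ∈ T)) hWo hWne
      (fun q _ => isClosed_voronoiCell hK h0 P T q) (by
        intro x _
        obtain ⟨q, hq, hmin⟩ := (P.filter (· ∈ T)).exists_min_image (fun q => gauge K (q - x))
          ⟨p, Finset.mem_filter.2 ⟨hp, hpT⟩⟩
        exact ⟨q, hq, fun q' hq' hq'T => hmin q' (Finset.mem_filter.2 ⟨hq', hq'T⟩)⟩)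
    obtain ⟨hqP, hqT⟩ := Finset.mem_filter.1 hq
    obtain ⟨h1, h2, h3⟩ := hU x hxU
    have hqc : q - c ∈ K := by
      by_contra hcon
      exact (h1 q hqP hcon).1.not_ge (interior_subset hxq p hp hpT)
    have hgq : 1 < gauge K (q - x) := by
      have := hex x ⟨hxU, hxp⟩ q hqP hqT
      rw [hmem] at this
      exact not_le.1 this
    refine ⟨q, ?_, hqc⟩
    refine Finset.mem_filter.2 ⟨hqP, hqT, h q x, ⟨?_, ?_⟩, ?_⟩
    · exact mem_reflAt.2 (interior_subset (h3 q hqP hqc))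
    · rw [mem_frontier_reflAt, ← gauge_eq_one_iff_mem_frontier hK h0]
      have : q - h q x = (max 1 (gauge K (q - x)))⁻¹ • (q - x) := by
        simp only [h]; module
      rw [this, max_eq_right hgq.le, gauge_smul_of_nonneg (by positivity), smul_eq_mul,
        inv_mul_cancel₀ (by positivity)]
    · refine mem_interior_voronoiCell hK h0 hxq (inv_pos.2 (by positivity)) ?_
      exact inv_le_one_of_one_le₀ (le_max_left _ _)

/-- Every translate that contains the quadrant centre `o` and a point of the tile contains an
extreme point. -/
theorem exists_mem_extremePoints (hK : Convex ℝ K) (hKc : IsCompact K)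
    (h0 : K ∈ nhds (0 : ℂ)) {P : Finset ℂ} {T : Set ℂ} {o : ℂ} {S : Set ℂ}
    (hS : ∀ p ∈ T, p - o ∈ S) (hgood : CrossingFree K S) {e : ℂ →ₗ[ℝ] ℝ}
    (he : ∀ β ∈ S, 0 < e β)
    (hhalf : ∀ β ∈ S, (1 / 2 : ℝ) • β ∈ interior K ∧ (-(1 / 2) : ℝ) • β ∈ interior K) {c p : ℂ}
    (hp : p ∈ P) (hpT : p ∈ T) (ho : o - c ∈ K) (hpc : p - c ∈ K) :
    ∃ q ∈ extremePoints K P T o, q - c ∈ K := by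
  classical
  induction hn : (P.filter fun q => q ∈ T ∧ q - c ∈ K).card using Nat.strong_induction_on
    generalizing c p with
  | _ n ih =>
  subst hn
  -- make `o` and `p` interior
  obtain ⟨c₁, ho₁, hp₁, hsub₁⟩ : ∃ c₁, o - c₁ ∈ interior K ∧ p - c₁ ∈ interior K ∧
      ∀ q ∈ P, q - c₁ ∈ K → q - c ∈ K := by
    set m := o + (1 / 2 : ℝ) • (p - o) with hm
    have hE : ∀ᶠ s in nhds (0 : ℝ), ∀ q ∈ P, q - (c + s • (m - c)) ∈ K → q - c ∈ K := by
      refine (Finset.eventually_all P).2 fun q _ => ?_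
      by_cases hq : q - c ∈ K
      · exact Filter.Eventually.of_forall fun _ _ => hq
      · have : ∀ᶠ s in nhds (0 : ℝ), q - (c + s • (m - c)) ∉ K :=
          (hKc.isClosed.isOpen_compl.preimage (f := fun s : ℝ => q - (c + s • (m - c)))
            (by fun_prop)).mem_nhds (by simpa using hq)
        filter_upwards [this] with s hs h using absurd h hs
    obtain ⟨ε, hε, hball⟩ := Metric.eventually_nhds_iff_ball.1 hE
    have hη : 0 < min (ε / 2) 1 := lt_min (by linarith) one_pos
    set η := min (ε / 2) 1 with hηdef
    have hη1 : η ≤ 1 := min_le_right _ _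
    have hηε : η ≤ ε / 2 := min_le_left _ _
    obtain ⟨hh1, hh2⟩ := hhalf _ (hS p hpT)
    refine ⟨c + η • (m - c), ?_, ?_, hball η ?_⟩
    · refine mem_interior_of_combo hK hh2 ho hη (b := 1 - η) (by linarith) ?_
      rw [hm]; module
    · refine mem_interior_of_combo hK hh1 hpc hη (b := 1 - η) (by linarith) ?_
      rw [hm]; module
    · simp only [Metric.mem_ball, dist_zero_right, Real.norm_eq_abs, abs_of_pos hη]
      linarith
  have hBS : ∀ β ∈ (P.filter (· ∈ T)).image (· - o), β ∈ S := by
    intro β hβ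
    obtain ⟨q, hq, rfl⟩ := Finset.mem_image.1 hβ
    exact hS q (Finset.mem_filter.1 hq).2
  have hB : ∀ q ∈ P, q ∈ T → q - o ∈ (P.filter (· ∈ T)).image (· - o) := fun q hq hqT =>
    Finset.mem_image_of_mem _ (Finset.mem_filter.2 ⟨hq, hqT⟩)
  obtain ⟨x, hx, hxp, hxp', hsub⟩ := exists_mem_boundary hK hKc
    (B := (P.filter (· ∈ T)).image (· - o))
    (fun α hα δ hδ => hgood α (hBS α hα) δ (hBS δ hδ)) (fun β hβ => he β (hBS β hβ))
    (hB p hp hpT) ho₁ (by convert hp₁ using 1; ring)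
  have hsub' : ∀ q ∈ P, q ∈ T → q - (o - x) ∈ K → q - c ∈ K := by
    intro q hq hqT hqx
    refine hsub₁ q hq ?_
    have := hsub _ (hB q hq hqT) (by convert hqx using 1; ring)
    convert this using 1; ring
  have e1 : p - (o - x) = x + (p - o) := by ring
  rcases exists_extreme_or_exists_smaller hK hKc h0 (o := o) (c := o - x) hp hpT
    (by simpa using hx) (by rwa [e1]) (by rwa [e1]) with
    ⟨q, hq, hqx⟩ | ⟨c', hc', ⟨q, hq, hqT, hqc'⟩, hpc', hsub''⟩
  · have hq' := Finset.mem_filter.1 hq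
    exact ⟨q, hq, hsub' q hq'.1 hq'.2.1 hqx⟩
  · have hlt : (P.filter fun q => q ∈ T ∧ q - c' ∈ K) ⊂ P.filter fun q => q ∈ T ∧ q - c ∈ K := by
      refine (Finset.ssubset_iff_of_subset ?_).2 ⟨p, ?_, ?_⟩
      · intro r hr
        obtain ⟨h1, h2, h3⟩ := Finset.mem_filter.1 hr
        exact Finset.mem_filter.2 ⟨h1, h2, hsub' r h1 h2 (hsub'' r h1 h2 h3)⟩
      · exact Finset.mem_filter.2 ⟨hp, hpT, hpc⟩
      · intro h
        exact hpc' (Finset.mem_filter.1 h).2.2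
    obtain ⟨q', hq', hq'c⟩ := ih _ (Finset.card_lt_card hlt) hq hqT hc' hqc' rfl
    have hq'' := Finset.mem_filter.1 hq'
    exact ⟨q', hq', hsub' q' hq''.1 hq''.2.1 (hsub'' q' hq''.1 hq''.2.1 hq'c)⟩

end

/-! ### Tiles and quadrant centres -/

theorem cos_pi_div_ge {k : ℕ} {m : ℝ} (hm : 0 < m) (hk : m ≤ k) :
    1 - (3.1416 / m) ^ 2 / 2 ≤ Real.cos (Real.pi / k) := by
  have h1 := Real.one_sub_sq_div_two_le_cos (x := Real.pi / k)
  have hpi := Real.pi_pos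
  have h2 : Real.pi / k ≤ 3.1416 / m :=
    div_le_div₀ (by norm_num) Real.pi_lt_d4.le hm hk
  have h3 : (Real.pi / k) ^ 2 ≤ (3.1416 / m) ^ 2 :=
    pow_le_pow_left₀ (by positivity) h2 2
  linarith

theorem tileSide_pos {k : ℕ} {R : ℝ} (hR : 0 < R) : 0 < tileSide k R := by
  unfold tileSide; split_ifs <;> positivity

theorem superSide_pos {k : ℕ} {R : ℝ} (hR : 0 < R) : 0 < superSide k R := by
  unfold superSide; split_ifs <;> positivity

theorem closedBall_subset_polygon {k : ℕ} {R φ r : ℝ} (hk : 0 < k) (hR : 0 < R)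
    (hr : r ≤ Real.cos (Real.pi / k)) : Metric.closedBall 0 (R * r) ⊆ polygon k R φ := by
  intro z hz
  refine mem_polygon_of_norm_le hk hR.le ?_
  rw [Metric.mem_closedBall, dist_zero_right] at hz
  exact hz.trans (by gcongr)

theorem polygon_subset_closedBall {k : ℕ} {R φ : ℝ} (hR : 0 ≤ R) :
    polygon k R φ ⊆ Metric.closedBall 0 R := fun z hz => by
  simpa using norm_le_of_mem_polygon hR hz

theorem norm_sq_eq_div {u : ℂ} (hu : ‖u‖ = 1) (z : ℂ) :
    ‖z‖ ^ 2 = (z / u).re ^ 2 + (z / u).im ^ 2 := by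
  have h : ‖z‖ = ‖z / u‖ := by rw [norm_div, hu, div_one]
  rw [h, ← Complex.normSq_eq_norm_sq, Complex.normSq_apply]
  ring

/-- The quadrant of the super-square, moved to the centre of the polygon, is contained in the
polygon. -/
theorem mem_polygon_of_abs_le {k : ℕ} (hk : 4 ≤ k) {R : ℝ} (hR : 0 < R) {φ : ℝ} {u : ℂ}
    (hu : GridDirection k R φ u) {z : ℂ} (hx : |(z / u).re| ≤ superSide k R / 4)
    (hy : |(z / u).im| ≤ superSide k R / 4) : z ∈ polygon k R φ := by
  rcases hk.eq_or_lt with rfl | hk4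
  · obtain ⟨r, hr⟩ := hu.2 rfl
    rw [mem_polygon_four hR hu.1 hr]
    have h2 : (0 : ℝ) < √2 := by positivity
    have h3 : superSide 4 R / 4 ≤ R / √2 := by
      have h4 : √2 ≤ 1.6 := by
        rw [Real.sqrt_le_left (by norm_num)]; norm_num
      rw [le_div_iff₀ h2]
      simp only [superSide]
      norm_num
      nlinarith
    exact ⟨hx.trans h3, hy.trans h3⟩
  · have hsq : ∀ {v : ℝ}, |v| ≤ superSide k R / 4 → v ^ 2 ≤ (superSide k R / 4) ^ 2 := fun h =>
      sq_le_sq' (abs_le.1 h).1 (abs_le.1 h).2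
    have hn := norm_sq_eq_div hu.1 z
    have hx2 := hsq hx
    have hy2 := hsq hy
    have key : ∀ r : ℝ, 0 ≤ r → r ≤ Real.cos (Real.pi / k) →
        2 * (superSide k R / 4) ^ 2 ≤ (R * r) ^ 2 → z ∈ polygon k R φ := by
      intro r hr0 hr hle
      refine closedBall_subset_polygon (by omega) hR hr ?_
      rw [Metric.mem_closedBall, dist_zero_right]
      refine le_of_sq_le_sq ?_ (by positivity)
      linarith
    by_cases h : k = 5 ∨ k = 6
    · have hk5 : (5 : ℝ) ≤ k := by exact_mod_cast hk4
      refine key 0.8 (by norm_num) (le_trans (by norm_num) (cos_pi_div_ge (by norm_num) hk5)) ?_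
      rw [superSide, if_pos h]
      nlinarith [sq_nonneg R]
    · have hk7 : (7 : ℝ) ≤ k := by exact_mod_cast (by omega : 7 ≤ k)
      refine key 0.89 (by norm_num) (le_trans (by norm_num) (cos_pi_div_ge (by norm_num) hk7)) ?_
      rw [superSide, if_neg h]
      nlinarith [sq_nonneg R]

theorem mem_interior_polygon_of_abs_lt {k : ℕ} (hk : 4 ≤ k) {R : ℝ} (hR : 0 < R) {φ : ℝ} {u : ℂ}
    (hu : GridDirection k R φ u) {z : ℂ} (hx : |(z / u).re| < superSide k R / 4)
    (hy : |(z / u).im| < superSide k R / 4) : z ∈ interior (polygon k R φ) := by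
  refine mem_interior.2 ⟨{z | |(z / u).re| < superSide k R / 4 ∧ |(z / u).im| < superSide k R / 4},
    fun w hw => mem_polygon_of_abs_le hk hR hu hw.1.le hw.2.le, ?_, ⟨hx, hy⟩⟩
  exact (isOpen_lt (f := fun z : ℂ => |(z / u).re|) (by fun_prop) continuous_const).inter
    (isOpen_lt (f := fun z : ℂ => |(z / u).im|) (by fun_prop) continuous_const)

theorem polygon_mem_nhds {k : ℕ} (hk : 4 ≤ k) {R : ℝ} (hR : 0 < R) {φ : ℝ} {u : ℂ}
    (hu : GridDirection k R φ u) : polygon k R φ ∈ nhds (0 : ℂ) := by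
  rw [mem_nhds_iff]
  refine ⟨_, interior_subset, isOpen_interior, mem_interior_polygon_of_abs_lt hk hR hu ?_ ?_⟩ <;>
  · have := superSide_pos (k := k) hR
    simp; linarith

theorem quadrantSign_sq (q : Fin 4) :
    (quadrantSign q).1 * (quadrantSign q).1 = 1 ∧ (quadrantSign q).2 * (quadrantSign q).2 = 1 := by
  fin_cases q <;> simp [quadrantSign]

/-- The first coordinate along the grid, oriented such that the tile is on the positive side of
the centre of the quadrant `q`. -/
noncomputable def hatX (u : ℂ) (q : Fin 4) : ℂ →ₗ[ℝ] ℝ :=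
  (-(quadrantSign q).1) • Complex.reLm.comp (LinearMap.mulLeft ℝ u⁻¹)

/-- The second coordinate along the grid, oriented such that the tile is on the positive side of
the centre of the quadrant `q`. -/
noncomputable def hatY (u : ℂ) (q : Fin 4) : ℂ →ₗ[ℝ] ℝ :=
  (-(quadrantSign q).2) • Complex.imLm.comp (LinearMap.mulLeft ℝ u⁻¹)

theorem hatX_apply (u : ℂ) (q : Fin 4) (z : ℂ) :
    hatX u q z = -(quadrantSign q).1 * (z / u).re := by
  simp [hatX, div_eq_inv_mul]

theorem hatY_apply (u : ℂ) (q : Fin 4) (z : ℂ) :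
    hatY u q z = -(quadrantSign q).2 * (z / u).im := by
  simp [hatY, div_eq_inv_mul]

/-- The vectors from a quadrant centre to the points of the (closed) tile. -/
def tileBox (ℓ t : ℝ) (u : ℂ) (q : Fin 4) : Set ℂ :=
  {z | t / 4 - ℓ / 2 ≤ hatX u q z ∧ hatX u q z ≤ t / 4 + ℓ / 2 ∧
    t / 4 - ℓ / 2 ≤ hatY u q z ∧ hatY u q z ≤ t / 4 + ℓ / 2}

theorem tileCenter_sub_div {u : ℂ} (hu : u ≠ 0) (ℓ : ℝ) (a z : ℂ) (s : ℤ × ℤ) :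
    ((z - tileCenter ℓ u a s) / u).re = ((z - a) / u).re - (s.1 + 1 / 2) * ℓ ∧
    ((z - tileCenter ℓ u a s) / u).im = ((z - a) / u).im - (s.2 + 1 / 2) * ℓ := by
  have : (z - tileCenter ℓ u a s) / u = (z - a) / u -
      (((s.1 + 1 / 2) * ℓ : ℝ) + ((s.2 + 1 / 2) * ℓ : ℝ) * Complex.I) := by
    unfold tileCenter; field_simp; ring
  rw [this]
  simp [-Complex.ofReal_mul, -Complex.ofReal_add]

theorem quadrantCenter_sub_div {u : ℂ} (hu : u ≠ 0) (ℓ t : ℝ) (a z : ℂ) (s : ℤ × ℤ) (q : Fin 4) :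
    ((z - quadrantCenter ℓ t u a s q) / u).re =
      ((z - tileCenter ℓ u a s) / u).re - (quadrantSign q).1 * (t / 4) ∧
    ((z - quadrantCenter ℓ t u a s q) / u).im =
      ((z - tileCenter ℓ u a s) / u).im - (quadrantSign q).2 * (t / 4) := by
  have : (z - quadrantCenter ℓ t u a s q) / u = (z - tileCenter ℓ u a s) / u -
      (((quadrantSign q).1 * (t / 4) : ℝ) + ((quadrantSign q).2 * (t / 4) : ℝ) * Complex.I) := by
    unfold quadrantCenter; field_simp; ring
  rw [this]
  simp [-Complex.ofReal_mul]

theorem sub_mem_tileBox {ℓ t : ℝ} {u a : ℂ} (hu : u ≠ 0) {s : ℤ × ℤ} (q : Fin 4) {p : ℂ}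
    (hp : p ∈ tile ℓ u a s) : p - quadrantCenter ℓ t u a s q ∈ tileBox ℓ t u q := by
  obtain ⟨h1, h2, h3, h4⟩ := hp
  obtain ⟨e1, e2⟩ := quadrantCenter_sub_div hu ℓ t a p s q
  obtain ⟨e3, e4⟩ := tileCenter_sub_div hu ℓ a p s
  simp only [tileBox, Set.mem_ofPred_eq, hatX_apply, hatY_apply, e1, e2, e3, e4]
  fin_cases q <;> simp [quadrantSign] <;> refine ⟨?_, ?_, ?_, ?_⟩ <;> linarith

theorem tileBox_pos {k : ℕ} {R : ℝ} (hR : 0 < R) {u : ℂ} {q : Fin 4} {z : ℂ}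
    (hz : z ∈ tileBox (tileSide k R) (superSide k R) u q) : 0 < hatX u q z ∧ 0 < hatY u q z := by
  have h : 0 < superSide k R / 4 - tileSide k R / 2 := by
    unfold superSide tileSide; split_ifs <;> linarith
  exact ⟨h.trans_le hz.1, h.trans_le hz.2.2.1⟩

/-- The midpoint `m` of the quadrant centre `o` and a point `p` of the tile is a position in whose
translate both `o` and `p` are interior. -/
theorem half_mem_interior {k : ℕ} (hk : 4 ≤ k) {R : ℝ} (hR : 0 < R) {φ : ℝ} {u : ℂ}
    (hu : GridDirection k R φ u) {q : Fin 4} {z : ℂ}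
    (hz : z ∈ tileBox (tileSide k R) (superSide k R) u q) :
    (1 / 2 : ℝ) • z ∈ interior (polygon k R φ) ∧
      (-(1 / 2) : ℝ) • z ∈ interior (polygon k R φ) := by
  have h : (superSide k R / 4 + tileSide k R / 2) / 2 < superSide k R / 4 := by
    unfold superSide tileSide; split_ifs <;> linarith
  have hpos := tileBox_pos hR hz
  obtain ⟨-, h2, -, h4⟩ := hz
  rw [hatX_apply] at h2 hpos
  rw [hatY_apply] at h4 hpos
  have hX : |(z / u).re| ≤ superSide k R / 4 + tileSide k R / 2 := by
    rw [abs_le]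
    fin_cases q <;> simp [quadrantSign] at * <;> constructor <;> linarith
  have hY : |(z / u).im| ≤ superSide k R / 4 + tileSide k R / 2 := by
    rw [abs_le]
    fin_cases q <;> simp [quadrantSign] at * <;> constructor <;> linarith
  have hd : ∀ c : ℝ, (c • z / u).re = c * (z / u).re ∧ (c • z / u).im = c * (z / u).im := by
    intro c
    have : c • z / u = c * (z / u) := by simp [mul_div_assoc]
    rw [this]
    simp
  constructor <;> refine mem_interior_polygon_of_abs_lt hk hR hu ?_ ?_ <;>
    simp only [(hd _).1, (hd _).2, abs_mul, abs_neg] <;> rw [abs_of_pos (by norm_num)] <;> linarith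

/-- Two translates of the polygon that contain a quadrant centre cannot cross twice inside the
tile. -/
theorem crossingFree_polygon {k : ℕ} (hk : 4 ≤ k) {R : ℝ} (hR : 0 < R) {φ : ℝ} {u : ℂ}
    (hu : GridDirection k R φ u) (q : Fin 4) :
    CrossingFree (polygon k R φ) (tileBox (tileSide k R) (superSide k R) u q) := by
  have hu0 : u ≠ 0 := by rintro rfl; simpa using hu.1
  obtain ⟨hq1, hq2⟩ := quadrantSign_sq q
  have hXY : ∀ z, ‖z‖ ^ 2 = hatX u q z ^ 2 + hatY u q z ^ 2 := fun z => by
    rw [norm_sq_eq_div hu.1, hatX_apply, hatY_apply]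
    linear_combination -(z / u).re ^ 2 * hq1 - (z / u).im ^ 2 * hq2
  have hsurj : ∀ a b : ℝ, ∃ z, hatX u q z = a ∧ hatY u q z = b := fun a b => by
    refine ⟨u * ⟨-(quadrantSign q).1 * a, -(quadrantSign q).2 * b⟩, ?_, ?_⟩
    · rw [hatX_apply, mul_div_cancel_left₀ _ hu0]
      linear_combination a * hq1
    · rw [hatY_apply, mul_div_cancel_left₀ _ hu0]
      linear_combination b * hq2
  rcases hk.eq_or_lt with rfl | hk4
  · obtain ⟨r, hr⟩ := hu.2 rfl
    refine crossingFree_of_square (h := R / √2) (LinearMap.continuous_of_finiteDimensional _)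
      (LinearMap.continuous_of_finiteDimensional _) (fun z => ?_) ?_
    · rw [mem_polygon_four hR hu.1 hr, hatX_apply, hatY_apply]
      have habs : ∀ v : ℝ, v * v = 1 → |v| = 1 := fun v hv => by
        rcases mul_self_eq_one_iff.1 hv with rfl | rfl <;> simp
      rw [abs_mul, abs_mul, abs_neg, abs_neg, habs _ hq1, habs _ hq2, one_mul, one_mul]
    · unfold superSide tileSide; norm_num; linarith
  have key : ∀ r l m : ℝ, r ≤ Real.cos (Real.pi / k) →
      superSide k R / 4 - tileSide k R / 2 = R * l → superSide k R / 4 + tileSide k R / 2 = R * m →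
      0 < l → l ≤ m → 1 < l + r → 3 * (m - l) < 2 * r →
      (∀ f g : ℝ, 0 ≤ f → 0 ≤ g → f ^ 2 + g ^ 2 = 1 → l * f ≤ m * g →
        (m - l + 0.7072) * f - 0.7072 * g < r) →
      CrossingFree (polygon k R φ) (tileBox (tileSide k R) (superSide k R) u q) := by
    intro r l m hr h1 h2 hl hlm hlr hd hN
    have := crossingFree_of_ball (convex_polygon k R φ) hR
      (closedBall_subset_polygon (by omega) hR hr) (polygon_subset_closedBall hR.le) hXY hsurj hl
      hlm hlr hd hN
    rwa [← h1, ← h2] at this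
  by_cases h : k = 5 ∨ k = 6
  · have hk5 : (5 : ℝ) ≤ k := by exact_mod_cast hk4
    refine key 0.8 (7 / 16) (11 / 16) (le_trans (by norm_num) (cos_pi_div_ge (by norm_num) hk5))
      ?_ ?_ (by norm_num) (by norm_num) (by norm_num) (by norm_num) ?_
    · rw [superSide, tileSide, if_pos h, if_pos h]; ring
    · rw [superSide, tileSide, if_pos h, if_pos h]; ring
    · intro f g hf hg hfg hle
      have : f ≤ 1 := by nlinarith
      linarith
  · have hk7 : (7 : ℝ) ≤ k := by exact_mod_cast (by omega : 7 ≤ k)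
    refine key 0.89 (3 / 8) (7 / 8) (le_trans (by norm_num) (cos_pi_div_ge (by norm_num) hk7))
      ?_ ?_ (by norm_num) (by norm_num) (by norm_num) (by norm_num) ?_
    · rw [superSide, tileSide, if_neg h, if_neg h]; ring
    · rw [superSide, tileSide, if_neg h, if_neg h]; ring
    · intro f g hf hg hfg hle
      have : f ≤ 0.92 := by
        by_contra! hlt
        nlinarith
      linarith

theorem abs_re_le_of_mem_polygon {k : ℕ} {R : ℝ} (hR : 0 < R) {φ : ℝ} {u : ℂ} (hu : ‖u‖ = 1)
    {z : ℂ} (hz : z ∈ polygon k R φ) : |(z / u).re| ≤ R ∧ |(z / u).im| ≤ R := by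
  have h : ‖z / u‖ ≤ R := by
    rw [norm_div, hu, div_one]; exact norm_le_of_mem_polygon hR.le hz
  exact ⟨(Complex.abs_re_le_norm _).trans h, (Complex.abs_im_le_norm _).trans h⟩

/-- Every translate that meets a tile contains one of the four quadrant centres. -/
theorem exists_quadrantCenter_mem {k : ℕ} (hk : 4 ≤ k) {R : ℝ} (hR : 0 < R) {φ : ℝ} {u : ℂ}
    (hu : GridDirection k R φ u) {a c z : ℂ} {s : ℤ × ℤ}
    (hz : z ∈ copyAt (polygon k R φ) c) (hzs : z ∈ tile (tileSide k R) u a s) :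
    ∃ q, quadrantCenter (tileSide k R) (superSide k R) u a s q ∈ copyAt (polygon k R φ) c := by
  have hu0 : u ≠ 0 := by rintro rfl; simpa using hu.1
  rw [mem_copyAt] at hz
  obtain ⟨hx, hy⟩ := abs_re_le_of_mem_polygon hR hu.1 hz
  obtain ⟨h1, h2, h3, h4⟩ := hzs
  set ℓ := tileSide k R with hℓ
  set t := superSide k R with ht
  obtain ⟨e3, e4⟩ := tileCenter_sub_div hu0 ℓ a z s
  have hRt : R + ℓ / 2 = t / 2 := by
    rw [hℓ, ht]; unfold superSide tileSide; split_ifs <;> linarith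
  have hw : (z - c) / u = (z - tileCenter ℓ u a s) / u - (c - tileCenter ℓ u a s) / u := by ring
  rw [hw, Complex.sub_re, e3, abs_le] at hx
  rw [hw, Complex.sub_im, e4, abs_le] at hy
  set X := ((c - tileCenter ℓ u a s) / u).re with hX
  set Y := ((c - tileCenter ℓ u a s) / u).im with hY
  have key : ∀ q : Fin 4, |X - (quadrantSign q).1 * (t / 4)| ≤ t / 4 →
      |Y - (quadrantSign q).2 * (t / 4)| ≤ t / 4 →
      quadrantCenter ℓ t u a s q ∈ copyAt (polygon k R φ) c := by
    intro q hq1 hq2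
    obtain ⟨e1, e2⟩ := quadrantCenter_sub_div hu0 ℓ t a c s q
    rw [mem_copyAt]
    have hneg : (quadrantCenter ℓ t u a s q - c) / u = -((c - quadrantCenter ℓ t u a s q) / u) := by
      ring
    refine mem_polygon_of_abs_le hk hR hu ?_ ?_
    · rwa [hneg, Complex.neg_re, abs_neg, e1]
    · rwa [hneg, Complex.neg_im, abs_neg, e2]
  rcases le_total 0 X with hX0 | hX0 <;> rcases le_total 0 Y with hY0 | hY0
  · refine ⟨0, key 0 ?_ ?_⟩ <;> rw [abs_le] <;> simp [quadrantSign] <;> constructor <;> linarith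
  · refine ⟨3, key 3 ?_ ?_⟩ <;> rw [abs_le] <;> simp [quadrantSign] <;> constructor <;> linarith
  · refine ⟨1, key 1 ?_ ?_⟩ <;> rw [abs_le] <;> simp [quadrantSign] <;> constructor <;> linarith
  · refine ⟨2, key 2 ?_ ?_⟩ <;> rw [abs_le] <;> simp [quadrantSign] <;> constructor <;> linarith

/-- A translate that contains a quadrant centre and a point of the tile contains an extreme point
with respect to this centre. -/
theorem exists_mem_extremePoints_polygon {k : ℕ} (hk : 4 ≤ k) {R : ℝ} (hR : 0 < R) {φ : ℝ} {u : ℂ}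
    (hu : GridDirection k R φ u) {P : Finset ℂ} {a c p : ℂ} {s : ℤ × ℤ} {q : Fin 4} (hp : p ∈ P)
    (hps : p ∈ tile (tileSide k R) u a s) (hpc : p ∈ copyAt (polygon k R φ) c)
    (ho : quadrantCenter (tileSide k R) (superSide k R) u a s q ∈ copyAt (polygon k R φ) c) :
    ∃ v ∈ extremePoints (polygon k R φ) P (tile (tileSide k R) u a s)
      (quadrantCenter (tileSide k R) (superSide k R) u a s q), v ∈ copyAt (polygon k R φ) c := by
  have hu0 : u ≠ 0 := by rintro rfl; simpa using hu.1
  obtain ⟨v, hv, hvc⟩ := exists_mem_extremePoints (convex_polygon k R φ) (isCompact_polygon k R φ)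
    (polygon_mem_nhds hk hR hu) (T := tile (tileSide k R) u a s)
    (fun p hp => sub_mem_tileBox hu0 q hp) (crossingFree_polygon hk hR hu q)
    (e := hatX u q + hatY u q) (fun β hβ => add_pos (tileBox_pos hR hβ).1 (tileBox_pos hR hβ).2)
    (fun β hβ => half_mem_interior hk hR hu hβ) hp hps (mem_copyAt.1 ho) (mem_copyAt.1 hpc)
  exact ⟨v, hv, mem_copyAt.2 hvc⟩

/-! ### The angular order around a quadrant centre -/

theorem cross_eq_norm_mul_sin (a b : ℂ) :
    cross a b = ‖a‖ * ‖b‖ * Real.sin (b.arg - a.arg) := by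
  rw [Real.sin_sub, cross]
  conv_lhs => rw [← Complex.norm_mul_cos_arg a, ← Complex.norm_mul_sin_arg a,
    ← Complex.norm_mul_cos_arg b, ← Complex.norm_mul_sin_arg b]
  ring

theorem cross_div (a b : ℂ) {u : ℂ} (hu : ‖u‖ = 1) : cross (a / u) (b / u) = cross a b := by
  have hu2 : u.re * u.re + u.im * u.im = 1 := by
    rw [← Complex.normSq_apply, Complex.normSq_eq_norm_sq, hu]; norm_num
  have h : Complex.normSq u = 1 := by rw [Complex.normSq_apply, hu2]
  simp only [cross, Complex.div_re, Complex.div_im, h, div_one]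
  linear_combination (a.re * b.im - a.im * b.re) * hu2

theorem mul_im_pos_of_mem_tileBox {k : ℕ} {R : ℝ} (hR : 0 < R) {u : ℂ} {q : Fin 4} {a b : ℂ}
    (ha : a ∈ tileBox (tileSide k R) (superSide k R) u q)
    (hb : b ∈ tileBox (tileSide k R) (superSide k R) u q) : 0 < (a / u).im * (b / u).im := by
  have h := mul_pos (tileBox_pos hR ha).2 (tileBox_pos hR hb).2
  rw [hatY_apply, hatY_apply] at h
  have hq := (quadrantSign_sq q).2
  have : -(quadrantSign q).2 * (a / u).im * (-(quadrantSign q).2 * (b / u).im) =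
      (a / u).im * (b / u).im := by
    linear_combination ((a / u).im * (b / u).im) * hq
  rwa [this] at h

/-- Seen from the quadrant centre, the tile lies in an open quadrant of the grid directions, so
the angles of its points differ by less than `π` and the order by angle is the order given by the
sign of the determinant. -/
theorem cross_pos_of_arg_lt {k : ℕ} {R : ℝ} (hR : 0 < R) {u : ℂ} (hu : ‖u‖ = 1) {q : Fin 4}
    {a b : ℂ} (ha : a ∈ tileBox (tileSide k R) (superSide k R) u q)
    (hb : b ∈ tileBox (tileSide k R) (superSide k R) u q) (h : (a / u).arg < (b / u).arg) :
    0 < cross a b := by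
  have him := mul_im_pos_of_mem_tileBox hR ha hb
  rw [← cross_div a b hu, cross_eq_norm_mul_sin]
  have ha0 : a / u ≠ 0 := by intro h0; simp [h0] at him
  have hb0 : b / u ≠ 0 := by intro h0; simp [h0] at him
  have hsin : 0 < Real.sin ((b / u).arg - (a / u).arg) := by
    refine Real.sin_pos_of_pos_of_lt_pi (by linarith) ?_
    rcases pos_and_pos_or_neg_and_neg_of_mul_pos him with ⟨h1, h2⟩ | ⟨h1, h2⟩
    · have h3 : 0 ≤ (a / u).arg := Complex.arg_nonneg_iff.2 h1.le
      have h4 : (b / u).arg < Real.pi := Complex.arg_lt_pi_iff.2 (Or.inr h2.ne')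
      linarith
    · have h3 := Complex.neg_pi_lt_arg (a / u)
      have h4 : (b / u).arg < 0 := Complex.arg_neg_iff.2 h2
      linarith
  positivity

theorem exists_smul_of_arg_eq {u : ℂ} (hu : u ≠ 0) {a b : ℂ} (ha : a ≠ 0) (hb : b ≠ 0)
    (h : (a / u).arg = (b / u).arg) : ∃ r : ℝ, 0 < r ∧ b = r • a := by
  have ha' := div_ne_zero ha hu
  have hb' := div_ne_zero hb hu
  have hna := norm_pos_iff.2 ha'
  have hnb := norm_pos_iff.2 hb'
  have h1 := (Complex.arg_eq_arg_iff ha' hb').1 h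
  refine ⟨‖b / u‖ / ‖a / u‖, by positivity, ?_⟩
  rw [Complex.real_smul]
  push_cast
  have h2 : (‖b / u‖ : ℂ) / ‖a / u‖ * a / u = b / u := by rw [mul_div_assoc, h1]
  rw [div_left_inj' hu] at h2
  exact h2.symm

/-! ### Contiguity of the extreme points in a translate -/

section

variable {K : Set ℂ}

/-- The position that witnesses that `z` is extreme: the translate contains the quadrant centre
and `z`, and no point of the tile is in its interior. -/
theorem exists_witness (hK : Convex ℝ K) (hKc : IsCompact K) (h0 : K ∈ nhds (0 : ℂ)) {P : Finset ℂ}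
    {T : Set ℂ} {o z : ℂ} (hz : z ∈ extremePoints K P T o) :
    ∃ c, o - c ∈ K ∧ z - c ∈ K ∧ ∀ p ∈ P, p ∈ T → p - c ∉ interior K := by
  classical
  obtain ⟨-, -, c, ⟨h1, h2⟩, h3⟩ := Finset.mem_filter.1 hz
  rw [mem_frontier_reflAt] at h2
  refine ⟨c, mem_reflAt.1 h1, hKc.isClosed.frontier_subset h2, fun p hp hpT hint => ?_⟩
  rw [← gauge_eq_one_iff_mem_frontier hK h0] at h2
  rw [← gauge_lt_one_iff_mem_interior hK h0] at hint
  have := interior_subset h3 p hp hpT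
  unfold convexDist at this
  linarith

/-- If a translate contains `o` and two points of the tile, then it contains all extreme points
between them. -/
theorem mem_copyAt_of_between (hK : Convex ℝ K) (hKc : IsCompact K) (h0 : K ∈ nhds (0 : ℂ))
    {P : Finset ℂ} {T S : Set ℂ} {o : ℂ} (hS : ∀ p ∈ T, p - o ∈ S) (hgood : CrossingFree K S)
    {v₁ v₂ z c : ℂ} (hv₁ : v₁ ∈ P) (hvT₁ : v₁ ∈ T) (hv₂ : v₂ ∈ P) (hvT₂ : v₂ ∈ T)
    (hz : z ∈ extremePoints K P T o) (h₁ : 0 < cross (v₁ - o) (z - o))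
    (h₂ : 0 < cross (z - o) (v₂ - o)) (h₁₂ : 0 < cross (v₁ - o) (v₂ - o)) (ho : o ∈ copyAt K c)
    (hc₁ : v₁ ∈ copyAt K c) (hc₂ : v₂ ∈ copyAt K c) : z ∈ copyAt K c := by
  rw [mem_copyAt] at ho hc₁ hc₂ ⊢
  by_contra hzc
  obtain ⟨c₀, ho₀, hz₀, hint⟩ := exists_witness hK hKc h0 hz
  have hw := eq_div_smul_add h₁₂.ne' (c₀ - c)
  have hβ := eq_div_smul_add h₁₂.ne' (z - o)
  refine no_crossing hK ⟨0, mem_interior_iff_mem_nhds.2 h0⟩ hgood (hS _ hvT₁) (hS _ hvT₂) h₁₂.ne'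
    (x := o - c₀) (p := cross (c₀ - c) (v₂ - o) / cross (v₁ - o) (v₂ - o))
    (q := cross (v₁ - o) (c₀ - c) / cross (v₁ - o) (v₂ - o))
    (lam := cross (z - o) (v₂ - o) / cross (v₁ - o) (v₂ - o))
    (mu := cross (v₁ - o) (z - o) / cross (v₁ - o) (v₂ - o)) ho₀ ?_ ?_ ?_ ?_ ?_ ?_ ?_
    (by positivity) (by positivity) (Or.inl (by positivity)) (Or.inl (by positivity))
  · rw [← hw]; convert ho using 1; ring
  · rw [← hw]; convert hc₁ using 1; ring
  · rw [← hw]; convert hc₂ using 1; ring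
  · convert hint v₁ hv₁ hvT₁ using 2; ring
  · convert hint v₂ hv₂ hvT₂ using 2; ring
  · rw [← hβ]; convert hz₀ using 1; ring
  · rw [← hw, ← hβ]; convert hzc using 2; ring

/-- The borderline case of `mem_copyAt_of_between`, in which the common point `p` of two
translates and the extreme point `z` are seen from `o` in the same direction. If `z` is further
away than `p`, then the segment from `o` to `z` lies on the boundary of the witness of `z`, and
the side of the witness decides which of the translates contains `z`. -/
theorem mem_copyAt_of_collinear (hK : Convex ℝ K) (hKc : IsCompact K) (h0 : K ∈ nhds (0 : ℂ))
    {P : Finset ℂ} {T S : Set ℂ} {o : ℂ} (hS : ∀ p ∈ T, p - o ∈ S) (hgood : CrossingFree K S)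
    {v₁ v₂ z p c₁ c₂ : ℂ} (hv₁ : v₁ ∈ P) (hvT₁ : v₁ ∈ T) (hv₂ : v₂ ∈ P) (hvT₂ : v₂ ∈ T)
    (hp : p ∈ P) (hpT : p ∈ T)
    (hz : z ∈ extremePoints K P T o) {r : ℝ} (hr : 0 < r) (hzp : z - o = r • (p - o))
    (h₁ : 0 < cross (v₁ - o) (p - o)) (h₂ : 0 < cross (p - o) (v₂ - o))
    (ho₁ : o ∈ copyAt K c₁) (ho₂ : o ∈ copyAt K c₂) (hp₁ : p ∈ copyAt K c₁)
    (hp₂ : p ∈ copyAt K c₂) (hc₁ : v₁ ∈ copyAt K c₁) (hc₂ : v₂ ∈ copyAt K c₂) :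
    z ∈ copyAt K c₁ ∨ z ∈ copyAt K c₂ := by
  simp only [mem_copyAt] at *
  by_contra! hcon
  obtain ⟨hz₁, hz₂⟩ := hcon
  obtain ⟨c₀, ho₀, hz₀, hint⟩ := exists_witness hK hKc h0 hz
  have hr1 : 1 < r := by
    by_contra! hle
    refine hz₁ (mem_of_combo hK hp₁ ho₁ hr (b := 1 - r) (by linarith) ?_)
    have : z - c₁ = (z - o) + (o - c₁) := by ring
    rw [this, hzp]; module
  have hK0 : (interior K).Nonempty := ⟨0, mem_interior_iff_mem_nhds.2 h0⟩
  obtain ⟨f, hf0, hf⟩ := exists_support hK hK0 (hint p hp hpT)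
  -- the supporting line at `p` contains `o` and `z`
  have hfp : f (p - o) = 0 := by
    have e1 := hf _ ho₀
    have e2 := hf _ hz₀
    have e3 : z - c₀ = r • (p - o) + (o - c₀) := by rw [← hzp]; ring
    have e4 : p - c₀ = (p - o) + (o - c₀) := by ring
    rw [e3, e4, map_add, map_add, map_smul, smul_eq_mul] at e2
    rw [e4, map_add] at e1
    nlinarith
  have hfo : ∀ v ∈ K, f v ≤ f (o - c₀) := by
    intro v hv
    have e4 : p - c₀ = (p - o) + (o - c₀) := by ring
    have := hf v hv
    rwa [e4, map_add, hfp, zero_add] at this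
  obtain ⟨η, hη⟩ : ∃ η : ℝ, ∀ w, f w = η * cross (p - o) w := by
    refine ⟨f (v₂ - o) / cross (p - o) (v₂ - o), fun w => ?_⟩
    conv_lhs => rw [eq_div_smul_add h₂.ne' w]
    rw [map_add, map_smul, map_smul, hfp]
    simp only [smul_eq_mul]
    ring
  have hη0 : η ≠ 0 := by
    rintro rfl
    apply hf0
    ext w
    simp [hη]
  have hside : ∀ c, o - c ∈ K → η * cross (p - o) (c₀ - c) ≤ 0 := by
    intro c hc
    rw [← hη]
    have e1 := hfo _ hc
    have e2 : o - c = (o - c₀) + (c₀ - c) := by ring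
    rw [e2, map_add] at e1
    linarith
  rcases lt_or_gt_of_ne hη0 with hneg | hpos
  · have hw := eq_div_smul_add h₂.ne' (c₀ - c₂)
    have hq : 0 ≤ cross (p - o) (c₀ - c₂) := by nlinarith [hside c₂ ho₂]
    have hβ : r • (p - o) + (0 : ℝ) • (v₂ - o) = z - o := by rw [hzp]; module
    refine no_crossing hK hK0 hgood (hS _ hpT) (hS _ hvT₂) h₂.ne'
      (x := o - c₀) (p := cross (c₀ - c₂) (v₂ - o) / cross (p - o) (v₂ - o))
      (q := cross (p - o) (c₀ - c₂) / cross (p - o) (v₂ - o))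
      (lam := r) (mu := 0) ho₀ ?_ ?_ ?_ ?_ ?_ ?_ ?_
      hr.le le_rfl (Or.inr (by positivity)) (Or.inl hr)
    · rw [← hw]; convert ho₂ using 1; ring
    · rw [← hw]; convert hp₂ using 1; ring
    · rw [← hw]; convert hc₂ using 1; ring
    · convert hint p hp hpT using 2; ring
    · convert hint v₂ hv₂ hvT₂ using 2; ring
    · rw [hβ]; convert hz₀ using 1; ring
    · rw [← hw, hβ]; convert hz₂ using 2; ring
  · have hw := eq_div_smul_add h₁.ne' (c₀ - c₁)
    have hq : 0 ≤ cross (c₀ - c₁) (p - o) := by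
      rw [cross_swap]
      nlinarith [hside c₁ ho₁]
    have hβ : (0 : ℝ) • (v₁ - o) + r • (p - o) = z - o := by rw [hzp]; module
    refine no_crossing hK hK0 hgood (hS _ hvT₁) (hS _ hpT) h₁.ne'
      (x := o - c₀) (p := cross (c₀ - c₁) (p - o) / cross (v₁ - o) (p - o))
      (q := cross (v₁ - o) (c₀ - c₁) / cross (v₁ - o) (p - o))
      (lam := 0) (mu := r) ho₀ ?_ ?_ ?_ ?_ ?_ ?_ ?_
      le_rfl hr.le (Or.inl hr) (Or.inr (by positivity))
    · rw [← hw]; convert ho₁ using 1; ring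
    · rw [← hw]; convert hc₁ using 1; ring
    · rw [← hw]; convert hp₁ using 1; ring
    · convert hint v₁ hv₁ hvT₁ using 2; ring
    · convert hint p hp hpT using 2; ring
    · rw [hβ]; convert hz₀ using 1; ring
    · rw [← hw, hβ]; convert hz₁ using 2; ring

end

/-! ### The points selected for one translate -/

theorem tile_unique {ℓ : ℝ} (hℓ : 0 < ℓ) {u a z : ℂ} {s s' : ℤ × ℤ} (h : z ∈ tile ℓ u a s)
    (h' : z ∈ tile ℓ u a s') : s = s' := by
  have key : ∀ (m n : ℤ) (x : ℝ), m * ℓ ≤ x → x < (n + 1) * ℓ → m ≤ n := by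
    intro m n x h1 h2
    have h3 : (m : ℝ) < n + 1 := lt_of_mul_lt_mul_right (h1.trans_lt h2) hℓ.le
    have h4 : m < n + 1 := by exact_mod_cast h3
    omega
  obtain ⟨h1, h2, h3, h4⟩ := h
  obtain ⟨h1', h2', h3', h4'⟩ := h'
  exact Prod.ext (le_antisymm (key _ _ _ h1 h2') (key _ _ _ h1' h2))
    (le_antisymm (key _ _ _ h3 h4') (key _ _ _ h3' h4))

namespace Preprocessing

variable {k : ℕ} {R φ : ℝ} {P : Finset ℂ} {u : ℂ} (D : Preprocessing k R φ P u)

/-- The angle under which a point is seen from a quadrant centre, measured from `u`. -/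
noncomputable def angle (s : ℤ × ℤ) (τ : Fin 4) (v : ℂ) : ℝ :=
  Complex.arg ((v - D.quad s τ) / u)

theorem mem_of_mem_extreme {s : ℤ × ℤ} {τ : Fin 4} {v : ℂ} (hv : v ∈ D.extreme s τ) :
    v ∈ P ∧ v ∈ D.tileAt s := by
  classical
  obtain ⟨h1, h2, -⟩ := Finset.mem_filter.1 hv
  exact ⟨h1, h2⟩

theorem exists_mem_tileAt {p : ℂ} (hp : p ∈ P) : ∃ s, p ∈ D.tileAt s := by
  obtain ⟨s, hs⟩ := D.mem_interior p hp
  exact ⟨s, interior_subset hs⟩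

theorem isType_unique {s : ℤ × ℤ} {c : ℂ} {τ τ' : Fin 4} (h : D.IsType s c τ)
    (h' : D.IsType s c τ') : τ = τ' := by
  rcases lt_trichotomy τ τ' with hlt | heq | hlt
  · exact absurd h.1 (h'.2 _ hlt)
  · exact heq
  · exact absurd h'.1 (h.2 _ hlt)

theorem exists_isType (hk : 4 ≤ k) (hR : 0 < R) (hu : GridDirection k R φ u) {s : ℤ × ℤ} {c z : ℂ}
    (hz : z ∈ copyAt (polygon k R φ) c) (hzs : z ∈ D.tileAt s) : ∃ τ, D.IsType s c τ := by
  obtain ⟨q, hq⟩ := exists_quadrantCenter_mem hk hR hu hz hzs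
  have hne : {τ | D.quad s τ ∈ copyAt (polygon k R φ) c}.Nonempty :=
    ⟨D.label.symm q, by simpa [quad] using hq⟩
  obtain ⟨τ, hτ, hmin⟩ := wellFounded_lt.has_min _ hne
  exact ⟨τ, hτ, fun τ' hlt hτ' => hmin τ' hτ' hlt⟩

theorem angle_lt_of_order_lt {s : ℤ × ℤ} {τ : Fin 4} {x y : D.extreme s τ}
    (h : (D.order s τ).symm x < (D.order s τ).symm y) : D.angle s τ x < D.angle s τ y := by
  obtain ⟨i, rfl⟩ := (D.order s τ).surjective x
  obtain ⟨j, rfl⟩ := (D.order s τ).surjective y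
  exact D.order_strictMono s τ (lt_of_eq_of_lt ((D.order s τ).symm_apply_apply i).symm
    (h.trans_eq ((D.order s τ).symm_apply_apply j)))

/-- Between two extreme points of the same colour there is one of larger colour. -/
theorem exists_extreme_between {s : ℤ × ℤ} {τ : Fin 4} {x y : D.extreme s τ}
    (hxy : x ≠ y) (hc : D.rank s τ x = D.rank s τ y) :
    ∃ z : D.extreme s τ, D.rank s τ x < D.rank s τ z ∧
      (D.angle s τ x < D.angle s τ z ∧ D.angle s τ z < D.angle s τ y ∨
        D.angle s τ y < D.angle s τ z ∧ D.angle s τ z < D.angle s τ x) := by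
  rcases lt_or_gt_of_ne (fun h => hxy ((D.order s τ).symm.injective h)) with h | h
  · obtain ⟨z, h1, h2, h3⟩ := exists_between_of_isVertexRanking (D.order s τ).symm
      (D.rank_isVertexRanking s τ) h hc
    exact ⟨z, h3, Or.inl ⟨D.angle_lt_of_order_lt h1, D.angle_lt_of_order_lt h2⟩⟩
  · obtain ⟨z, h1, h2, h3⟩ := exists_between_of_isVertexRanking (D.order s τ).symm
      (D.rank_isVertexRanking s τ) h hc.symm
    exact ⟨z, hc ▸ h3, Or.inr ⟨D.angle_lt_of_order_lt h1, D.angle_lt_of_order_lt h2⟩⟩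

theorem sub_quad_mem_tileBox (hu : u ≠ 0) (s : ℤ × ℤ) (τ : Fin 4) :
    ∀ p ∈ D.tileAt s,
      p - D.quad s τ ∈ tileBox (tileSide k R) (superSide k R) u (D.label τ) :=
  fun _ hp => sub_mem_tileBox hu _ hp

theorem mem_copyAt_of_angle_between (hk : 4 ≤ k) (hR : 0 < R) (hu : GridDirection k R φ u)
    {s : ℤ × ℤ} {τ : Fin 4} {v₁ v₂ z c : ℂ} (hv₁ : v₁ ∈ P) (hvT₁ : v₁ ∈ D.tileAt s)
    (hv₂ : v₂ ∈ P) (hvT₂ : v₂ ∈ D.tileAt s) (hz : z ∈ D.extreme s τ)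
    (h₁ : D.angle s τ v₁ < D.angle s τ z) (h₂ : D.angle s τ z < D.angle s τ v₂)
    (ho : D.quad s τ ∈ copyAt (polygon k R φ) c) (hc₁ : v₁ ∈ copyAt (polygon k R φ) c)
    (hc₂ : v₂ ∈ copyAt (polygon k R φ) c) : z ∈ copyAt (polygon k R φ) c := by
  have hu0 : u ≠ 0 := by rintro rfl; simpa using hu.1
  have hb := D.sub_quad_mem_tileBox hu0 s τ
  have hzT := (D.mem_of_mem_extreme hz).2
  exact mem_copyAt_of_between (convex_polygon k R φ) (isCompact_polygon k R φ)
    (polygon_mem_nhds hk hR hu) hb (crossingFree_polygon hk hR hu _) hv₁ hvT₁ hv₂ hvT₂ hz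
    (cross_pos_of_arg_lt hR hu.1 (hb _ hvT₁) (hb _ hzT) h₁)
    (cross_pos_of_arg_lt hR hu.1 (hb _ hzT) (hb _ hvT₂) h₂)
    (cross_pos_of_arg_lt hR hu.1 (hb _ hvT₁) (hb _ hvT₂) (h₁.trans h₂)) ho hc₁ hc₂

/-- If the extreme point `z` lies between a point of one translate and a point of another one,
and the translates have a common point in the tile, then one of them contains `z`. -/
theorem mem_copyAt_or_mem_copyAt (hk : 4 ≤ k) (hR : 0 < R) (hu : GridDirection k R φ u)
    {s : ℤ × ℤ} {τ : Fin 4} {v₁ v₂ z p c₁ c₂ : ℂ} (hv₁ : v₁ ∈ P) (hvT₁ : v₁ ∈ D.tileAt s)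
    (hv₂ : v₂ ∈ P) (hvT₂ : v₂ ∈ D.tileAt s) (hp : p ∈ P) (hpT : p ∈ D.tileAt s)
    (hz : z ∈ D.extreme s τ)
    (h₁ : D.angle s τ v₁ < D.angle s τ z) (h₂ : D.angle s τ z < D.angle s τ v₂)
    (ho₁ : D.quad s τ ∈ copyAt (polygon k R φ) c₁) (ho₂ : D.quad s τ ∈ copyAt (polygon k R φ) c₂)
    (hp₁ : p ∈ copyAt (polygon k R φ) c₁) (hp₂ : p ∈ copyAt (polygon k R φ) c₂)
    (hc₁ : v₁ ∈ copyAt (polygon k R φ) c₁) (hc₂ : v₂ ∈ copyAt (polygon k R φ) c₂) :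
    z ∈ copyAt (polygon k R φ) c₁ ∨ z ∈ copyAt (polygon k R φ) c₂ := by
  have hu0 : u ≠ 0 := by rintro rfl; simpa using hu.1
  have hb := D.sub_quad_mem_tileBox hu0 s τ
  have hzT := (D.mem_of_mem_extreme hz).2
  rcases lt_trichotomy (D.angle s τ p) (D.angle s τ z) with h | h | h
  · exact Or.inr (D.mem_copyAt_of_angle_between hk hR hu hp hpT hv₂ hvT₂ hz h h₂ ho₂ hp₂ hc₂)
  · have hne : ∀ v ∈ D.tileAt s, v - D.quad s τ ≠ 0 := by
      intro v hv h0
      have := (tileBox_pos hR (hb v hv)).1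
      rw [h0, map_zero] at this
      exact lt_irrefl _ this
    obtain ⟨r, hr, hzr⟩ := exists_smul_of_arg_eq hu0 (hne p hpT) (hne z hzT) h
    exact mem_copyAt_of_collinear (convex_polygon k R φ) (isCompact_polygon k R φ)
      (polygon_mem_nhds hk hR hu) hb (crossingFree_polygon hk hR hu _) hv₁ hvT₁ hv₂ hvT₂ hp hpT hz
      hr hzr (cross_pos_of_arg_lt hR hu.1 (hb _ hvT₁) (hb _ hpT) (h₁.trans_eq h.symm))
      (cross_pos_of_arg_lt hR hu.1 (hb _ hpT) (hb _ hvT₂) (h.trans_lt h₂)) ho₁ ho₂ hp₁ hp₂ hc₁ hc₂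
  · exact Or.inl (D.mem_copyAt_of_angle_between hk hR hu hv₁ hvT₁ hp hpT hz h₁ h ho₁ hc₁ hp₁)

/-- `v` has the largest colour among the extreme points of the tile `s` and type `τ` that the
translate centred at `c` contains. -/
def IsTop (s : ℤ × ℤ) (τ : Fin 4) (c : ℂ) (v : D.extreme s τ) : Prop :=
  (v : ℂ) ∈ copyAt (polygon k R φ) c ∧
    ∀ w : D.extreme s τ, (w : ℂ) ∈ copyAt (polygon k R φ) c → D.rank s τ w ≤ D.rank s τ v

theorem mem_selected {c v : ℂ} : v ∈ D.selected c ↔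
    ∃ (s : ℤ × ℤ) (τ : Fin 4) (hv : v ∈ D.extreme s τ), D.IsType s c τ ∧ D.IsTop s τ c ⟨v, hv⟩ := by
  classical
  constructor
  · intro h
    obtain ⟨-, s, τ, hv, h1, h2, h3⟩ := Finset.mem_filter.1 h
    exact ⟨s, τ, hv, h1, h2, fun w => h3 w w.2⟩
  · rintro ⟨s, τ, hv, h1, h2, h3⟩
    exact Finset.mem_filter.2 ⟨(D.mem_of_mem_extreme hv).1, s, τ, hv, h1, h2,
      fun w hw => h3 ⟨w, hw⟩⟩

/-- The extreme point of largest colour in a translate is unique. -/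
theorem isTop_unique (hk : 4 ≤ k) (hR : 0 < R) (hu : GridDirection k R φ u) {s : ℤ × ℤ}
    {τ : Fin 4} {c : ℂ} (ho : D.quad s τ ∈ copyAt (polygon k R φ) c) {x y : D.extreme s τ}
    (hx : D.IsTop s τ c x) (hy : D.IsTop s τ c y) : x = y := by
  by_contra hne
  obtain ⟨z, hlt, hz⟩ := D.exists_extreme_between hne (le_antisymm (hy.2 _ hx.1) (hx.2 _ hy.1))
  have hxP := D.mem_of_mem_extreme x.2
  have hyP := D.mem_of_mem_extreme y.2
  have hzc : (z : ℂ) ∈ copyAt (polygon k R φ) c := by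
    rcases hz with ⟨h1, h2⟩ | ⟨h1, h2⟩
    · exact D.mem_copyAt_of_angle_between hk hR hu hxP.1 hxP.2 hyP.1 hyP.2 z.2 h1 h2 ho hx.1 hy.1
    · exact D.mem_copyAt_of_angle_between hk hR hu hyP.1 hyP.2 hxP.1 hxP.2 z.2 h1 h2 ho hy.1 hx.1
  exact (hx.2 _ hzc).not_gt hlt

/-- Two translates of the same type with a common point in the tile whose extreme points of
largest colour have the same colour have the same extreme point of largest colour. -/
theorem isTop_eq_isTop (hk : 4 ≤ k) (hR : 0 < R) (hu : GridDirection k R φ u) {s : ℤ × ℤ}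
    {τ : Fin 4} {c₁ c₂ p : ℂ} (hp : p ∈ P) (hpT : p ∈ D.tileAt s)
    (hp₁ : p ∈ copyAt (polygon k R φ) c₁) (hp₂ : p ∈ copyAt (polygon k R φ) c₂)
    (ho₁ : D.quad s τ ∈ copyAt (polygon k R φ) c₁) (ho₂ : D.quad s τ ∈ copyAt (polygon k R φ) c₂)
    {x y : D.extreme s τ} (hx : D.IsTop s τ c₁ x) (hy : D.IsTop s τ c₂ y)
    (hxy : D.rank s τ x = D.rank s τ y) : x = y := by
  by_contra hne
  obtain ⟨z, hlt, hz⟩ := D.exists_extreme_between hne hxy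
  have hxP := D.mem_of_mem_extreme x.2
  have hyP := D.mem_of_mem_extreme y.2
  have hzc : (z : ℂ) ∈ copyAt (polygon k R φ) c₁ ∨ (z : ℂ) ∈ copyAt (polygon k R φ) c₂ := by
    rcases hz with ⟨h1, h2⟩ | ⟨h1, h2⟩
    · exact D.mem_copyAt_or_mem_copyAt hk hR hu hxP.1 hxP.2 hyP.1 hyP.2 hp hpT z.2 h1 h2 ho₁ ho₂
        hp₁ hp₂ hx.1 hy.1
    · exact (D.mem_copyAt_or_mem_copyAt hk hR hu hyP.1 hyP.2 hxP.1 hxP.2 hp hpT z.2 h1 h2 ho₂ ho₁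
        hp₂ hp₁ hy.1 hx.1).symm
  rcases hzc with h | h
  · exact (hx.2 _ h).not_gt hlt
  · exact (hy.2 _ h).not_gt (hxy ▸ hlt)

/-- A translate that contains a point of `P` in the tile `s` has a selected point in `s`. -/
theorem exists_isTop (hk : 4 ≤ k) (hR : 0 < R) (hu : GridDirection k R φ u) {s : ℤ × ℤ} {c p : ℂ}
    (hp : p ∈ P) (hpT : p ∈ D.tileAt s) (hpc : p ∈ copyAt (polygon k R φ) c) :
    ∃ (τ : Fin 4) (v : D.extreme s τ), D.IsType s c τ ∧ D.IsTop s τ c v := by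
  classical
  obtain ⟨τ, hτ⟩ := D.exists_isType hk hR hu hpc hpT
  obtain ⟨v, hv, hvc⟩ := exists_mem_extremePoints_polygon hk hR hu hp hpT hpc hτ.1
  obtain ⟨w, hw, hmax⟩ := (Finset.univ.filter fun w : D.extreme s τ =>
    (w : ℂ) ∈ copyAt (polygon k R φ) c).exists_max_image (D.rank s τ)
      ⟨⟨v, hv⟩, Finset.mem_filter.2 ⟨Finset.mem_univ _, hvc⟩⟩
  exact ⟨τ, w, hτ, (Finset.mem_filter.1 hw).2, fun x hx =>
    hmax x (Finset.mem_filter.2 ⟨Finset.mem_univ _, hx⟩)⟩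

/-- At most one point is selected in each tile. -/
theorem card_selected_le (hk : 4 ≤ k) (hR : 0 < R) (hu : GridDirection k R φ u) (c : ℂ) :
    ((D.selected c).card : ℕ∞) ≤ D.maxTiles := by
  refine le_trans ?_ (le_iSup (fun c : ℂ =>
    {s : ℤ × ℤ | (copyAt (polygon k R φ) c ∩ D.tileAt s).Nonempty}.encard) c)
  rw [← Set.encard_coe_eq_coe_finsetCard]
  have h : ∀ v ∈ D.selected c, ∃ s : ℤ × ℤ, ∃ (τ : Fin 4) (hv : v ∈ D.extreme s τ),
      D.IsType s c τ ∧ D.IsTop s τ c ⟨v, hv⟩ := fun v hv => D.mem_selected.1 hv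
  choose! f hf using h
  refine Set.encard_le_encard_of_injOn (f := f) ?_ ?_
  · intro v hv
    obtain ⟨τ, hvτ, -, htop⟩ := hf v hv
    exact ⟨v, htop.1, (D.mem_of_mem_extreme hvτ).2⟩
  · intro v hv w hw hvw
    obtain ⟨τ, hvτ, htype, htop⟩ := hf v hv
    have hw' := hf w hw
    rw [← hvw] at hw'
    obtain ⟨τ', hwτ, htype', htop'⟩ := hw'
    obtain rfl := D.isType_unique htype htype'
    exact congrArg Subtype.val (D.isTop_unique hk hR hu htype.1 htop htop')

/-! ### The online phase -/

theorem selected_subset (c : ℂ) : D.selected c ⊆ P := by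
  classical
  exact Finset.filter_subset _ _

theorem run_append_singleton (I : List ℂ) (c : ℂ) : D.run (I ++ [c]) = D.step (D.run I) c := by
  simp [run]

theorem subset_step (H : Finset ℂ) (c : ℂ) : H ⊆ D.step H c := by
  classical
  unfold step
  split_ifs
  · exact subset_rfl
  · exact Finset.subset_union_left

theorem run_subset (I : List ℂ) : D.run I ⊆ P := by
  classical
  induction I using List.reverseRecOn with
  | nil => simp [run]
  | append_singleton I c ih =>
    rw [run_append_singleton, step]
    split_ifs
    · exact ih
    · exact Finset.union_subset ih (D.selected_subset c)

theorem isHittingSet_run (hk : 4 ≤ k) (hR : 0 < R) (hu : GridDirection k R φ u) (I : List ℂ) :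
    IsHittingSet (polygon k R φ) P I (D.run I) := by
  classical
  refine ⟨D.run_subset I, ?_⟩
  induction I using List.reverseRecOn with
  | nil => simp
  | append_singleton I c ih =>
    intro c' hc' hex
    rw [run_append_singleton]
    rcases List.mem_append.1 hc' with h | h
    · obtain ⟨p, hp, hpc⟩ := ih c' h hex
      exact ⟨p, D.subset_step _ _ hp, hpc⟩
    · obtain rfl := List.mem_singleton.1 h
      by_cases hit : ∃ p ∈ D.run I, p ∈ copyAt (polygon k R φ) c'
      · obtain ⟨p, hp, hpc⟩ := hit
        exact ⟨p, D.subset_step _ _ hp, hpc⟩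
      · obtain ⟨p, hp, hpc⟩ := hex
        obtain ⟨s, hs⟩ := D.exists_mem_tileAt hp
        obtain ⟨τ, v, htype, htop⟩ := D.exists_isTop hk hR hu hp hs hpc
        refine ⟨v, ?_, htop.1⟩
        rw [step, if_neg hit]
        exact Finset.mem_union_right _ (D.mem_selected.2 ⟨s, τ, v.2, htype, htop⟩)

/-- The translates for which points are added: they contain points of `P`, and each of them
contains no point that was selected for an earlier one. -/
theorem exists_events (I : List ℂ) : ∃ E : List ℂ,
    (∀ c ∈ E, c ∈ I ∧ ∃ p ∈ P, p ∈ copyAt (polygon k R φ) c) ∧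
    E.Pairwise (fun c₁ c₂ => ∀ v ∈ D.selected c₁, v ∉ copyAt (polygon k R φ) c₂) ∧
    (∀ c ∈ E, D.selected c ⊆ D.run I) ∧
    (D.run I).card ≤ (E.map fun c => (D.selected c).card).sum := by
  classical
  induction I using List.reverseRecOn with
  | nil => exact ⟨[], by simp [run]⟩
  | append_singleton I c ih =>
    obtain ⟨E, h1, h2, h3, h4⟩ := ih
    rw [run_append_singleton, step]
    by_cases hit : ∃ p ∈ D.run I, p ∈ copyAt (polygon k R φ) c
    · rw [if_pos hit]
      exact ⟨E, fun c' hc' => ⟨List.mem_append_left _ (h1 c' hc').1, (h1 c' hc').2⟩, h2, h3, h4⟩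
    rw [if_neg hit]
    push Not at hit
    by_cases hex : ∃ p ∈ P, p ∈ copyAt (polygon k R φ) c
    · refine ⟨E ++ [c], ?_, ?_, ?_, ?_⟩
      · intro c' hc'
        rcases List.mem_append.1 hc' with h | h
        · exact ⟨List.mem_append_left _ (h1 c' h).1, (h1 c' h).2⟩
        · obtain rfl := List.mem_singleton.1 h
          exact ⟨by simp, hex⟩
      · refine List.pairwise_append.2 ⟨h2, List.pairwise_singleton _ _, ?_⟩
        intro c₁ hc₁ c₂ hc₂ v hv
        obtain rfl := List.mem_singleton.1 hc₂
        exact hit v (h3 c₁ hc₁ hv)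
      · intro c' hc'
        rcases List.mem_append.1 hc' with h | h
        · exact (h3 c' h).trans Finset.subset_union_left
        · obtain rfl := List.mem_singleton.1 h
          exact Finset.subset_union_right
      · rw [List.map_append, List.sum_append]
        refine (Finset.card_union_le _ _).trans ?_
        simpa using h4
    · have hemp : D.selected c = ∅ := by
        refine Finset.eq_empty_of_forall_notMem fun v hv => hex ⟨v, D.selected_subset c hv, ?_⟩
        obtain ⟨s, τ, hv', -, htop⟩ := D.mem_selected.1 hv
        exact htop.1
      rw [hemp, Finset.union_empty]
      exact ⟨E, fun c' hc' => ⟨List.mem_append_left _ (h1 c' hc').1, (h1 c' hc').2⟩, h2, h3, h4⟩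

/-- At most `4 ⌊log₂ 2n⌋` events can contain the same point of a feasible solution, because they
differ in their types or in their largest colours. -/
theorem length_events_le (hk : 4 ≤ k) (hR : 0 < R) (hu : GridDirection k R φ u) {E : List ℂ}
    {H : Finset ℂ} (hH : H ⊆ P) (hE : ∀ c ∈ E, ∃ p ∈ H, p ∈ copyAt (polygon k R φ) c)
    (hpw : E.Pairwise fun c₁ c₂ => ∀ v ∈ D.selected c₁, v ∉ copyAt (polygon k R φ) c₂) :
    E.length ≤ H.card * (4 * Nat.log 2 (2 * P.card)) := by
  classical
  have hkey : ∀ c ∈ E, ∃ key : ℂ × Fin 4 × ℕ, key.1 ∈ H ∧ key.1 ∈ copyAt (polygon k R φ) c ∧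
      ∃ (s : ℤ × ℤ) (v : D.extreme s key.2.1), key.1 ∈ D.tileAt s ∧ D.IsType s c key.2.1 ∧
        D.IsTop s key.2.1 c v ∧ D.rank s key.2.1 v = key.2.2 := by
    intro c hc
    obtain ⟨p, hp, hpc⟩ := hE c hc
    obtain ⟨s, hs⟩ := D.exists_mem_tileAt (hH hp)
    obtain ⟨τ, v, htype, htop⟩ := D.exists_isTop hk hR hu (hH hp) hs hpc
    exact ⟨(p, τ, D.rank s τ v), hp, hpc, s, v, hs, htype, htop, rfl⟩
  choose! key hkey using hkey
  have hnodup : (E.map key).Nodup := by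
    refine List.pairwise_map.2 (hpw.imp_of_mem ?_)
    intro c₁ c₂ hc₁ hc₂ hsel heq
    obtain ⟨hp₁, hpc₁, s₁, v₁, hs₁, htype₁, htop₁, hrank₁⟩ := hkey c₁ hc₁
    obtain ⟨hp₂, hpc₂, s₂, v₂, hs₂, htype₂, htop₂, hrank₂⟩ := hkey c₂ hc₂
    generalize key c₁ = K₁ at *
    generalize key c₂ = K₂ at *
    subst heq
    obtain rfl := tile_unique (tileSide_pos hR) hs₁ hs₂
    have h12 := D.isTop_eq_isTop hk hR hu (hH hp₁) hs₁ hpc₁ hpc₂ htype₁.1 htype₂.1 htop₁ htop₂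
      (hrank₁.trans hrank₂.symm)
    subst h12
    exact hsel v₁ (D.mem_selected.2 ⟨s₁, _, v₁.2, htype₁, htop₁⟩) htop₂.1
  have hsub : (E.map key).toFinset ⊆
      H ×ˢ (Finset.univ : Finset (Fin 4)) ×ˢ Finset.Icc 1 (Nat.log 2 (2 * P.card)) := by
    intro x hx
    obtain ⟨c, hc, rfl⟩ := List.mem_map.1 (List.mem_toFinset.1 hx)
    obtain ⟨hp, -, s, v, -, -, -, hrank⟩ := hkey c hc
    obtain ⟨h1, h2⟩ := (D.rank_isVertexRanking s (key c).2.1).1 v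
    simp only [Finset.mem_product, Finset.mem_univ, Finset.mem_Icc, true_and]
    refine ⟨hp, hrank ▸ h1, hrank ▸ h2.trans (Nat.log_mono_right ?_)⟩
    exact Nat.mul_le_mul_left 2 (Finset.card_le_card (Finset.filter_subset _ _))
  have hcard := Finset.card_le_card hsub
  rw [List.toFinset_card_of_nodup hnodup, List.length_map, Finset.card_product,
    Finset.card_product, Finset.card_univ, Fintype.card_fin, Nat.card_Icc] at hcard
  simpa using hcard

/-- Every event adds at most `maxTiles` points, one for each tile that the translate meets. -/
theorem card_run_le (hk : 4 ≤ k) (hR : 0 < R) (hu : GridDirection k R φ u) (I : List ℂ)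
    {H : Finset ℂ} (hH : IsHittingSet (polygon k R φ) P I H) :
    ((D.run I).card : ℕ∞) ≤
      4 * D.maxTiles * (Nat.log 2 (2 * P.card) : ℕ∞) * (H.card : ℕ∞) := by
  obtain ⟨E, h1, h2, -, h4⟩ := D.exists_events I
  have hlen := D.length_events_le hk hR hu hH.1 (fun c hc => hH.2 c (h1 c hc).1 (h1 c hc).2) h2
  have hsum : (((E.map fun c => (D.selected c).card).sum : ℕ) : ℕ∞) ≤ E.length * D.maxTiles := by
    clear h1 h2 h4 hlen
    induction E with
    | nil => simp
    | cons c E ih =>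
      simp only [List.map_cons, List.sum_cons, List.length_cons]
      rw [Nat.cast_add, Nat.cast_add, Nat.cast_one, add_mul, one_mul, add_comm]
      exact add_le_add ih (D.card_selected_le hk hR hu c)
  calc ((D.run I).card : ℕ∞) ≤ (((E.map fun c => (D.selected c).card).sum : ℕ) : ℕ∞) := by
        exact_mod_cast h4
    _ ≤ E.length * D.maxTiles := hsum
    _ ≤ ((H.card * (4 * Nat.log 2 (2 * P.card)) : ℕ) : ℕ∞) * D.maxTiles := by
        gcongr
    _ = _ := by push_cast; ring

end Preprocessing

/-! ### The preprocessing can be carried out -/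

/-- Countably many lines do not cover the plane: the parabola `θ ↦ θ + i θ²` meets each of them
in at most two points. -/
theorem exists_forall_notMem_line {L : Set (ℝ × ℝ × ℝ)} (hL : L.Countable)
    (h : ∀ x ∈ L, x.1 ≠ 0 ∨ x.2.1 ≠ 0) : ∃ a : ℂ, ∀ x ∈ L, x.1 * a.re + x.2.1 * a.im ≠ x.2.2 := by
  have hcount : (⋃ x ∈ L, {θ : ℝ | x.1 * θ + x.2.1 * θ ^ 2 = x.2.2}).Countable := by
    refine hL.biUnion fun x hx => Set.Finite.countable ?_
    set p : Polynomial ℝ := Polynomial.C x.1 * Polynomial.X +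
      Polynomial.C x.2.1 * Polynomial.X ^ 2 - Polynomial.C x.2.2 with hp
    have hp0 : p ≠ 0 := by
      intro h0
      have h1 : p.coeff 1 = x.1 := by simp [hp, Polynomial.coeff_C]
      have h2 : p.coeff 2 = x.2.1 := by simp [hp]
      rw [h0, Polynomial.coeff_zero] at h1 h2
      exact (h x hx).elim (fun h => h h1.symm) (fun h => h h2.symm)
    refine (Polynomial.finite_setOfPred_isRoot hp0).subset fun θ hθ => ?_
    simp only [Set.mem_ofPred_eq] at hθ
    simp [Polynomial.IsRoot, hp, hθ]
  have huncount : ¬ (Set.univ : Set ℝ).Countable := Set.not_countable_univ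
  obtain ⟨θ, -, hθ⟩ := Set.not_subset.1 fun hsub => huncount (hcount.mono hsub)
  refine ⟨⟨θ, θ ^ 2⟩, fun x hx heq => hθ ?_⟩
  exact Set.mem_biUnion hx heq

theorem exists_equiv_strictMono {V : Finset ℂ} {f : V → ℝ} (hf : Function.Injective f) :
    ∃ e : Fin V.card ≃ V, StrictMono fun i => f (e i) := by
  let : LinearOrder V := LinearOrder.lift' f hf
  exact ⟨(Fintype.orderIsoFinOfCardEq V (Fintype.card_coe V)).toEquiv,
    fun i j hij => (Fintype.orderIsoFinOfCardEq V (Fintype.card_coe V)).strictMono hij⟩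

/-- A point that is not on a grid line is in the interior of a tile. -/
theorem exists_mem_interior_tile {ℓ : ℝ} (hℓ : 0 < ℓ) {u a p : ℂ}
    (hre : ∀ m : ℤ, ((p - a) / u).re ≠ m * ℓ) (him : ∀ m : ℤ, ((p - a) / u).im ≠ m * ℓ) :
    ∃ s, p ∈ interior (tile ℓ u a s) := by
  have key : ∀ x : ℝ, (∀ m : ℤ, x ≠ m * ℓ) → ∃ m : ℤ, m * ℓ < x ∧ x < (m + 1) * ℓ := by
    intro x hx
    refine ⟨⌊x / ℓ⌋, lt_of_le_of_ne ?_ (hx _).symm, ?_⟩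
    · rw [← le_div_iff₀ hℓ]; exact Int.floor_le _
    · rw [← div_lt_iff₀ hℓ]; exact Int.lt_floor_add_one _
  obtain ⟨m, hm1, hm2⟩ := key _ hre
  obtain ⟨n, hn1, hn2⟩ := key _ him
  refine ⟨(m, n), mem_interior.2 ⟨{z | (m * ℓ < ((z - a) / u).re ∧ ((z - a) / u).re < (m + 1) * ℓ) ∧
    n * ℓ < ((z - a) / u).im ∧ ((z - a) / u).im < (n + 1) * ℓ},
    fun z hz => ⟨hz.1.1.le, hz.1.2, hz.2.1.le, hz.2.2⟩, ?_, ⟨hm1, hm2⟩, hn1, hn2⟩⟩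
  have hc1 : Continuous fun z : ℂ => ((z - a) / u).re := by fun_prop
  have hc2 : Continuous fun z : ℂ => ((z - a) / u).im := by fun_prop
  exact ((isOpen_lt continuous_const hc1).inter (isOpen_lt hc1 continuous_const)).inter
    ((isOpen_lt continuous_const hc2).inter (isOpen_lt hc2 continuous_const))

/-- All positions of the grid outside countably many lines are admissible. -/
theorem nonempty_preprocessing {k : ℕ} {R : ℝ} (hR : 0 < R) (φ : ℝ)
    (P : Finset ℂ) {u : ℂ} (hu : ‖u‖ = 1) : Nonempty (Preprocessing k R φ P u) := by
  classical
  have hu0 : u ≠ 0 := by rintro rfl; simp at hu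
  have hu2 : u.re * u.re + u.im * u.im = 1 := by
    rw [← Complex.normSq_apply, Complex.normSq_eq_norm_sq, hu]; norm_num
  have hns : Complex.normSq u = 1 := by rw [Complex.normSq_apply, hu2]
  have hure : u.re ≠ 0 ∨ u.im ≠ 0 := by
    by_contra! h
    rw [h.1, h.2] at hu2
    norm_num at hu2
  set ℓ := tileSide k R with hℓ
  set t := superSide k R with ht
  -- the positions that put a point of `P` on a grid line or two points on a line through a
  -- quadrant centre
  let L₁ : Set (ℝ × ℝ × ℝ) := ⋃ p ∈ P, Set.range fun m : ℤ => (u.re, u.im, (p / u).re - m * ℓ)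
  let L₂ : Set (ℝ × ℝ × ℝ) := ⋃ p ∈ P, Set.range fun m : ℤ => (-u.im, u.re, (p / u).im - m * ℓ)
  let L₃ : Set (ℝ × ℝ × ℝ) := ⋃ p ∈ P, ⋃ p' ∈ P.filter (· ≠ p),
    Set.range fun x : (ℤ × ℤ) × Fin 4 => ((p' - p).im, -(p' - p).re,
      cross (p - quadrantCenter ℓ t u 0 x.1 x.2) (p' - quadrantCenter ℓ t u 0 x.1 x.2))
  have hcount : (L₁ ∪ (L₂ ∪ L₃)).Countable := by
    refine Set.Countable.union ?_ (Set.Countable.union ?_ ?_)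
    · exact P.countable_toSet.biUnion fun _ _ => Set.countable_range _
    · exact P.countable_toSet.biUnion fun _ _ => Set.countable_range _
    · exact P.countable_toSet.biUnion fun _ _ => (Finset.countable_toSet _).biUnion
        fun _ _ => Set.countable_range _
  obtain ⟨a, ha⟩ := exists_forall_notMem_line hcount (by
    rintro x (hx | hx | hx)
    · obtain ⟨p, -, m, rfl⟩ := Set.mem_iUnion₂.1 hx
      exact hure
    · obtain ⟨p, -, m, rfl⟩ := Set.mem_iUnion₂.1 hx
      exact hure.symm.imp_left neg_ne_zero.2
    · obtain ⟨p, -, hx⟩ := Set.mem_iUnion₂.1 hx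
      obtain ⟨p', hp', m, rfl⟩ := Set.mem_iUnion₂.1 hx
      have hne := (Finset.mem_filter.1 hp').2
      by_contra! h
      exact hne (sub_eq_zero.1 (Complex.ext (neg_eq_zero.1 h.2) h.1)))
  have hre : ∀ p ∈ P, ∀ m : ℤ, ((p - a) / u).re ≠ m * ℓ := by
    intro p hp m h
    refine ha _ (Or.inl (Set.mem_iUnion₂.2 ⟨p, hp, m, rfl⟩)) ?_
    simp only [sub_div, Complex.sub_re] at h
    have : (a / u).re = u.re * a.re + u.im * a.im := by
      simp only [Complex.div_re, hns, div_one]; ring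
    rw [← this]
    linarith
  have him : ∀ p ∈ P, ∀ m : ℤ, ((p - a) / u).im ≠ m * ℓ := by
    intro p hp m h
    refine ha _ (Or.inr (Or.inl (Set.mem_iUnion₂.2 ⟨p, hp, m, rfl⟩))) ?_
    simp only [sub_div, Complex.sub_im] at h
    have : (a / u).im = -u.im * a.re + u.re * a.im := by
      simp only [Complex.div_im, hns, div_one]; ring
    rw [← this]
    linarith
  have hcross : ∀ p ∈ P, ∀ p' ∈ P, p' ≠ p → ∀ s q,
      cross (p - quadrantCenter ℓ t u a s q) (p' - quadrantCenter ℓ t u a s q) ≠ 0 := by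
    intro p hp p' hp' hne s q h
    refine ha _ (Or.inr (Or.inr (Set.mem_iUnion₂.2 ⟨p, hp, Set.mem_iUnion₂.2
      ⟨p', Finset.mem_filter.2 ⟨hp', hne⟩, (s, q), rfl⟩⟩))) ?_
    have hq : quadrantCenter ℓ t u a s q = a + quadrantCenter ℓ t u 0 s q := by
      unfold quadrantCenter tileCenter; ring
    rw [hq] at h
    simp only [cross, Complex.sub_re, Complex.sub_im, Complex.add_re, Complex.add_im] at h ⊢
    linear_combination (-1 : ℝ) * h
  have hinj : ∀ (s : ℤ × ℤ) (τ : Fin 4), Function.Injective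
      fun v : extremePoints (polygon k R φ) P (tile ℓ u a s) (quadrantCenter ℓ t u a s τ) =>
        Complex.arg (((v : ℂ) - quadrantCenter ℓ t u a s τ) / u) := by
    intro s τ v w hvw
    obtain ⟨hv, hvT, -⟩ := Finset.mem_filter.1 v.2
    obtain ⟨hw, hwT, -⟩ := Finset.mem_filter.1 w.2
    by_contra hne
    have hne' : (w : ℂ) ≠ v := fun h => hne (Subtype.ext h.symm)
    have h0 : ∀ x ∈ tile ℓ u a s, x - quadrantCenter ℓ t u a s τ ≠ 0 := by
      intro x hx h0
      have := (tileBox_pos hR (sub_mem_tileBox hu0 τ hx (t := superSide k R))).1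
      rw [h0, map_zero] at this
      exact lt_irrefl _ this
    obtain ⟨r, -, hr⟩ := exists_smul_of_arg_eq hu0 (h0 v hvT) (h0 w hwT) hvw
    refine hcross v hv w hw hne' s τ ?_
    rw [hr, cross_smul, cross_self, mul_zero]
  choose order horder using fun s τ => exists_equiv_strictMono (hinj s τ)
  choose rank hrank using fun s τ => exists_isVertexRanking (order s τ).symm
  exact ⟨{
    a := a
    mem_interior := fun p hp => exists_mem_interior_tile (tileSide_pos hR) (hre p hp) (him p hp)
    label := Equiv.refl _
    order := order
    order_strictMono := horder
    rank := rank
    rank_isVertexRanking := hrank }⟩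

/-! ### Symmetries of the regular polygons -/

theorem map_mem_polygon {k : ℕ} {R R' φ φ' : ℝ} (f : ℂ →ₗ[ℝ] ℂ)
    (hf : ∀ j < k, f (vertex k R φ j) ∈ polygon k R' φ') {z : ℂ} (hz : z ∈ polygon k R φ) :
    f z ∈ polygon k R' φ' := by
  refine convexHull_min ?_ ((convex_polygon k R' φ').linear_preimage f) hz
  rintro _ ⟨j, rfl⟩
  exact hf j j.2

/-- The points at the angles `φ + 2 π m / k` are vertices also if `m` is an integer that is not
between `0` and `k`. -/
theorem vertex_int_mem {k : ℕ} (hk : 0 < k) (R φ : ℝ) (m : ℤ) :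
    (R : ℂ) * Complex.exp ((φ + 2 * Real.pi * m / k : ℝ) * Complex.I) ∈ polygon k R φ := by
  have hkz : (k : ℤ) ≠ 0 := by exact_mod_cast hk.ne'
  have hk0 : (k : ℂ) ≠ 0 := by exact_mod_cast hk.ne'
  obtain ⟨j, hj⟩ : ∃ j : ℕ, (j : ℤ) = m % k := ⟨(m % k).toNat, Int.toNat_of_nonneg
    (Int.emod_nonneg _ hkz)⟩
  have hjk : j < k := by
    have := Int.emod_lt_of_pos m (by exact_mod_cast hk : (0 : ℤ) < k)
    omega
  have hmj : (m : ℂ) = j + k * (m / k : ℤ) := by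
    have := Int.emod_add_mul_ediv m k
    rw [← hj] at this
    exact_mod_cast this.symm
  refine subset_convexHull ℝ _ ⟨⟨j, hjk⟩, ?_⟩
  have : ((φ + 2 * Real.pi * m / k : ℝ) * Complex.I : ℂ) =
      (φ + 2 * Real.pi * j / k) * Complex.I + (m / k : ℤ) * (2 * Real.pi * Complex.I) := by
    push_cast
    rw [hmj]
    field_simp
    ring
  rw [this, Complex.exp_periodic.int_mul]
  rfl

theorem polygon_add {k : ℕ} (hk : 0 < k) {R φ : ℝ} (m : ℤ) {z : ℂ} (hz : z ∈ polygon k R φ) :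
    z ∈ polygon k R (φ + 2 * Real.pi * m / k) := by
  refine map_mem_polygon LinearMap.id (fun j _ => ?_) hz
  have := vertex_int_mem hk R (φ + 2 * Real.pi * m / k) (j - m)
  convert this using 1
  simp only [LinearMap.id_apply, vertex]
  congr 2
  push_cast
  ring

/-- Rotation and scaling. -/
theorem mul_mem_polygon {k : ℕ} {R φ : ℝ} (r θ : ℝ) {z : ℂ} (hz : z ∈ polygon k R φ) :
    (r : ℂ) * Complex.exp (θ * Complex.I) * z ∈ polygon k (r * R) (φ + θ) := by
  refine map_mem_polygon (LinearMap.mulLeft ℝ ((r : ℂ) * Complex.exp (θ * Complex.I)))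
    (fun j hj => ?_) hz
  refine subset_convexHull ℝ _ ⟨⟨j, hj⟩, ?_⟩
  simp only [vertex, LinearMap.mulLeft_apply]
  have : ((φ + θ : ℝ) + 2 * Real.pi * j / k) * Complex.I =
      (θ * Complex.I : ℂ) + (φ + 2 * Real.pi * j / k) * Complex.I := by push_cast; ring
  rw [this, Complex.exp_add]
  push_cast
  ring

theorem I_mul_mem_polygon {k : ℕ} {R φ : ℝ} {z : ℂ} (hz : z ∈ polygon k R φ) :
    Complex.I * z ∈ polygon k R (φ + Real.pi / 2) := by
  have := mul_mem_polygon 1 (Real.pi / 2) hz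
  push_cast at this
  rwa [one_mul, one_mul, Complex.exp_pi_div_two_mul_I] at this

theorem conj_mem_polygon {k : ℕ} (hk : 0 < k) {R φ : ℝ} {z : ℂ} (hz : z ∈ polygon k R φ) :
    (starRingEnd ℂ) z ∈ polygon k R (-φ) := by
  refine map_mem_polygon Complex.conjAe.toLinearMap (fun j _ => ?_) hz
  have := vertex_int_mem hk R (-φ) (-j)
  convert this using 1
  simp only [AlgEquiv.toLinearMap_apply, Complex.conjAe_coe, vertex, map_mul, Complex.conj_ofReal,
    ← Complex.exp_conj]
  congr 2
  simp only [map_mul, map_add, map_div₀, Complex.conj_ofReal, Complex.conj_I, map_natCast]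
  push_cast
  rw [Complex.conj_ofNat]
  ring

/-- The largest cosine of an odd multiple of `π / k`. -/
theorem cos_odd_mul_le {k : ℕ} (hk : 0 < k) (m : ℤ) :
    Real.cos ((2 * m + 1) * (Real.pi / k)) ≤ Real.cos (Real.pi / k) := by
  have hkR : (0 : ℝ) < k := by exact_mod_cast hk
  have hkz : (0 : ℤ) < k := by exact_mod_cast hk
  have hpi := Real.pi_pos
  set d := Real.pi / k with hd
  have hkd : k * d = Real.pi := by rw [hd]; field_simp
  have hdpos : 0 < d := by positivity
  obtain ⟨j, hj0, hjk, hm⟩ : ∃ j : ℤ, 0 ≤ j ∧ j + 1 ≤ k ∧ m = j + k * (m / k) :=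
    ⟨m % k, Int.emod_nonneg _ hkz.ne', Int.emod_lt_of_pos _ hkz, (Int.emod_add_mul_ediv m k).symm⟩
  have hmR : (m : ℝ) = j + k * (m / k : ℤ) := by exact_mod_cast hm
  have h1 : (2 * m + 1) * d = (2 * j + 1) * d + (m / k : ℤ) * (2 * Real.pi) := by
    rw [hmR, ← hkd]; ring
  rw [h1, Real.cos_add_int_mul_two_pi]
  have hj0' : (0 : ℝ) ≤ j := by exact_mod_cast hj0
  have hjk' : (j : ℝ) + 1 ≤ k := by exact_mod_cast hjk
  rcases le_total ((2 * j + 1) * d) Real.pi with h | h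
  · exact Real.cos_le_cos_of_nonneg_of_le_pi hdpos.le h (by nlinarith)
  · rw [← Real.cos_two_pi_sub ((2 * j + 1) * d)]
    exact Real.cos_le_cos_of_nonneg_of_le_pi hdpos.le (by linarith) (by nlinarith)

/-- The inequalities for the edges of a regular polygon. -/
theorem edge_le {k : ℕ} (hk : 0 < k) {R φ : ℝ} (hR : 0 ≤ R) {z : ℂ} (hz : z ∈ polygon k R φ)
    (m : ℤ) : Real.cos (φ + (2 * m + 1) * (Real.pi / k)) * z.re +
      Real.sin (φ + (2 * m + 1) * (Real.pi / k)) * z.im ≤ R * Real.cos (Real.pi / k) := by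
  refine polygon_le (fun j _ => ?_) hz
  set ν := φ + (2 * m + 1) * (Real.pi / k) with hν
  calc Real.cos ν * (R * Real.cos (φ + 2 * Real.pi * j / k)) +
        Real.sin ν * (R * Real.sin (φ + 2 * Real.pi * j / k))
      = R * Real.cos (ν - (φ + 2 * Real.pi * j / k)) := by rw [Real.cos_sub]; ring
    _ = R * Real.cos ((2 * (m - j : ℤ) + 1) * (Real.pi / k)) := by
        congr 2; rw [hν]; push_cast; ring
    _ ≤ R * Real.cos (Real.pi / k) := mul_le_mul_of_nonneg_left (cos_odd_mul_le hk _) hR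

/-! ### Counting tiles -/

/-- The regular `k`-gons with circumradius `4` and rotation angle `φ` meet at most `63` open unit
tiles. A finite set `S` of tiles is met by the polygon with centre `c` if it has a choice `w` of
points of the polygon in its tiles. -/
def TileBound (k : ℕ) (φ : ℝ) : Prop :=
  ∀ (c : ℂ) (S : Finset (ℤ × ℤ)) (w : ℤ × ℤ → ℂ),
    (∀ s ∈ S, (s.1 < (w s).re ∧ (w s).re < s.1 + 1) ∧ (s.2 < (w s).im ∧ (w s).im < s.2 + 1) ∧
      w s - c ∈ polygon k 4 φ) → S.card ≤ 63

theorem tileBound_of_rotate {k : ℕ} {φ : ℝ} (h : TileBound k (φ + Real.pi / 2)) :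
    TileBound k φ := by
  classical
  intro c S w hw
  let g : ℤ × ℤ → ℤ × ℤ := fun s => (-s.2 - 1, s.1)
  have hg : Function.Injective g := fun s s' hss => by
    simp only [g, Prod.mk.injEq] at hss
    ext <;> omega
  have := h (Complex.I * c) (S.image g) (fun s => Complex.I * w (s.2, -s.1 - 1)) (by
    intro s' hs'
    obtain ⟨s, hs, rfl⟩ := Finset.mem_image.1 hs'
    obtain ⟨⟨h1, h2⟩, ⟨h3, h4⟩, h5⟩ := hw s hs
    have he : ((g s).2, -(g s).1 - 1) = s := by ext <;> simp [g]
    rw [he, ← mul_sub]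
    refine ⟨?_, ?_, I_mul_mem_polygon h5⟩
    · simp only [Complex.mul_re, Complex.I_re, Complex.I_im, zero_mul, one_mul, zero_sub]
      simp only [g]
      push_cast
      constructor <;> linarith
    · simp only [Complex.mul_im, Complex.I_re, Complex.I_im, zero_mul, one_mul, zero_add]
      exact ⟨h1, h2⟩)
  rwa [Finset.card_image_of_injective _ hg] at this

theorem tileBound_of_conj {k : ℕ} (hk : 0 < k) {φ : ℝ} (h : TileBound k (-φ)) :
    TileBound k φ := by
  classical
  intro c S w hw
  let g : ℤ × ℤ → ℤ × ℤ := fun s => (s.1, -s.2 - 1)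
  have hg : Function.Injective g := fun s s' hss => by
    simp only [g, Prod.mk.injEq] at hss
    ext <;> omega
  have := h ((starRingEnd ℂ) c) (S.image g) (fun s => (starRingEnd ℂ) (w (s.1, -s.2 - 1))) (by
    intro s' hs'
    obtain ⟨s, hs, rfl⟩ := Finset.mem_image.1 hs'
    obtain ⟨⟨h1, h2⟩, ⟨h3, h4⟩, h5⟩ := hw s hs
    have he : ((g s).1, -(g s).2 - 1) = s := by ext <;> simp [g]
    rw [he, ← map_sub]
    refine ⟨?_, ?_, conj_mem_polygon hk h5⟩
    · simp only [Complex.conj_re]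
      exact ⟨h1, h2⟩
    · simp only [Complex.conj_im, g]
      push_cast
      constructor <;> linarith)
  rwa [Finset.card_image_of_injective _ hg] at this

theorem tileBound_of_add {k : ℕ} (hk : 0 < k) {φ : ℝ} (m : ℤ)
    (h : TileBound k (φ + 2 * Real.pi * m / k)) : TileBound k φ := fun c S w hw =>
  h c S w fun s hs => ⟨(hw s hs).1, (hw s hs).2.1, polygon_add hk m (hw s hs).2.2⟩

/-- A property of angles that is invariant under a rotation by `δ` and under reflection holds for
all angles if it holds between `0` and `δ / 2`. -/
theorem forall_of_symmetries {p : ℝ → Prop} {δ : ℝ} (hδ : 0 < δ) (h₁ : ∀ x, p (x + δ) → p x)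
    (h₂ : ∀ x, p (x - δ) → p x) (h₃ : ∀ x, p (-x) → p x)
    (h : ∀ x, 0 ≤ x → x ≤ δ / 2 → p x) (x : ℝ) : p x := by
  have hn : ∀ (n : ℕ) (x : ℝ), (p (x + n * δ) → p x) ∧ (p (x - n * δ) → p x) := by
    intro n
    induction n with
    | zero => intro x; simp
    | succ n ih =>
      intro x
      constructor
      · intro hp
        refine (ih x).1 (h₁ _ ?_)
        convert hp using 1; push_cast; ring
      · intro hp
        refine (ih x).2 (h₂ _ ?_)
        convert hp using 1; push_cast; ring
  have hz : ∀ (n : ℤ) (x : ℝ), p (x - n * δ) → p x := by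
    intro n x hp
    obtain ⟨m, rfl | rfl⟩ := n.eq_nat_or_neg
    · exact (hn m x).2 (by simpa using hp)
    · exact (hn m x).1 (by simpa using hp)
  refine hz (round (x / δ)) x ?_
  have hr := abs_sub_round (x / δ)
  have habs : |x - round (x / δ) * δ| ≤ δ / 2 := by
    have : x - round (x / δ) * δ = (x / δ - round (x / δ)) * δ := by field_simp
    rw [this, abs_mul, abs_of_pos hδ]
    nlinarith
  rw [abs_le] at habs
  rcases le_total 0 (x - round (x / δ) * δ) with h0 | h0
  · exact h _ h0 habs.2
  · exact h₃ _ (h _ (by linarith) (by linarith))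

/-- If a set of tiles in a window contains at most one tile of each of `N` disjoint pairs, then it
misses at least `N` tiles. A pair may consist of two equal tiles. -/
theorem card_add_le_of_pairs {S : Finset (ℤ × ℤ)} {x₀ y₀ : ℤ} {m n : ℕ}
    (hS : ∀ s ∈ S, (x₀ ≤ s.1 ∧ s.1 < x₀ + m) ∧ y₀ ≤ s.2 ∧ s.2 < y₀ + n) {N : ℕ}
    (p q : Fin N → ℕ × ℕ)
    (hp : ∀ i, (p i).1 < m ∧ (p i).2 < n ∧ (q i).1 < m ∧ (q i).2 < n)
    (hdisj : ∀ i j, i ≠ j → p i ≠ p j ∧ p i ≠ q j ∧ q i ≠ q j)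
    (hpq : ∀ i, (x₀ + (p i).1, y₀ + (p i).2) ∈ S → (x₀ + (q i).1, y₀ + (q i).2) ∉ S) :
    S.card + N ≤ m * n := by
  classical
  let f : ℕ × ℕ → ℤ × ℤ := fun v => (x₀ + v.1, y₀ + v.2)
  have hf : Function.Injective f := fun v v' h => by
    simp only [f, Prod.mk.injEq] at h
    ext <;> omega
  let g : Fin N → ℕ × ℕ := fun i => if f (p i) ∈ S then q i else p i
  have hg : Function.Injective g := by
    intro i j hij
    by_contra hne
    have h1 := hdisj i j hne
    have h2 := hdisj j i (Ne.symm hne)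
    simp only [g] at hij
    split_ifs at hij
    · exact h1.2.2 hij
    · exact h2.2.1 hij.symm
    · exact h1.2.1 hij
    · exact h1.1 hij
  have hgS : ∀ i, f (g i) ∉ S := by
    intro i
    simp only [g]
    split_ifs with h
    · exact hpq i h
    · exact h
  have hsub : S ∪ (Finset.univ.image fun i => f (g i)) ⊆
      (Finset.range m ×ˢ Finset.range n).image f := by
    intro s hs
    rcases Finset.mem_union.1 hs with h | h
    · obtain ⟨⟨h1, h2⟩, h3, h4⟩ := hS s h
      refine Finset.mem_image.2 ⟨((s.1 - x₀).toNat, (s.2 - y₀).toNat), ?_, ?_⟩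
      · simp only [Finset.mem_product, Finset.mem_range]; omega
      · ext <;> simp only [f] <;> omega
    · obtain ⟨i, -, rfl⟩ := Finset.mem_image.1 h
      refine Finset.mem_image_of_mem _ ?_
      have := hp i
      simp only [g, Finset.mem_product, Finset.mem_range]
      split_ifs <;> tauto
  have hdis : Disjoint S (Finset.univ.image fun i => f (g i)) := by
    rw [Finset.disjoint_right]
    intro s hs
    obtain ⟨i, -, rfl⟩ := Finset.mem_image.1 hs
    exact hgS i
  have hfg : Function.Injective fun i => f (g i) := fun i j h => hg (hf h)
  have hcard := Finset.card_le_card hsub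
  rw [Finset.card_union_of_disjoint hdis, Finset.card_image_of_injective _ hfg,
    Finset.card_image_of_injective _ hf, Finset.card_product, Finset.card_range, Finset.card_range,
    Finset.card_univ, Fintype.card_fin] at hcard
  exact hcard

/-! ### Tiles met by a regular hexagon -/

/-- A set of tiles met by a polygon of circumradius `4` lies in a window of `9` rows and
columns. -/
theorem exists_window {k : ℕ} {φ : ℝ} {c : ℂ} {S : Finset (ℤ × ℤ)} {w : ℤ × ℤ → ℂ}
    (hw : ∀ s ∈ S, (s.1 < (w s).re ∧ (w s).re < s.1 + 1) ∧
      (s.2 < (w s).im ∧ (w s).im < s.2 + 1) ∧ w s - c ∈ polygon k 4 φ) (hS : S.Nonempty) :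
    ∃ x₀ y₀ : ℤ, (∀ s ∈ S, (x₀ ≤ s.1 ∧ s.1 < x₀ + 9) ∧ y₀ ≤ s.2 ∧ s.2 < y₀ + 9) ∧
      (∃ s ∈ S, s.1 = x₀) ∧ ∃ s ∈ S, s.2 = y₀ := by
  obtain ⟨a, ha, hamin⟩ := S.exists_min_image Prod.fst hS
  obtain ⟨b, hb, hbmin⟩ := S.exists_min_image Prod.snd hS
  have hdist : ∀ s ∈ S, ∀ s' ∈ S, ‖w s' - w s‖ ≤ 8 := by
    intro s hs s' hs'
    have h1 := norm_le_of_mem_polygon (by norm_num) (hw s hs).2.2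
    have h2 := norm_le_of_mem_polygon (by norm_num) (hw s' hs').2.2
    have : w s' - w s = (w s' - c) - (w s - c) := by ring
    rw [this]
    exact (norm_sub_le _ _).trans (by linarith)
  refine ⟨a.1, b.2, fun s hs => ⟨⟨hamin s hs, ?_⟩, hbmin s hs, ?_⟩, ⟨a, ha, rfl⟩, b, hb, rfl⟩
  · have h1 := (Complex.re_le_norm _).trans (hdist a ha s hs)
    rw [Complex.sub_re] at h1
    have h2 := (hw s hs).1.1
    have h3 := (hw a ha).1.2
    have : (s.1 : ℝ) < a.1 + 9 := by linarith
    exact_mod_cast this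
  · have h1 := (Complex.im_le_norm _).trans (hdist b hb s hs)
    rw [Complex.sub_im] at h1
    have h2 := (hw s hs).2.1.1
    have h3 := (hw b hb).2.1.2
    have : (s.2 : ℝ) < b.2 + 9 := by linarith
    exact_mod_cast this

/-- An initial arc of the unit circle lies above its chord. -/
theorem cos_ge_of_sin_le {τ b : ℝ} (hc : 0 ≤ Real.cos τ) (hs : 0 ≤ Real.sin τ) {m : ℝ}
    (hb : Real.sin τ ≤ b) (hmb : (1 + m ^ 2) * b ≤ 2 * m) :
    1 - m * Real.sin τ ≤ Real.cos τ := by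
  have h := Real.sin_sq_add_cos_sq τ
  by_contra! hlt
  have h1 : Real.cos τ ^ 2 < (1 - m * Real.sin τ) ^ 2 := pow_lt_pow_left₀ hlt hc two_ne_zero
  have h2 : (1 + m ^ 2) * Real.sin τ ≤ 2 * m :=
    (mul_le_mul_of_nonneg_left hb (by positivity)).trans hmb
  nlinarith [mul_nonneg hs (sub_nonneg.2 h2)]

/-- The distance of two points of a hexagon in the direction of an edge normal is at most the
width of the hexagon. -/
theorem hexagon_width {φ : ℝ} {z z' : ℂ} (hz : z ∈ polygon 6 4 φ) (hz' : z' ∈ polygon 6 4 φ)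
    {ν : ℝ} (m : ℤ) (hν : ν = φ + (2 * m + 1) * (Real.pi / 6)) :
    Real.cos ν * (z' - z).re + Real.sin ν * (z' - z).im ≤ 4 * √3 := by
  have h1 := edge_le (by norm_num) (by norm_num) hz' m
  have h2 := edge_le (by norm_num) (by norm_num) hz (m + 3)
  have e : φ + (2 * ((m + 3 : ℤ) : ℝ) + 1) * (Real.pi / (6 : ℕ)) = ν + Real.pi := by
    rw [hν]; push_cast; ring
  have e' : φ + (2 * (m : ℝ) + 1) * (Real.pi / (6 : ℕ)) = ν := by rw [hν]; push_cast; ring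
  rw [e, Real.cos_add_pi, Real.sin_add_pi] at h2
  rw [e'] at h1
  have h3 : Real.cos (Real.pi / (6 : ℕ)) = √3 / 2 := by
    push_cast; exact Real.cos_pi_div_six
  rw [h3] at h1 h2
  rw [Complex.sub_re, Complex.sub_im]
  linarith

/-- Among the `81` tiles of a window there are `19` disjoint pairs of tiles that are further apart
in the direction of an edge normal than the width `4 √3` of the hexagon. At least one tile of each
pair is missed. -/
theorem tileBound_six_aux {τ : ℝ} (hτ0 : 0 ≤ τ) (hτ : τ ≤ Real.pi / 6 / 2) :
    TileBound 6 (τ + Real.pi / 6) := by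
  intro c S w hw
  rcases S.eq_empty_or_nonempty with rfl | hne
  · simp
  obtain ⟨x₀, y₀, hwin, -, -⟩ := exists_window hw hne
  have hpi := Real.pi_lt_d4
  have hs0 : 0 ≤ Real.sin τ := Real.sin_nonneg_of_nonneg_of_le_pi hτ0 (by linarith [Real.pi_pos])
  have hs1 : Real.sin τ ≤ 0.2619 := (Real.sin_le hτ0).trans (by linarith)
  have hc0 : 0 ≤ Real.cos τ := Real.cos_nonneg_of_mem_Icc ⟨by linarith [Real.pi_pos], by linarith⟩
  have hc := cos_ge_of_sin_le (m := 0.14) hc0 hs0 hs1 (by norm_num)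
  set C := Real.cos τ with hC
  set s := Real.sin τ with hs
  have hr2 : √3 * √3 = 3 := Real.mul_self_sqrt (by norm_num)
  have hr0 : 1.732 < √3 := Real.lt_sqrt_of_sq_lt (by norm_num)
  have hr1 : √3 < 1.7321 := by rw [Real.sqrt_lt' (by norm_num)]; norm_num
  -- the directions of the three edge normals
  have key : ∀ i ∈ S, ∀ j ∈ S,
      C * ((w j).re - (w i).re) + s * ((w j).im - (w i).im) ≤ 4 * √3 ∧
      (C / 2 - √3 / 2 * s) * ((w j).re - (w i).re) + (√3 / 2 * C + s / 2) * ((w j).im - (w i).im)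
        ≤ 4 * √3 ∧
      -(C / 2 + √3 / 2 * s) * ((w j).re - (w i).re) + (√3 / 2 * C - s / 2) * ((w j).im - (w i).im)
        ≤ 4 * √3 := by
    intro i hi j hj
    have e : (w j - c) - (w i - c) = w j - w i := by ring
    have h1 := hexagon_width (hw i hi).2.2 (hw j hj).2.2 (ν := τ) (-1) (by push_cast; ring)
    have h2 := hexagon_width (hw i hi).2.2 (hw j hj).2.2 (ν := τ + Real.pi / 3) 0
      (by push_cast; ring)
    have h3 := hexagon_width (hw i hi).2.2 (hw j hj).2.2 (ν := τ + Real.pi / 3 + Real.pi / 3) 1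
      (by push_cast; ring)
    rw [e, Complex.sub_re, Complex.sub_im] at h1 h2 h3
    rw [Real.cos_add, Real.sin_add, Real.cos_pi_div_three, Real.sin_pi_div_three] at h2
    simp only [Real.cos_add, Real.sin_add, Real.cos_pi_div_three, Real.sin_pi_div_three] at h3
    refine ⟨h1, by linarith, ?_⟩
    have e1 : -(C / 2 + √3 / 2 * s) = (C * (1 / 2) - s * (√3 / 2)) * (1 / 2) -
        (s * (1 / 2) + C * (√3 / 2)) * (√3 / 2) := by linear_combination (C / 4) * hr2
    have e2 : √3 / 2 * C - s / 2 = (s * (1 / 2) + C * (√3 / 2)) * (1 / 2) +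
        (C * (1 / 2) - s * (√3 / 2)) * (√3 / 2) := by linear_combination (s / 4) * hr2
    rw [e1, e2]
    exact h3
  have hpairA : ∀ r : ℕ, (x₀ + (0 : ℕ), y₀ + (r : ℕ)) ∈ S →
      (x₀ + (8 : ℕ), y₀ + (r + 2 : ℕ)) ∉ S := by
    intro r h h'
    obtain ⟨h1, -, -⟩ := key _ h _ h'
    obtain ⟨⟨a1, a2⟩, ⟨a3, a4⟩, -⟩ := hw _ h
    obtain ⟨⟨b1, b2⟩, ⟨b3, b4⟩, -⟩ := hw _ h'
    push_cast at a1 a2 a3 a4 b1 b2 b3 b4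
    have h2 := mul_le_mul_of_nonneg_left (show (7 : ℝ) ≤ (w (x₀ + (8 : ℕ), y₀ + (r + 2 : ℕ))).re -
      (w (x₀ + (0 : ℕ), y₀ + (r : ℕ))).re by push_cast; linarith) hc0
    have h3 := mul_le_mul_of_nonneg_left (show (1 : ℝ) ≤ (w (x₀ + (8 : ℕ), y₀ + (r + 2 : ℕ))).im -
      (w (x₀ + (0 : ℕ), y₀ + (r : ℕ))).im by push_cast; linarith) hs0
    linarith
  have hpairB : ∀ r : ℕ, (x₀ + (r : ℕ), y₀ + (0 : ℕ)) ∈ S →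
      (x₀ + (r + 3 : ℕ), y₀ + (8 : ℕ)) ∉ S := by
    intro r h h'
    obtain ⟨-, h1, -⟩ := key _ h _ h'
    obtain ⟨⟨a1, a2⟩, ⟨a3, a4⟩, -⟩ := hw _ h
    obtain ⟨⟨b1, b2⟩, ⟨b3, b4⟩, -⟩ := hw _ h'
    push_cast at a1 a2 a3 a4 b1 b2 b3 b4
    have h2 := mul_le_mul_of_nonneg_left (show (2 : ℝ) ≤ (w (x₀ + (r + 3 : ℕ), y₀ + (8 : ℕ))).re -
      (w (x₀ + (r : ℕ), y₀ + (0 : ℕ))).re by push_cast; linarith)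
      (show 0 ≤ C / 2 - √3 / 2 * s by nlinarith)
    have h3 := mul_le_mul_of_nonneg_left (show (7 : ℝ) ≤ (w (x₀ + (r + 3 : ℕ), y₀ + (8 : ℕ))).im -
      (w (x₀ + (r : ℕ), y₀ + (0 : ℕ))).im by push_cast; linarith)
      (show 0 ≤ √3 / 2 * C + s / 2 by positivity)
    nlinarith [mul_nonneg (sub_nonneg.2 hr0.le) hc0, mul_nonneg (sub_nonneg.2 hr1.le) hs0]
  have hpairC : ∀ r t : ℕ, (x₀ + (r + 5 : ℕ), y₀ + (t : ℕ)) ∈ S →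
      (x₀ + (r : ℕ), y₀ + (t + 7 : ℕ)) ∉ S := by
    intro r t h h'
    obtain ⟨-, -, h1⟩ := key _ h _ h'
    obtain ⟨⟨a1, a2⟩, ⟨a3, a4⟩, -⟩ := hw _ h
    obtain ⟨⟨b1, b2⟩, ⟨b3, b4⟩, -⟩ := hw _ h'
    push_cast at a1 a2 a3 a4 b1 b2 b3 b4
    have h2 := mul_le_mul_of_nonneg_left (show (4 : ℝ) ≤ -((w (x₀ + (r : ℕ), y₀ + (t + 7 : ℕ))).re -
      (w (x₀ + (r + 5 : ℕ), y₀ + (t : ℕ))).re) by push_cast; linarith)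
      (show 0 ≤ C / 2 + √3 / 2 * s by positivity)
    have h3 := mul_le_mul_of_nonneg_left (show (6 : ℝ) ≤ (w (x₀ + (r : ℕ), y₀ + (t + 7 : ℕ))).im -
      (w (x₀ + (r + 5 : ℕ), y₀ + (t : ℕ))).im by push_cast; linarith)
      (show 0 ≤ √3 / 2 * C - s / 2 by nlinarith)
    nlinarith [mul_nonneg (sub_nonneg.2 hr0.le) hc0, mul_nonneg (sub_nonneg.2 hr0.le) hs0]
  have := card_add_le_of_pairs (m := 9) (n := 9) hwin
    ![(0, 0), (0, 1), (0, 2), (0, 3), (0, 4), (0, 5), (0, 6), (1, 0), (2, 0), (3, 0), (4, 0),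
      (5, 0), (6, 0), (7, 0), (8, 0), (5, 1), (6, 1), (7, 1), (8, 1)]
    ![(8, 2), (8, 3), (8, 4), (8, 5), (8, 6), (8, 7), (8, 8), (4, 8), (5, 8), (6, 8), (7, 8),
      (0, 7), (1, 7), (2, 7), (3, 7), (0, 8), (1, 8), (2, 8), (3, 8)]
    (by decide) (by decide) (by
      intro i
      fin_cases i
      exacts [hpairA 0, hpairA 1, hpairA 2, hpairA 3, hpairA 4, hpairA 5, hpairA 6, hpairB 1,
        hpairB 2, hpairB 3, hpairB 4, hpairC 0 0, hpairC 1 0, hpairC 2 0, hpairC 3 0, hpairC 0 1,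
        hpairC 1 1, hpairC 2 1, hpairC 3 1])
  omega

/-- A regular hexagon meets at most `63` tiles. -/
theorem tileBound_six (φ : ℝ) : TileBound 6 φ := by
  have hpi := Real.pi_pos
  refine forall_of_symmetries (p := TileBound 6) (δ := Real.pi / 6) (by positivity) ?_ ?_ ?_ ?_ φ
  · intro x h
    -- `π / 6 = π / 2 - π / 3` and `-π / 6 = π / 2 - 2 π / 3`
    refine tileBound_of_rotate (tileBound_of_add (by norm_num) (-1) ?_)
    convert h using 1; push_cast; ring
  · intro x h
    refine tileBound_of_rotate (tileBound_of_add (by norm_num) (-2) ?_)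
    convert h using 1; push_cast; ring
  · exact fun x h => tileBound_of_conj (by norm_num) h
  · intro x h0 h1
    refine tileBound_of_rotate (tileBound_of_add (by norm_num) (-1) ?_)
    convert tileBound_six_aux h0 h1 using 1; push_cast; ring

/-! ### Tiles met by a regular pentagon -/

/-- The diameter of a regular pentagon with circumradius `4`, squared, is `32 (1 + cos (π / 5))`. -/
theorem pentagon_diam {φ : ℝ} {z z' : ℂ} (hz : z ∈ polygon 5 4 φ) (hz' : z' ∈ polygon 5 4 φ) :
    Complex.normSq (z' - z) ≤ 32 * (1 + Real.cos (Real.pi / 5)) := by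
  obtain ⟨_, ⟨i, rfl⟩, _, ⟨j, rfl⟩, h⟩ := convexHull_exists_dist_ge2 hz' hz
  rw [dist_eq_norm, dist_eq_norm] at h
  have h1 := pow_le_pow_left₀ (norm_nonneg _) h 2
  rw [← Complex.normSq_eq_norm_sq, ← Complex.normSq_eq_norm_sq] at h1
  refine h1.trans ?_
  have h2 := cos_odd_mul_le (k := 5) (by norm_num) (2 - ((i : ℤ) - (j : ℤ)))
  have h3 : (2 * ((2 - ((i : ℤ) - (j : ℤ)) : ℤ) : ℝ) + 1) * (Real.pi / (5 : ℕ)) =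
      Real.pi - ((φ + 2 * Real.pi * (i : ℕ) / (5 : ℕ)) -
        (φ + 2 * Real.pi * (j : ℕ) / (5 : ℕ))) := by
    push_cast; ring
  rw [h3, Real.cos_pi_sub, Real.cos_sub] at h2
  rw [Complex.normSq_apply, Complex.sub_re, Complex.sub_im, vertex_re, vertex_re, vertex_im,
    vertex_im]
  push_cast at h2 ⊢
  have h4 := Real.sin_sq_add_cos_sq (φ + 2 * Real.pi * (i : ℕ) / 5)
  have h5 := Real.sin_sq_add_cos_sq (φ + 2 * Real.pi * (j : ℕ) / 5)
  nlinarith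

theorem cos_pi_div_five_bounds : 0.80901 < Real.cos (Real.pi / 5) ∧
    Real.cos (Real.pi / 5) < 0.80902 := by
  rw [Real.cos_pi_div_five]
  have h1 : 2.23606 < √5 := Real.lt_sqrt_of_sq_lt (by norm_num)
  have h2 : √5 < 2.23607 := by rw [Real.sqrt_lt' (by norm_num)]; norm_num
  constructor <;> linarith

theorem sin_pi_div_five_bounds : 0.58778 < Real.sin (Real.pi / 5) ∧
    Real.sin (Real.pi / 5) < 0.58779 := by
  have h0 : 0 < Real.sin (Real.pi / 5) :=
    Real.sin_pos_of_pos_of_lt_pi (by positivity) (by linarith [Real.pi_pos])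
  have h1 := Real.sin_sq_add_cos_sq (Real.pi / 5)
  rw [Real.cos_pi_div_five] at h1
  have h5 : √5 * √5 = 5 := Real.mul_self_sqrt (by norm_num)
  have h2 : 2.236067 < √5 := Real.lt_sqrt_of_sq_lt (by norm_num)
  have h3 : √5 < 2.236068 := by rw [Real.sqrt_lt' (by norm_num)]; norm_num
  have h4 : Real.sin (Real.pi / 5) ^ 2 = 5 / 8 - √5 / 8 := by linarith
  exact ⟨lt_of_pow_lt_pow_left₀ 2 h0.le (by linarith),
    lt_of_pow_lt_pow_left₀ 2 (by norm_num) (by linarith)⟩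

theorem cos_two_pi_div_five : Real.cos (2 * (Real.pi / 5)) = Real.cos (Real.pi / 5) - 1 / 2 := by
  rw [Real.cos_two_mul, Real.cos_pi_div_five]
  have h5 : √5 * √5 = 5 := Real.mul_self_sqrt (by norm_num)
  linarith

theorem sin_two_pi_div_five_bounds : 0.95105 < Real.sin (2 * (Real.pi / 5)) ∧
    Real.sin (2 * (Real.pi / 5)) < 0.95106 := by
  have h0 : 0 < Real.sin (2 * (Real.pi / 5)) :=
    Real.sin_pos_of_pos_of_lt_pi (by positivity) (by linarith [Real.pi_pos])
  have h1 := Real.sin_sq_add_cos_sq (2 * (Real.pi / 5))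
  rw [cos_two_pi_div_five, Real.cos_pi_div_five] at h1
  have h5 : √5 * √5 = 5 := Real.mul_self_sqrt (by norm_num)
  have h2 : 2.236067 < √5 := Real.lt_sqrt_of_sq_lt (by norm_num)
  have h3 : √5 < 2.236068 := by rw [Real.sqrt_lt' (by norm_num)]; norm_num
  have h4 : Real.sin (2 * (Real.pi / 5)) ^ 2 = 5 / 8 + √5 / 8 := by linarith
  exact ⟨lt_of_pow_lt_pow_left₀ 2 h0.le (by linarith),
    lt_of_pow_lt_pow_left₀ 2 (by norm_num) (by linarith)⟩

/-- Bounds for the coordinates of the edge normals of a regular pentagon, linear in the sine `s` of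
the angle `τ ∈ [0, π / 20]` between the horizontal axis and the opposite of a vertex. The letters
stand for `A = cos (π / 5 - τ)`, `B = cos (π / 5 + τ)`, `E = cos (2 π / 5 - τ)`, `E' = cos (2 π / 5
+ τ)` and `A'`, `B'`, `D`, `D'` for the sines of the same angles. -/
structure PentagonBounds (s A A' B B' D D' E E' : ℝ) : Prop where
  s0 : 0 ≤ s
  s1 : s ≤ 0.1571
  A0 : 0.80901 + 0.52289 * s ≤ A
  A1 : A ≤ 0.80902 + 0.58779 * s
  A'0 : 0.58778 - 0.85616 * s ≤ A'
  A'1 : A' ≤ 0.58779 - 0.80901 * s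
  B0 : 0.80901 - 0.65268 * s ≤ B
  B'0 : 0.58778 + 0.76187 * s ≤ B'
  D0 : 0.95105 - 0.38530 * s ≤ D
  D1 : D ≤ 0.95106 - 0.30901 * s
  D'0 : 0.95105 + 0.23273 * s ≤ D'
  D'1 : D' ≤ 0.95106 + 0.30902 * s
  E0 : 0.30901 + 0.92626 * s ≤ E
  E1 : E ≤ 0.30902 + 0.95106 * s
  E'0 : 0.30901 - 0.97585 * s ≤ E'
  E'1 : E' ≤ 0.30902 - 0.95105 * s

theorem pentagonBounds {τ : ℝ} (hτ0 : 0 ≤ τ) (hτ : τ ≤ Real.pi / 10 / 2) :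
    PentagonBounds (Real.sin τ) (Real.cos (Real.pi / 5 - τ)) (Real.sin (Real.pi / 5 - τ))
      (Real.cos (Real.pi / 5 + τ)) (Real.sin (Real.pi / 5 + τ)) (Real.sin (2 * (Real.pi / 5) - τ))
      (Real.sin (2 * (Real.pi / 5) + τ)) (Real.cos (2 * (Real.pi / 5) - τ))
      (Real.cos (2 * (Real.pi / 5) + τ)) := by
  have hpi := Real.pi_lt_d4
  have hs0 : 0 ≤ Real.sin τ := Real.sin_nonneg_of_nonneg_of_le_pi hτ0 (by linarith [Real.pi_pos])
  have hs1 : Real.sin τ ≤ 0.1571 := (Real.sin_le hτ0).trans (by linarith)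
  have hc0 : 0 ≤ Real.cos τ := Real.cos_nonneg_of_mem_Icc ⟨by linarith [Real.pi_pos], by linarith⟩
  have hc := cos_ge_of_sin_le (m := 0.0802) hc0 hs0 hs1 (by norm_num)
  have hc1 := Real.cos_le_one τ
  obtain ⟨hC0, hC1⟩ := cos_pi_div_five_bounds
  obtain ⟨hS0, hS1⟩ := sin_pi_div_five_bounds
  obtain ⟨hK0, hK1⟩ := sin_two_pi_div_five_bounds
  have hL0 : 0.30901 < Real.cos (2 * (Real.pi / 5)) := by rw [cos_two_pi_div_five]; linarith
  have hL1 : Real.cos (2 * (Real.pi / 5)) < 0.30902 := by rw [cos_two_pi_div_five]; linarith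
  simp only [Real.cos_sub, Real.sin_sub, Real.cos_add, Real.sin_add]
  generalize Real.cos (2 * (Real.pi / 5)) = L at *
  generalize Real.sin (2 * (Real.pi / 5)) = K at *
  generalize Real.cos (Real.pi / 5) = C at *
  generalize Real.sin (Real.pi / 5) = S at *
  generalize Real.cos τ = c at *
  generalize Real.sin τ = s at *
  have a1 := mul_le_mul_of_nonneg_right hC0.le hc0
  have a2 := mul_le_mul_of_nonneg_right hC1.le hc0
  have a3 := mul_le_mul_of_nonneg_right hC0.le hs0
  have a4 := mul_le_mul_of_nonneg_right hC1.le hs0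
  have b1 := mul_le_mul_of_nonneg_right hS0.le hc0
  have b2 := mul_le_mul_of_nonneg_right hS1.le hc0
  have b3 := mul_le_mul_of_nonneg_right hS0.le hs0
  have b4 := mul_le_mul_of_nonneg_right hS1.le hs0
  have c1 := mul_le_mul_of_nonneg_right hK0.le hc0
  have c2 := mul_le_mul_of_nonneg_right hK1.le hc0
  have c3 := mul_le_mul_of_nonneg_right hK0.le hs0
  have c4 := mul_le_mul_of_nonneg_right hK1.le hs0
  have d1 := mul_le_mul_of_nonneg_right hL0.le hc0
  have d2 := mul_le_mul_of_nonneg_right hL1.le hc0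
  have d3 := mul_le_mul_of_nonneg_right hL0.le hs0
  have d4 := mul_le_mul_of_nonneg_right hL1.le hs0
  refine ⟨hs0, hs1, ?_, ?_, ?_, ?_, ?_, ?_, ?_, ?_, ?_, ?_, ?_, ?_, ?_, ?_⟩ <;> linarith

namespace PentagonBounds

/-- Let the tiles of a window be indexed from its lower left corner, and let `(X, Y)` be the
position of the centre of the pentagon in the window. The tiles `(0, 2)`, `(1, 1)` and `(2, 0)`,
with upper right corners `(a, b)`, lie beyond the edge with outer normal `-(B, B')`, whose distance
from the centre is `4 cos (π / 5) < 3.23608`. -/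
theorem left_lower {s A A' B B' D D' E E' X Y : ℝ}
    (h : PentagonBounds s A A' B B' D D' E E')
    {a b : ℝ} (hab : a = 1 ∧ b = 3 ∨ a = 2 ∧ b = 2 ∨ a = 3 ∧ b = 1)
    (hX : 8 - 4 * A ≤ X) (hY : 8 - 4 * D ≤ Y) :
    3.23608 < B * (X - a) + B' * (Y - b) := by
  have hx : 4.76392 - 2.35116 * s ≤ X := by linarith [h.A1]
  have hy : 4.19576 + 1.23604 * s ≤ Y := by linarith [h.D1]
  have h0 := h.s0
  have h1 := h.s1
  have hs := mul_nonneg h.s0 (sub_nonneg.2 h.s1)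
  have hs' := mul_nonneg h.s0 h.s0
  have m1 : (0.80901 - 0.65268 * s) * (4.76392 - 2.35116 * s - a) ≤ B * (X - a) :=
    mul_le_mul h.B0 (by linarith)
    (by rcases hab with ⟨rfl, rfl⟩ | ⟨rfl, rfl⟩ | ⟨rfl, rfl⟩ <;> linarith) (by linarith [h.B0])
  have m2 : (0.58778 + 0.76187 * s) * (4.19576 + 1.23604 * s - b) ≤ B' * (Y - b) :=
    mul_le_mul h.B'0 (by linarith)
    (by rcases hab with ⟨rfl, rfl⟩ | ⟨rfl, rfl⟩ | ⟨rfl, rfl⟩ <;> linarith) (by linarith [h.B'0])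
  rcases hab with ⟨rfl, rfl⟩ | ⟨rfl, rfl⟩ | ⟨rfl, rfl⟩ <;> linarith

/-- The tiles `(0, 6)` and `(1, 8)`, with lower right corners `(a, b)`, lie beyond the edge with
outer normal `(-A, A')`. -/
theorem left_upper {s A A' B B' D D' E E' X Y : ℝ}
    (h : PentagonBounds s A A' B B' D D' E E')
    {a b : ℝ} (hab : a = 1 ∧ b = 6 ∨ a = 2 ∧ b = 8)
    (hX : 8 - 4 * A ≤ X) (hY : Y ≤ 1 + 4 * D') :
    3.23608 < A * (X - a) + A' * (b - Y) := by
  have hx : 4.76392 - 2.35116 * s ≤ X := by linarith [h.A1]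
  have hy : Y ≤ 4.80424 + 1.23608 * s := by linarith [h.D'1]
  have h0 := h.s0
  have h1 := h.s1
  have hs := mul_nonneg h.s0 (sub_nonneg.2 h.s1)
  have hs' := mul_nonneg h.s0 h.s0
  have m1 : (0.80901 + 0.52289 * s) * (4.76392 - 2.35116 * s - a) ≤ A * (X - a) :=
    mul_le_mul h.A0 (by linarith)
    (by rcases hab with ⟨rfl, rfl⟩ | ⟨rfl, rfl⟩ <;> linarith) (by linarith [h.A0])
  have m2 : (0.58778 - 0.85616 * s) * (b - (4.80424 + 1.23608 * s)) ≤ A' * (b - Y) :=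
    mul_le_mul h.A'0 (by linarith)
    (by rcases hab with ⟨rfl, rfl⟩ | ⟨rfl, rfl⟩ <;> linarith) (by linarith [h.A'0])
  rcases hab with ⟨rfl, rfl⟩ | ⟨rfl, rfl⟩ <;> linarith

/-- The tile `(6, 0)`, with upper left corner `(6, 1)`, lies beyond the edge with outer normal
`(E, -D)`. -/
theorem right_lower {s A A' B B' D D' E E' X Y : ℝ}
    (h : PentagonBounds s A A' B B' D D' E E')
    (hX : X ≤ 5) (hY : 8 - 4 * D ≤ Y) :
    3.23608 < E * (6 - X) + D * (Y - 1) := by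
  have hy : 4.19576 + 1.23604 * s ≤ Y := by linarith [h.D1]
  have h0 := h.s0
  have h1 := h.s1
  have hs := mul_nonneg h.s0 (sub_nonneg.2 h.s1)
  have hs' := mul_nonneg h.s0 h.s0
  have m1 : (0.30901 + 0.92626 * s) * 1 ≤ E * (6 - X) :=
    mul_le_mul (by linarith [h.E0, h.E1]) (by linarith)
    (by linarith) (by linarith [h.E0, h.E1])
  have m2 : (0.95105 - 0.38530 * s) * (4.19576 + 1.23604 * s - 1) ≤ D * (Y - 1) :=
    mul_le_mul (by linarith [h.D0, h.D1]) (by linarith)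
    (by linarith) (by linarith [h.D0, h.D1])
  linarith [h.A0, h.A1, h.A'0, h.D0, h.D1, h.D'0, h.E0, h.E'0]

/-- The tile `(7, 8)`, with lower left corner `(7, 8)`, lies beyond the edge with outer normal
`(E', D')`. -/
theorem right_upper {s A A' B B' D D' E E' X Y : ℝ}
    (h : PentagonBounds s A A' B B' D D' E E')
    (hX : X ≤ 5) (hY : Y ≤ 1 + 4 * D') :
    3.23608 < E' * (7 - X) + D' * (8 - Y) := by
  have hy : Y ≤ 4.80424 + 1.23608 * s := by linarith [h.D'1]
  have h0 := h.s0
  have h1 := h.s1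
  have hs := mul_nonneg h.s0 (sub_nonneg.2 h.s1)
  have hs' := mul_nonneg h.s0 h.s0
  have m1 : (0.30901 - 0.97585 * s) * 2 ≤ E' * (7 - X) :=
    mul_le_mul (by linarith [h.E'0, h.E'1]) (by linarith)
    (by linarith) (by linarith [h.E'0, h.E'1])
  have m2 : (0.95105 + 0.23273 * s) * (8 - (4.80424 + 1.23608 * s)) ≤ D' * (8 - Y) :=
    mul_le_mul (by linarith [h.D'0, h.D'1]) (by linarith)
    (by linarith) (by linarith [h.D'0, h.D'1])
  linarith [h.A0, h.A1, h.A'0, h.D0, h.D1, h.D'0, h.E0, h.E'0]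

/-- The tile `(5, 0)` lies beyond the edge with outer normal `(E, -D)`, or the tile `(0, 5)` lies
beyond the edge with outer normal `(-A, A')`: a convex combination of the two distances is too
large. -/
theorem right_lower_add_left_upper {s A A' B B' D D' E E' X Y : ℝ}
    (h : PentagonBounds s A A' B B' D D' E E')
    (hX : 8 - 4 * A ≤ X) (hY : 8 - 4 * D ≤ Y) :
    3.23608 < 0.4 * (E * (5 - X) + D * (Y - 1)) + 0.6 * (A * (X - 1) + A' * (5 - Y)) := by
  have hx : 4.76392 - 2.35116 * s ≤ X := by linarith [h.A1]
  have hy : 4.19576 + 1.23604 * s ≤ Y := by linarith [h.D1]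
  have h0 := h.s0
  have h1 := h.s1
  have hs := mul_nonneg h.s0 (sub_nonneg.2 h.s1)
  have hs' := mul_nonneg h.s0 h.s0
  have m1 : (0.6 * (0.80901 + 0.52289 * s) - 0.4 * (0.30902 + 0.95106 * s)) *
      (4.76392 - 2.35116 * s) ≤ (0.6 * A - 0.4 * E) * X :=
    mul_le_mul (by linarith [h.A0, h.A1, h.E0, h.E1]) (by linarith)
    (by linarith) (by linarith [h.A0, h.A1, h.E0, h.E1])
  have m2 : (0.4 * (0.95105 - 0.38530 * s) - 0.6 * (0.58779 - 0.80901 * s)) *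
      (4.19576 + 1.23604 * s) ≤ (0.4 * D - 0.6 * A') * Y :=
    mul_le_mul (by linarith [h.A'0, h.A'1, h.D0, h.D1]) (by linarith)
    (by linarith) (by linarith [h.A'0, h.A'1, h.D0, h.D1])
  linarith [h.A0, h.A1, h.A'0, h.D0, h.D1, h.D'0, h.E0, h.E'0]

/-- The tile `(7, 1)` lies beyond the edge with outer normal `(E, -D)`, or the tile `(6, 8)` lies
beyond the edge with outer normal `(E', D')`. -/
theorem right_lower_add_right_upper {s A A' B B' D D' E E' X Y : ℝ}
    (h : PentagonBounds s A A' B B' D D' E E')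
    (hX : X ≤ 5) (hY : Y ≤ 1 + 4 * D') :
    3.23608 < 0.4 * (E * (7 - X) + D * (Y - 2)) + 0.6 * (E' * (6 - X) + D' * (8 - Y)) := by
  have hy : Y ≤ 4.80424 + 1.23608 * s := by linarith [h.D'1]
  have h0 := h.s0
  have h1 := h.s1
  have hs := mul_nonneg h.s0 (sub_nonneg.2 h.s1)
  have hs' := mul_nonneg h.s0 h.s0
  have m1 : (0.4 * E + 0.6 * E') * X ≤
      (0.4 * (0.30902 + 0.95106 * s) + 0.6 * (0.30902 - 0.95105 * s)) * 5 :=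
    (mul_le_mul_of_nonneg_left hX (by linarith [h.E0, h.E'0])).trans
      (mul_le_mul_of_nonneg_right (by linarith [h.E1, h.E'1]) (by norm_num))
  have m2 : (0.6 * D' - 0.4 * D) * Y ≤ (0.6 * (0.95106 + 0.30902 * s) -
      0.4 * (0.95105 - 0.38530 * s)) * (4.80424 + 1.23608 * s) :=
    (mul_le_mul_of_nonneg_left hy (by linarith [h.D1, h.D'0])).trans
      (mul_le_mul_of_nonneg_right (by linarith [h.D0, h.D'1]) (by linarith))
  linarith [h.A0, h.A1, h.A'0, h.D0, h.D1, h.D'0, h.E0, h.E'0]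

/-- The tile `(8, 1)` lies beyond the edge with outer normal `(E, -D)`, or the tile `(2, 8)` lies
beyond the edge with outer normal `(-A, A')`. -/
theorem far_right_lower_add_left_upper {s A A' B B' D D' E E' X Y : ℝ}
    (h : PentagonBounds s A A' B B' D D' E E')
    (hX : 8 - 4 * A ≤ X) (hY : 8 - 4 * D ≤ Y) :
    3.23608 < 0.5 * (E * (8 - X) + D * (Y - 2)) + 0.5 * (A * (X - 3) + A' * (8 - Y)) := by
  have hx : 4.76392 - 2.35116 * s ≤ X := by linarith [h.A1]
  have hy : 4.19576 + 1.23604 * s ≤ Y := by linarith [h.D1]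
  have h0 := h.s0
  have h1 := h.s1
  have hs := mul_nonneg h.s0 (sub_nonneg.2 h.s1)
  have hs' := mul_nonneg h.s0 h.s0
  have m1 : ((0.80901 + 0.52289 * s) - (0.30902 + 0.95106 * s)) * (4.76392 - 2.35116 * s)
      ≤ (A - E) * X :=
    mul_le_mul (by linarith [h.A0, h.A1, h.E0, h.E1]) (by linarith)
    (by linarith) (by linarith [h.A0, h.A1, h.E0, h.E1])
  have m2 : ((0.95105 - 0.38530 * s) - (0.58779 - 0.80901 * s)) * (4.19576 + 1.23604 * s)
      ≤ (D - A') * Y :=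
    mul_le_mul (by linarith [h.A'0, h.A'1, h.D0, h.D1]) (by linarith)
    (by linarith) (by linarith [h.A'0, h.A'1, h.D0, h.D1])
  linarith [h.A0, h.A1, h.A'0, h.D0, h.D1, h.D'0, h.E0, h.E'0]

end PentagonBounds

/-- `cos x ≤ cos α` if the distance of `x` from the multiples of `2 π` is at least `α`. -/
theorem cos_le_cos_of_far {α x : ℝ} (n : ℤ) (h₀ : 0 ≤ α) (h₁ : α ≤ x - n * (2 * Real.pi))
    (h₂ : x - n * (2 * Real.pi) ≤ 2 * Real.pi - α) : Real.cos x ≤ Real.cos α := by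
  rw [← Real.cos_sub_int_mul_two_pi x n]
  rcases le_total (x - n * (2 * Real.pi)) Real.pi with h | h
  · exact Real.cos_le_cos_of_nonneg_of_le_pi h₀ h h₁
  · rw [← Real.cos_two_pi_sub]
    exact Real.cos_le_cos_of_nonneg_of_le_pi h₀ (by linarith) (by linarith)

/-- The extent of the pentagon in the grid directions. -/
theorem pentagon_coordinates {τ : ℝ} (hτ0 : 0 ≤ τ) (hτ : τ ≤ Real.pi / 10 / 2) {z : ℂ}
    (hz : z ∈ polygon 5 4 (τ + Real.pi)) :
    (z.re ≤ 4 * Real.cos (Real.pi / 5 - τ) ∧ -4 ≤ z.re) ∧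
      z.im ≤ 4 * Real.sin (2 * (Real.pi / 5) - τ) ∧
      -(4 * Real.sin (2 * (Real.pi / 5) + τ)) ≤ z.im := by
  have hpi := Real.pi_pos
  have hv : ∀ j : ℕ, j < 5 → Real.cos (τ + Real.pi + 2 * Real.pi * j / (5 : ℕ)) ≤
        Real.cos (Real.pi / 5 - τ) ∧
      Real.sin (τ + Real.pi + 2 * Real.pi * j / (5 : ℕ)) ≤ Real.sin (2 * (Real.pi / 5) - τ) ∧
      -Real.sin (τ + Real.pi + 2 * Real.pi * j / (5 : ℕ)) ≤ Real.sin (2 * (Real.pi / 5) + τ) := by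
    intro j hj
    rw [← Real.cos_pi_div_two_sub (2 * (Real.pi / 5) - τ),
      ← Real.cos_pi_div_two_sub (2 * (Real.pi / 5) + τ), ← Real.cos_add_pi_div_two,
      ← Real.cos_sub_pi_div_two]
    refine ⟨?_, ?_, ?_⟩
    · interval_cases j
      on_goal 4 => refine cos_le_cos_of_far 1 ?_ ?_ ?_ <;> push_cast <;> linarith
      on_goal 4 => refine cos_le_cos_of_far 1 ?_ ?_ ?_ <;> push_cast <;> linarith
      all_goals refine cos_le_cos_of_far 0 ?_ ?_ ?_ <;> push_cast <;> linarith
    · interval_cases j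
      on_goal 5 => refine cos_le_cos_of_far 1 ?_ ?_ ?_ <;> push_cast <;> linarith
      all_goals refine cos_le_cos_of_far 0 ?_ ?_ ?_ <;> push_cast <;> linarith
    · interval_cases j
      on_goal 3 => refine cos_le_cos_of_far 1 ?_ ?_ ?_ <;> push_cast <;> linarith
      on_goal 3 => refine cos_le_cos_of_far 1 ?_ ?_ ?_ <;> push_cast <;> linarith
      on_goal 3 => refine cos_le_cos_of_far 1 ?_ ?_ ?_ <;> push_cast <;> linarith
      all_goals refine cos_le_cos_of_far 0 ?_ ?_ ?_ <;> push_cast <;> linarith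
  refine ⟨⟨?_, ?_⟩, ?_, ?_⟩
  · have := polygon_le (p := 1) (q := 0) (M := 4 * Real.cos (Real.pi / 5 - τ))
      (fun j hj => by linarith [(hv j hj).1]) hz
    linarith
  · have h := (Complex.abs_re_le_norm z).trans (norm_le_of_mem_polygon (by norm_num) hz)
    exact (abs_le.1 h).1
  · have := polygon_le (p := 0) (q := 1) (M := 4 * Real.sin (2 * (Real.pi / 5) - τ))
      (fun j hj => by linarith [(hv j hj).2.1]) hz
    linarith
  · have := polygon_le (p := 0) (q := -1) (M := 4 * Real.sin (2 * (Real.pi / 5) + τ))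
      (fun j hj => by linarith [(hv j hj).2.2]) hz
    linarith

/-- The inequalities for the four edges other than the one opposite to the vertex at the angle
`τ + π`. -/
theorem pentagon_edges {τ : ℝ} {z : ℂ} (hz : z ∈ polygon 5 4 (τ + Real.pi)) :
    Real.cos (2 * (Real.pi / 5) + τ) * z.re + Real.sin (2 * (Real.pi / 5) + τ) * z.im
        ≤ 4 * Real.cos (Real.pi / 5) ∧
      -Real.cos (Real.pi / 5 - τ) * z.re + Real.sin (Real.pi / 5 - τ) * z.im
        ≤ 4 * Real.cos (Real.pi / 5) ∧
      -Real.cos (Real.pi / 5 + τ) * z.re - Real.sin (Real.pi / 5 + τ) * z.im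
        ≤ 4 * Real.cos (Real.pi / 5) ∧
      Real.cos (2 * (Real.pi / 5) - τ) * z.re - Real.sin (2 * (Real.pi / 5) - τ) * z.im
        ≤ 4 * Real.cos (Real.pi / 5) := by
  have h := fun m => edge_le (by norm_num) (by norm_num) hz m
  push_cast at h
  refine ⟨?_, ?_, ?_, ?_⟩
  · have h1 := h (-2)
    have e : τ + Real.pi + (2 * (-2 : ℤ) + 1) * (Real.pi / 5) = 2 * (Real.pi / 5) + τ := by
      push_cast; ring
    rwa [e] at h1
  · have h1 := h (-1)
    have e : τ + Real.pi + (2 * (-1 : ℤ) + 1) * (Real.pi / 5) = Real.pi - (Real.pi / 5 - τ) := by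
      push_cast; ring
    rwa [e, Real.cos_pi_sub, Real.sin_pi_sub] at h1
  · have h1 := h 0
    have e : τ + Real.pi + (2 * (0 : ℤ) + 1) * (Real.pi / 5) = Real.pi / 5 + τ + Real.pi := by
      push_cast; ring
    rw [e, Real.cos_add_pi, Real.sin_add_pi] at h1
    linarith
  · have h1 := h 1
    have e : τ + Real.pi + (2 * (1 : ℤ) + 1) * (Real.pi / 5) =
        -(2 * (Real.pi / 5) - τ) + 2 * Real.pi := by push_cast; ring
    rw [e, Real.cos_add_two_pi, Real.sin_add_two_pi, Real.cos_neg, Real.sin_neg] at h1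
    linarith

/-- If the tiles lie in `8` rows or in `8` columns, then the diameter of the pentagon excludes one
tile of each of `9` disjoint pairs from the `72` tiles of the window. Otherwise the first and the
last row and column are met, which determines the position of the centre up to a small error; then
`15` of the `81` tiles and one tile of each of `3` further pairs lie beyond the edges. -/
theorem tileBound_five_aux {τ : ℝ} (hτ0 : 0 ≤ τ) (hτ : τ ≤ Real.pi / 10 / 2) :
    TileBound 5 (τ + Real.pi) := by
  intro c S w hw
  rcases S.eq_empty_or_nonempty with rfl | hne
  · simp
  obtain ⟨x₀, y₀, hwin, ⟨sx, hsx, hsx0⟩, sy, hsy, hsy0⟩ := exists_window hw hne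
  -- two tiles that are far apart are not both met
  have hfar : ∀ i ∈ S, ∀ j ∈ S, ∀ p q : ℕ, (p : ℤ) + 1 ≤ |j.1 - i.1| →
      (q : ℤ) + 1 ≤ |j.2 - i.2| → 58 ≤ p ^ 2 + q ^ 2 → False := by
    intro i hi j hj p q hp hq hpq
    obtain ⟨⟨a1, a2⟩, ⟨a3, a4⟩, a5⟩ := hw i hi
    obtain ⟨⟨b1, b2⟩, ⟨b3, b4⟩, b5⟩ := hw j hj
    have h1 := pentagon_diam a5 b5
    have h2 := cos_pi_div_five_bounds.2
    have e : (w j - c) - (w i - c) = w j - w i := by ring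
    rw [e, Complex.normSq_apply, Complex.sub_re, Complex.sub_im] at h1
    have hp' : (p : ℝ) + 1 ≤ |(j.1 : ℝ) - i.1| := by exact_mod_cast hp
    have hq' : (q : ℝ) + 1 ≤ |(j.2 : ℝ) - i.2| := by exact_mod_cast hq
    have h3 : (p : ℝ) ≤ |(w j).re - (w i).re| := by
      rcases le_abs.1 hp' with h | h
      · exact le_abs.2 (Or.inl (by linarith))
      · exact le_abs.2 (Or.inr (by linarith))
    have h4 : (q : ℝ) ≤ |(w j).im - (w i).im| := by
      rcases le_abs.1 hq' with h | h
      · exact le_abs.2 (Or.inl (by linarith))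
      · exact le_abs.2 (Or.inr (by linarith))
    have h5 := pow_le_pow_left₀ (Nat.cast_nonneg p) h3 2
    have h6 := pow_le_pow_left₀ (Nat.cast_nonneg q) h4 2
    rw [sq_abs] at h5 h6
    have h7 : (58 : ℝ) ≤ p ^ 2 + q ^ 2 := by exact_mod_cast hpq
    nlinarith
  by_cases hrow : ∀ s ∈ S, s.2 < y₀ + 8
  · have := card_add_le_of_pairs (m := 9) (n := 8)
      (fun s hs => ⟨(hwin s hs).1, (hwin s hs).2.1, hrow s hs⟩)
      ![(0, 0), (0, 1), (0, 2), (0, 3), (0, 4), (0, 5), (0, 6), (0, 7), (1, 0)]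
      ![(8, 4), (8, 5), (8, 6), (8, 7), (8, 0), (8, 1), (8, 2), (8, 3), (7, 7)]
      (by decide) (by decide) (by
        intro i h h'
        fin_cases i
        on_goal 9 => exact hfar _ h _ h' 5 6 (by simp) (by simp) (by norm_num)
        all_goals exact hfar _ h _ h' 7 3 (by simp) (by simp) (by norm_num))
    omega
  by_cases hcol : ∀ s ∈ S, s.1 < x₀ + 8
  · have := card_add_le_of_pairs (m := 8) (n := 9)
      (fun s hs => ⟨⟨(hwin s hs).1.1, hcol s hs⟩, (hwin s hs).2⟩)
      ![(0, 0), (1, 0), (2, 0), (3, 0), (4, 0), (5, 0), (6, 0), (7, 0), (0, 1)]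
      ![(4, 8), (5, 8), (6, 8), (7, 8), (0, 8), (1, 8), (2, 8), (3, 8), (7, 7)]
      (by decide) (by decide) (by
        intro i h h'
        fin_cases i
        on_goal 9 => exact hfar _ h _ h' 6 5 (by simp) (by simp) (by norm_num)
        all_goals exact hfar _ h _ h' 3 7 (by simp) (by simp) (by norm_num))
    omega
  push Not at hrow hcol
  obtain ⟨ty, hty, hty0⟩ := hrow
  obtain ⟨tx, htx, htx0⟩ := hcol
  have hb := pentagonBounds hτ0 hτ
  have hcoord := fun s hs => pentagon_coordinates hτ0 hτ (hw s hs).2.2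
  have hC := cos_pi_div_five_bounds.2
  have hedge := fun s hs => pentagon_edges (hw s hs).2.2
  generalize Real.cos (Real.pi / 5 - τ) = A at *
  generalize Real.sin (Real.pi / 5 - τ) = A' at *
  generalize Real.cos (Real.pi / 5 + τ) = B at *
  generalize Real.sin (Real.pi / 5 + τ) = B' at *
  generalize Real.sin (2 * (Real.pi / 5) - τ) = D at *
  generalize Real.sin (2 * (Real.pi / 5) + τ) = D' at *
  generalize Real.cos (2 * (Real.pi / 5) - τ) = E at *
  generalize Real.cos (2 * (Real.pi / 5) + τ) = E' at *
  -- the position of the centre in the window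
  obtain ⟨X, hX⟩ : ∃ X : ℝ, X = c.re - x₀ := ⟨_, rfl⟩
  obtain ⟨Y, hY⟩ : ∃ Y : ℝ, Y = c.im - y₀ := ⟨_, rfl⟩
  simp only [Complex.sub_re, Complex.sub_im] at hcoord hedge
  have hX0 : 8 - 4 * A ≤ X := by
    have h1 : (x₀ : ℝ) + 8 ≤ tx.1 := by exact_mod_cast htx0
    linarith [(hcoord tx htx).1.1, (hw tx htx).1.1]
  have hX1 : X ≤ 5 := by
    have h1 : (sx.1 : ℝ) = x₀ := by exact_mod_cast hsx0
    linarith [(hcoord sx hsx).1.2, (hw sx hsx).1.2]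
  have hY0 : 8 - 4 * D ≤ Y := by
    have h1 : (y₀ : ℝ) + 8 ≤ ty.2 := by exact_mod_cast hty0
    linarith [(hcoord ty hty).2.1, (hw ty hty).2.1.1]
  have hY1 : Y ≤ 1 + 4 * D' := by
    have h1 : (sy.2 : ℝ) = y₀ := by exact_mod_cast hsy0
    linarith [(hcoord sy hsy).2.2, (hw sy hsy).2.1.2]
  have hs0 := hb.s0
  have hs1 := hb.s1
  have key : ∀ a b : ℕ, (x₀ + a, y₀ + b) ∈ S →
      (E' * (a - X) + D' * (b - Y) ≤ 3.23608 ∧ A * (X - (a + 1)) + A' * (b - Y) ≤ 3.23608) ∧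
      B * (X - (a + 1)) + B' * (Y - (b + 1)) ≤ 3.23608 ∧
      E * (a - X) + D * (Y - (b + 1)) ≤ 3.23608 := by
    intro a b h
    obtain ⟨⟨a1, a2⟩, ⟨a3, a4⟩, -⟩ := hw _ h
    obtain ⟨h1, h2, h3, h4⟩ := hedge _ h
    push_cast at a1 a2 a3 a4
    generalize w (x₀ + a, y₀ + b) = v at *
    have hx0 : a - X ≤ v.re - c.re := by linarith
    have hx1 : X - (a + 1) ≤ -(v.re - c.re) := by linarith
    have hy0 : b - Y ≤ v.im - c.im := by linarith
    have hy1 : Y - (b + 1) ≤ -(v.im - c.im) := by linarith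
    refine ⟨⟨?_, ?_⟩, ?_, ?_⟩
    · linarith [mul_le_mul_of_nonneg_left hx0 (show 0 ≤ E' by linarith [hb.E'0]),
        mul_le_mul_of_nonneg_left hy0 (show 0 ≤ D' by linarith [hb.D'0])]
    · linarith [mul_le_mul_of_nonneg_left hx1 (show 0 ≤ A by linarith [hb.A0]),
        mul_le_mul_of_nonneg_left hy0 (show 0 ≤ A' by linarith [hb.A'0])]
    · linarith [mul_le_mul_of_nonneg_left hx1 (show 0 ≤ B by linarith [hb.B0]),
        mul_le_mul_of_nonneg_left hy1 (show 0 ≤ B' by linarith [hb.B'0])]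
    · linarith [mul_le_mul_of_nonneg_left hx0 (show 0 ≤ E by linarith [hb.E0]),
        mul_le_mul_of_nonneg_left hy1 (show 0 ≤ D by linarith [hb.D0])]
  -- single tiles beyond one of the edges
  have hn1 : ∀ a b : ℕ, 7 ≤ a → 8 ≤ b → (x₀ + a, y₀ + b) ∉ S := by
    intro a b ha hb' h
    have ha' : (7 : ℝ) ≤ a := by exact_mod_cast ha
    have hb'' : (8 : ℝ) ≤ b := by exact_mod_cast hb'
    linarith [(key a b h).1.1, hb.right_upper hX1 hY1,
      mul_le_mul_of_nonneg_left ha' (show 0 ≤ E' by linarith [hb.E'0]),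
      mul_le_mul_of_nonneg_left hb'' (show 0 ≤ D' by linarith [hb.D'0])]
  have hn4 : ∀ a : ℕ, 6 ≤ a → (x₀ + a, y₀ + (0 : ℕ)) ∉ S := by
    intro a ha h
    have ha' : (6 : ℝ) ≤ a := by exact_mod_cast ha
    have h4 := (key a 0 h).2.2
    push_cast at h4
    linarith [hb.right_lower hX1 hY0,
      mul_le_mul_of_nonneg_left ha' (show 0 ≤ E by linarith [hb.E0])]
  have hn2 : ∀ a b : ℕ, a = 0 ∧ 6 ≤ b ∨ a = 1 ∧ 8 ≤ b → (x₀ + a, y₀ + b) ∉ S := by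
    intro a b hab h
    have h2 := (key a b h).1.2
    have hA' : 0 ≤ A' := by linarith [hb.A'0]
    rcases hab with ⟨rfl, hb'⟩ | ⟨rfl, hb'⟩
    · have hb'' : (6 : ℝ) ≤ b := by exact_mod_cast hb'
      push_cast at h2
      linarith [hb.left_upper (Or.inl ⟨rfl, rfl⟩) hX0 hY1, mul_le_mul_of_nonneg_left hb'' hA']
    · have hb'' : (8 : ℝ) ≤ b := by exact_mod_cast hb'
      push_cast at h2
      linarith [hb.left_upper (Or.inr ⟨rfl, rfl⟩) hX0 hY1, mul_le_mul_of_nonneg_left hb'' hA']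
  have hn3 : ∀ a b : ℕ, a + b ≤ 2 → (x₀ + a, y₀ + b) ∉ S := by
    intro a b hab h
    have h3 := (key a b h).2.1
    have hB' : 0 ≤ B' := by linarith [hb.B'0]
    have ha : a ≤ 2 := by omega
    have hb' : (b : ℝ) + 1 ≤ 3 - a := by
      have : (a : ℝ) + b ≤ 2 := by exact_mod_cast hab
      linarith
    have hb'' := mul_le_mul_of_nonneg_left hb' hB'
    interval_cases a
    · push_cast at h3 hb''
      linarith [hb.left_lower (Or.inl ⟨rfl, rfl⟩) hX0 hY0]
    · push_cast at h3 hb''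
      linarith [hb.left_lower (Or.inr (Or.inl ⟨rfl, rfl⟩)) hX0 hY0]
    · push_cast at h3 hb''
      linarith [hb.left_lower (Or.inr (Or.inr ⟨rfl, rfl⟩)) hX0 hY0]
  -- pairs of tiles of which one lies beyond an edge
  have hp1 : (x₀ + (5 : ℕ), y₀ + (0 : ℕ)) ∈ S → (x₀ + (0 : ℕ), y₀ + (5 : ℕ)) ∉ S := by
    intro h h'
    have h1 := (key _ _ h).2.2
    have h2 := (key _ _ h').1.2
    push_cast at h1 h2
    linarith [hb.right_lower_add_left_upper hX0 hY0]
  have hp2 : (x₀ + (7 : ℕ), y₀ + (1 : ℕ)) ∈ S → (x₀ + (6 : ℕ), y₀ + (8 : ℕ)) ∉ S := by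
    intro h h'
    have h1 := (key _ _ h).2.2
    have h2 := (key _ _ h').1.1
    push_cast at h1 h2
    linarith [hb.right_lower_add_right_upper hX1 hY1]
  have hp3 : (x₀ + (8 : ℕ), y₀ + (1 : ℕ)) ∈ S → (x₀ + (2 : ℕ), y₀ + (8 : ℕ)) ∉ S := by
    intro h h'
    have h1 := (key _ _ h).2.2
    have h2 := (key _ _ h').1.2
    push_cast at h1 h2
    linarith [hb.far_right_lower_add_left_upper hX0 hY0]
  have := card_add_le_of_pairs (m := 9) (n := 9) hwin
    ![(7, 8), (8, 8), (6, 0), (7, 0), (8, 0), (0, 6), (0, 7), (0, 8), (1, 8), (0, 0), (0, 1),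
      (0, 2), (1, 0), (1, 1), (2, 0), (5, 0), (7, 1), (8, 1)]
    ![(7, 8), (8, 8), (6, 0), (7, 0), (8, 0), (0, 6), (0, 7), (0, 8), (1, 8), (0, 0), (0, 1),
      (0, 2), (1, 0), (1, 1), (2, 0), (0, 5), (6, 8), (2, 8)]
    (by decide) (by decide) (by
      intro i
      fin_cases i
      exacts [fun _ => hn1 7 8 (by norm_num) (by norm_num),
        fun _ => hn1 8 8 (by norm_num) (by norm_num), fun _ => hn4 6 (by norm_num),
        fun _ => hn4 7 (by norm_num), fun _ => hn4 8 (by norm_num), fun _ => hn2 0 6 (by norm_num),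
        fun _ => hn2 0 7 (by norm_num), fun _ => hn2 0 8 (by norm_num),
        fun _ => hn2 1 8 (by norm_num), fun _ => hn3 0 0 (by norm_num),
        fun _ => hn3 0 1 (by norm_num), fun _ => hn3 0 2 (by norm_num),
        fun _ => hn3 1 0 (by norm_num), fun _ => hn3 1 1 (by norm_num),
        fun _ => hn3 2 0 (by norm_num), hp1, hp2, hp3])
  omega

/-- A regular pentagon meets at most `63` tiles. -/
theorem tileBound_five (φ : ℝ) : TileBound 5 φ := by
  have hpi := Real.pi_pos
  refine forall_of_symmetries (p := TileBound 5) (δ := Real.pi / 10) (by positivity) ?_ ?_ ?_ ?_ φ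
  · intro x h
    -- `π / 10 = π / 2 - 2 π / 5`
    refine tileBound_of_rotate (tileBound_of_add (by norm_num) (-1) ?_)
    convert h using 1; push_cast; ring
  · intro x h
    -- `- π / 10 = 3 π / 2 - 8 π / 5`
    refine tileBound_of_rotate (tileBound_of_rotate (tileBound_of_rotate
      (tileBound_of_add (by norm_num) (-4) ?_)))
    convert h using 1; push_cast; ring
  · exact fun x h => tileBound_of_conj (by norm_num) h
  · intro x h0 h1
    refine tileBound_of_rotate (tileBound_of_rotate ?_)
    convert tileBound_five_aux h0 h1 using 1; ring

/-! ### The number of tiles met by a translate -/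

open Filter Topology in
/-- The bound for open tiles implies the bound for half-open tiles: a small translation moves
finitely many points of half-open tiles into the interiors of these tiles. -/
theorem TileBound.card_le {k : ℕ} {φ : ℝ} (h : TileBound k φ) {c : ℂ} {S : Finset (ℤ × ℤ)}
    {w : ℤ × ℤ → ℂ} (hw : ∀ s ∈ S, (s.1 ≤ (w s).re ∧ (w s).re < s.1 + 1) ∧
      (s.2 ≤ (w s).im ∧ (w s).im < s.2 + 1) ∧ w s - c ∈ polygon k 4 φ) : S.card ≤ 63 := by
  have hev : ∀ᶠ η : ℝ in 𝓝[>] 0, ∀ s ∈ S, (w s).re + η < s.1 + 1 ∧ (w s).im + η < s.2 + 1 := by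
    refine (Finset.eventually_all S).2 fun s hs => ?_
    have h0 : ∀ x y : ℝ, x < y → ∀ᶠ η : ℝ in 𝓝[>] 0, x + η < y := fun x y hxy =>
      nhdsWithin_le_nhds ((eventually_lt_nhds (sub_pos.2 hxy)).mono fun η hη => by linarith)
    exact (h0 _ _ (hw s hs).1.2).and (h0 _ _ (hw s hs).2.1.2)
  obtain ⟨η, hη, hη0⟩ := (hev.and self_mem_nhdsWithin).exists
  refine h (c + ⟨η, η⟩) S (fun s => w s + ⟨η, η⟩) fun s hs => ?_
  obtain ⟨⟨h1, -⟩, ⟨h2, -⟩, h3⟩ := hw s hs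
  rw [add_sub_add_right_eq_sub, Complex.add_re, Complex.add_im]
  exact ⟨⟨by linarith, (hη s hs).1⟩, ⟨by linarith, (hη s hs).2⟩, h3⟩

theorem card_le_of_forall_mem_tile {k : ℕ} {R : ℝ} (hR : 0 < R) {φ : ℝ} {u : ℂ} (hu : ‖u‖ = 1)
    (a c : ℂ) (S : Finset (ℤ × ℤ)) (hS : ∀ s ∈ S, (copyAt (polygon k R φ) c ∩
      tile (tileSide k R) u a s).Nonempty) : S.card ≤ 63 := by
  have hu0 : u ≠ 0 := norm_ne_zero_iff.1 (by rw [hu]; exact one_ne_zero)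
  choose! w hwc hwt using hS
  simp only [mem_copyAt] at hwc
  have hsplit : ∀ s, (w s - a) / u = (w s - c) / u + (c - a) / u := fun s => by
    rw [← add_div, sub_add_sub_cancel]
  by_cases hk : k = 5 ∨ k = 6
  · -- after a rotation and a scaling, the tiles are unit squares and the circumradius is `4`
    have hℓ : tileSide k R = R / 4 := if_pos hk
    have hb : TileBound k (φ + -Complex.arg u) := by
      rcases hk with rfl | rfl
      · exact tileBound_five _
      · exact tileBound_six _
    have hexp : Complex.exp ((-Complex.arg u : ℝ) * Complex.I) = u⁻¹ := by
      have := Complex.norm_mul_exp_arg_mul_I u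
      rw [hu, Complex.ofReal_one, one_mul] at this
      rw [Complex.ofReal_neg, neg_mul, Complex.exp_neg, this]
    have hR4 : 4 / R * R = 4 := by field_simp
    refine hb.card_le (c := (4 / R : ℝ) * ((c - a) / u))
      (w := fun s => (4 / R : ℝ) * ((w s - a) / u)) fun s hs => ?_
    have h := hwt s hs
    simp only [tile, Set.mem_ofPred_eq, hℓ] at h
    obtain ⟨h1, h2, h3, h4⟩ := h
    have h0 : (0 : ℝ) < 4 / R := by positivity
    simp only [Complex.re_ofReal_mul, Complex.im_ofReal_mul]
    have key : ∀ x y : ℝ, (x * (R / 4) ≤ y → x ≤ 4 / R * y) ∧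
        (y < x * (R / 4) → 4 / R * y < x) := by
      intro x y
      have e : x = 4 / R * (x * (R / 4)) := by field_simp
      exact ⟨fun h => e ▸ mul_le_mul_of_nonneg_left h h0.le,
        fun h => e ▸ mul_lt_mul_of_pos_left h h0⟩
    refine ⟨⟨(key _ _).1 h1, (key _ _).2 h2⟩, ⟨(key _ _).1 h3, (key _ _).2 h4⟩, ?_⟩
    have := mul_mem_polygon (4 / R) (-Complex.arg u) (hwc s hs)
    rw [hexp, hR4] at this
    convert this using 1
    rw [hsplit]
    ring
  · have hℓ : tileSide k R = R / 2 := if_neg hk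
    set x := ((c - a) / u).re / (R / 2) with hx
    set y := ((c - a) / u).im / (R / 2) with hy
    -- the circumradius is two side lengths, so that at most `5` rows and `5` columns are met
    have hsub : S ⊆ Finset.Ioc (⌊x⌋ - 3) (⌊x⌋ + 2) ×ˢ Finset.Ioc (⌊y⌋ - 3) (⌊y⌋ + 2) := by
      intro s hs
      have h := hwt s hs
      simp only [tile, Set.mem_ofPred_eq, hℓ, hsplit, Complex.add_re, Complex.add_im] at h
      obtain ⟨h1, h2, h3, h4⟩ := h
      obtain ⟨h5, h6⟩ := abs_re_le_of_mem_polygon hR hu (hwc s hs)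
      rw [abs_le] at h5 h6
      have hx' : ((c - a) / u).re = x * (R / 2) := by rw [hx]; field_simp
      have hy' : ((c - a) / u).im = y * (R / 2) := by rw [hy]; field_simp
      rw [hx'] at h1 h2
      rw [hy'] at h3 h4
      have key : ∀ (n : ℤ) (t b : ℝ), -R ≤ b → b ≤ R → n * (R / 2) ≤ b + t * (R / 2) →
          b + t * (R / 2) < (n + 1) * (R / 2) → n ∈ Finset.Ioc (⌊t⌋ - 3) (⌊t⌋ + 2) := by
        intro n t b hb1 hb2 hn1 hn2
        have e1 : (n : ℝ) ≤ t + 2 := by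
          by_contra! hlt
          nlinarith
        have e2 : t < n + 3 := by
          by_contra! hlt
          nlinarith
        have e3 : n - 2 ≤ ⌊t⌋ := Int.le_floor.2 (by push_cast; linarith)
        have e4 : ⌊t⌋ < n + 3 := Int.floor_lt.2 (by push_cast; linarith)
        rw [Finset.mem_Ioc]
        omega
      exact Finset.mem_product.2 ⟨key _ _ _ h5.1 h5.2 h1 h2, key _ _ _ h6.1 h6.2 h3 h4⟩
    have := Finset.card_le_card hsub
    rw [Finset.card_product, Int.card_Ioc, Int.card_Ioc] at this
    have e : ∀ n : ℤ, (n + 2 - (n - 3)).toNat = 5 := fun n => by omega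
    rw [e, e] at this
    omega

theorem Preprocessing.maxTiles_le {k : ℕ} {R φ : ℝ} {P : Finset ℂ} {u : ℂ} (hR : 0 < R)
    (hu : ‖u‖ = 1) (D : Preprocessing k R φ P u) : D.maxTiles ≤ 63 := by
  refine iSup_le fun c => ?_
  by_contra! hlt
  obtain ⟨T, hT, hTcard⟩ := Set.exists_subset_encard_eq (Order.add_one_le_of_lt hlt)
  have hfin : T.Finite := Set.finite_of_encard_eq_coe (k := 64) (by rw [hTcard]; norm_num)
  have h := card_le_of_forall_mem_tile hR hu D.a c hfin.toFinset
    fun s hs => hT (hfin.mem_toFinset.1 hs)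
  have h' : (hfin.toFinset.card : ℕ∞) ≤ 63 := by exact_mod_cast h
  rw [← hfin.encard_eq_coe_toFinset_card, hTcard] at h'
  exact absurd h' (by norm_num)

end OnlineHitting

theorem mainTheorem5 (k : ℕ) (hk : 4 ≤ k) (R : ℝ) (hR : 0 < R) (φ : ℝ) (P : Finset ℂ)
    (u : ℂ) (hu : OnlineHitting.GridDirection k R φ u) :
    Nonempty (OnlineHitting.Preprocessing k R φ P u) ∧
      ∀ D : OnlineHitting.Preprocessing k R φ P u,
        D.maxTiles ≤ 63 ∧
        ∀ I : List ℂ,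
          OnlineHitting.IsHittingSet (OnlineHitting.polygon k R φ) P I (D.run I) ∧
          ∀ H : Finset ℂ, OnlineHitting.IsHittingSet (OnlineHitting.polygon k R φ) P I H →
            ((D.run I).card : ℕ∞) ≤
              4 * D.maxTiles * (Nat.log 2 (2 * P.card) : ℕ∞) * (H.card : ℕ∞) :=
  ⟨OnlineHitting.nonempty_preprocessing hR φ P hu.1, fun D => ⟨D.maxTiles_le hR hu.1, fun I =>
    ⟨D.isHittingSet_run hk hR hu I, fun _ hH => D.card_run_le hk hR hu I hH⟩⟩⟩
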